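/- **Setting.** A (strict) Krein space is a space $V=V_+\oplus V_-$ with inner product $g$, complete positive definite on $V_+$, complete negative definite on $V_-$; $I=\pm1$ on $V_\pm$, $[v]\in\{0,1\}$ is the signature, an ON-basis is a union of ON-bases of $V_+$ and $V_-$ (up to sign of $g$), and $\langle\!\langle I\cdot,\cdot\rangle\!\rangle$ is the Hilbert majorant. Isomorphisms of Krein spaces respect these decompositions. Consider a spacetime system (oriented hypersurfaces $\Sigma$, regions $M$ with boundary $\partial M$, orientation reversal $\Sigma\mapsto\overline\Sigma$, $M\mapsto\overline M$ with $\partial\overline M=\overline{\partial M}$, decompositions $\Sigma=\Sigma_1\cup\dots\cup\Sigma_n$) and a fermionic classical free field theory on it: separable real Krein spaces $(L_\Sigma,g_\Sigma)$; an identification $L_\Sigma\cong L_{\overline\Sigma}$ with $g_{\overline\Sigma}=-g_\Sigma$, exchanging positive and negative parts; isomorphisms of Krein spaces $L_{\Sigma_1}\oplus\dots\oplus L_{\Sigma_n}\cong L_\Sigma$ for decompositions, compatible with orientation reversal; and for each region an orientation independent real solution space $L_M$ with a linear map $r_M:L_M\to L_{\partial M}$ whose image is hypermaximal neutral (equal to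 its own $g$-orthogonal complement). Let $u_M$ be the unique linear involution of $L_{\partial M}$ that is the identity on $r_M(L_M)$, exchanges the positive and negative parts, and satisfies $g(u_Mx,u_My)=-g(x,y)$. (The gluing axiom of the classical theory is not needed.) Let a subcollection of *polarized* hypersurfaces be closed under orientation reversal and contain every hypersurface having a decomposition into polarized ones, and suppose that polarized hypersurfaces carry complex structures satisfying (C1+)–(C5+): $J_\Sigma^2=-1$, $J_\Sigma$ preserves $g_\Sigma$ and $L_\Sigma=L_{\Sigma,+}\oplus L_{\Sigma,-}$; $J_{\overline\Sigma}=-J_\Sigma$; $J_\Sigma=J_{\Sigma_1}+\dots+J_{\Sigma_n}$ for decompositions into polarized hypersurfaces; and $J_{\partial M}u_M=-u_MJ_{\partial M}$ if $\partial M$ is polarized. **FFR quantization.** $\mathcal D^{\mathbb R}_\Sigma$ is the real Fock space of $L_\Sigma$: sequences $\sigma=(\sigma_n)_{n\ge0}$ of continuous completely anti-symmetric $n$-linear maps $L_\Sigma^n\to\mathbb R$ with $\sum_n n!\sum_{i_1,\dots,i_n}|\sigma_n(\zeta_{i_1},\dots,\zeta_{i_n})|^2<\infty$, with Krein inner product $\langle\!\langle\sigma',\sigma\rangle\!\rangle_\Sigma=\sum_n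 n!\sum_{i_1,\dots,i_n}(-1)^{[\zeta_{i_1}]+\dots+[\zeta_{i_n}]}\,\overline{\sigma'_n(\zeta_{i_1},\dots)}\,\sigma_n(\zeta_{i_1},\dots)$ for any ON-basis $\zeta$, and f-grading by the parity of $n$ (written $|\sigma|$). $\mathcal D_\Sigma$ is its complexification (complex valued functions). $\mathcal D_\Sigma$ and $\mathcal D_{\overline\Sigma}$ are identified by reversing the order of the arguments. For a decomposition, $\tau^*(\sigma_1\otimes\dots\otimes\sigma_n)$ is the anti-symmetrized product (anti-symmetrizer $\frac1{N!}\sum_\pi(-1)^{|\pi|}$ in degree $N$) of the $\sigma_i$ pulled back to $L_\Sigma$. The probability map is $$A_M(\sigma)=\sum_{n}\frac{(2n)!}{2^n n!}(-1)^n\sum_{i_1,\dots,i_n}(-1)^{[\zeta_{i_1}]+\dots+[\zeta_{i_n}]}\sigma_{2n}(\zeta_{i_1},\dots,\zeta_{i_n},u_M\zeta_{i_n},\dots,u_M\zeta_{i_1}),$$ with domain the $\sigma$ for which, for every ON-basis $\zeta$ of $L_{\partial M}$, the sum over all $n$ and all multi-indices converges unconditionally, with a value that does not depend on $\zeta$.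 **FFA quantization and its modulus square.** For $\Sigma$ polarized, $\mathcal H_\Sigma\subseteq\mathcal D_\Sigma$ is the space of the elements that are $J_\Sigma$-complex-linear (holomorphic) in every argument, with the same inner product formula; $\iota_\Sigma:\mathcal H_\Sigma\to\mathcal H_{\overline\Sigma}$ is $(\iota_\Sigma\psi)(\xi_1,\dots,\xi_n)=\overline{\psi(\xi_n,\dots,\xi_1)}$; $\tau$ and $\rho_M$ are given by the same formulas as $\tau^*$ and $A_M$. The twisted modulus square is the completed tensor product $\mathcal H_\Sigma\hat\otimes\mathcal H_{\overline\Sigma}$ with - inner product $\langle\psi',\psi\rangle_\Sigma(-1)^{|\eta'||\eta|}\langle\eta',\eta\rangle_{\overline\Sigma}$ on $\psi'\otimes\eta',\psi\otimes\eta$, and bigrading $\mathcal D_{\Sigma,ij}=\mathcal H_{\Sigma,i}\hat\otimes\mathcal H_{\overline\Sigma,j}$; - orientation reversal $\psi\otimes\eta\mapsto\eta\otimes\psi$ and real structure $\overline{\psi\otimes\eta}=(-1)^{|\psi||\eta|}\iota_{\overline\Sigma}(\eta)\otimes\iota_\Sigma(\psi)$; - $\tau^*\big((\psi_1\otimes\eta_1)\otimes\dots\otimes(\psi_n\otimes\eta_n)\big)=(-1)^{\sum_{i<j}(|\eta_i||\psi_j|+|\eta_i||\eta_j|)}\,\tau(\psi_1\otimes\dots\otimes\psi_n)\otimes\tau(\eta_1\otimes\dots\otimes\eta_n)$;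 - probability map $A_M(\psi\otimes\eta)=\rho_M(\psi)\rho_{\overline M}(\eta)$ on the algebraic tensor product of the domains of $\rho_M$ and $\rho_{\overline M}$; - positive elements $\mathcal D^+_{\Sigma,00}$: those elements of $\mathcal D_{\Sigma,00}$ that are positive as operators on $\mathcal H_\Sigma$ via $(\psi\otimes\eta)\xi=\psi\,\langle I\iota_{\overline\Sigma}(\eta),\xi\rangle_\Sigma$. **Theorem.** For every polarized $\Sigma$ the decomposition into holomorphic and anti-holomorphic parts, $$\psi\otimes\eta\ \mapsto\ \sigma_n(\xi_1,\dots,\xi_n)=\sum_{k=0}^n\frac1{n!}\sum_{\pi\in S^n}(-1)^{|\pi|}\psi_k(\xi_{\pi(1)},\dots,\xi_{\pi(k)})\,\eta_{n-k}(\xi_{\pi(n)},\dots,\xi_{\pi(k+1)}),$$ extends to an isometric isomorphism $\mathcal H_\Sigma\hat\otimes\mathcal H_{\overline\Sigma}\to\mathcal D_\Sigma$ (for the Hilbert majorants). Under it the following structures of the complexified FFR quantization and of the twisted modulus square of the FFA quantization coincide: the Krein inner products, the identifications for opposite orientations, the real structures, and the maps $\tau^*$ for decompositions into polarized hypersurfaces.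 For each region $M$ with polarized boundary the two probability maps agree on every element that lies in both domains, and these elements are dense in $\mathcal D_{\partial M}$. Moreover: - (R1+) The bigrading decomposes $\mathcal D_\Sigma$ into mutually orthogonal Krein subspaces and combines to the f-grading: $\mathcal D_{\Sigma,00}\oplus\mathcal D_{\Sigma,11}$ is the even and $\mathcal D_{\Sigma,01}\oplus\mathcal D_{\Sigma,10}$ the odd part. Complex conjugation maps $\mathcal D_{\Sigma,ij}$ to $\mathcal D_{\Sigma,ji}$, and the even part of $\mathcal D^{\mathbb R}_\Sigma$ is $\mathcal D^{\mathbb R}_{\Sigma,00}\oplus\mathcal D^{\mathbb R}_{\Sigma,11}$. The set $\mathcal D^+_{\Sigma,00}$ is a generating proper cone in $\mathcal D^{\mathbb R}_{\Sigma,00}$, making it an Archimedean ordered vector space, and $\langle\!\langle I\sigma',\sigma\rangle\!\rangle_\Sigma\ge0$ for $\sigma,\sigma'\in\mathcal D^+_{\Sigma,00}$. - (R2+) If a polarized $\Sigma$ decomposes into polarized $\Sigma_1,\dots,\Sigma_n$ and $\sigma_i\in\mathcal D^+_{\Sigma_i,00}$ for all $i$, then $\tau^*(\sigma_1\otimes\dots\otimes\sigma_n)\in\mathcal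 D^+_{\Sigma,00}$. If in addition all $\sigma_i$ lie in the Krein-positive parts ($I\sigma_i=\sigma_i$), then so does $\tau^*(\sigma_1\otimes\dots\otimes\sigma_n)$. - (R4+) If $\partial M$ is polarized, then $A_M(\sigma)\ge0$ for all $\sigma\in\mathcal D^+_{\partial M,00}$ in the domain of $A_M$, and $A_M(\sigma)=0$ for all $\sigma\in\mathcal D^{\mathbb R}_{\partial M,11}$ in the domain of $A_M$. -/

import Mathlib

open scoped TensorProduct ENNReal

noncomputable section

namespace FermionGBF

universe u v w

/-! ### Krein spaces -/

/-- A (strict) Krein space, presented by its Hilbert space majorant together with the map `I`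
(here `fund`) which is the identity on the positive part and minus the identity on the negative
part. The positive and negative parts are the two eigenspaces of `I`. -/
class KreinSpace (V : Type u) [NormedAddCommGroup V] [InnerProductSpace ℝ V] where
  complete : CompleteSpace V
  fund : V ≃ₗᵢ[ℝ] V
  fund_fund : ∀ x, fund (fund x) = x

attribute [instance] KreinSpace.complete

section Krein

variable {V : Type u} [NormedAddCommGroup V] [InnerProductSpace ℝ V] [KreinSpace V]

/-- The map `I`. -/
def fund : V ≃ₗᵢ[ℝ] V := KreinSpace.fund

@[simp] theorem fund_fund (x : V) : fund (fund x) = x := KreinSpace.fund_fund x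

/-- The indefinite inner product `g` of a Krein space. -/
def kip (x y : V) : ℝ := inner ℝ (fund x) y

/-- An ON-basis of a Krein space: an ON-basis of the positive part together with an ON-basis of
the negative part. For `ζ` in such a basis, `kip ζ ζ = (-1) ^ [ζ]`. -/
def IsONBasis {ι : Type u} (b : HilbertBasis ι ℝ V) : Prop :=
  ∀ i, fund (b i) = b i ∨ fund (b i) = -b i

/-- A subspace is hypermaximal neutral if it equals its own orthogonal complement for `g`. -/
def IsHypermaximalNeutral (N : Submodule ℝ V) : Prop :=
  ∀ x, x ∈ N ↔ ∀ y ∈ N, kip x y = 0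

/-- The map `u` attached to a hypermaximal neutral subspace: the orthogonal reflection
in it with respect to the majorant, characterized in `uMap_unique`. -/
def uMap (N : Submodule ℝ V) : V →ₗ[ℝ] V :=
  (N.topologicalClosure.reflection).toLinearEquiv.toLinearMap

theorem fund_inner (x y : V) : inner ℝ (fund x) y = inner ℝ x (fund y) := by
  rw [← (fund (V := V)).inner_map_map (fund x) y, fund_fund]

theorem isClosed_of_hmn {N : Submodule ℝ V} (h : IsHypermaximalNeutral N) :
    N.topologicalClosure = N := by
  have hN : N = (N.map ((fund (V := V)).toLinearEquiv : V →ₗ[ℝ] V))ᗮ := by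
    ext x
    rw [h x, Submodule.mem_orthogonal]
    constructor
    · rintro hx _ ⟨y, hy, rfl⟩
      have := hx y hy
      rw [kip, fund_inner, real_inner_comm] at this
      exact this
    · intro hx y hy
      rw [kip, fund_inner, real_inner_comm]
      exact hx _ ⟨y, hy, rfl⟩
  refine IsClosed.submodule_topologicalClosure_eq ?_
  rw [hN]
  exact Submodule.isClosed_orthogonal _

/-- `u` is the unique linear map which is involutive, is an adapted anti-isometry (it
interchanges the positive and the negative part and changes the sign of `g`), and is the identity
on the given hypermaximal neutral subspace. -/
theorem uMap_unique {N : Submodule ℝ V} (h : IsHypermaximalNeutral N) (f : V →ₗ[ℝ] V) :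
    ((∀ x, f (f x) = x) ∧ (∀ x, f (fund x) = -fund (f x)) ∧ (∀ x y, kip (f x) (f y) = -kip x y) ∧
      ∀ x ∈ N, f x = x) ↔ f = uMap N := by
  have hc := isClosed_of_hmn h
  have key : ∀ x, x ∈ N.topologicalClosureᗮ ↔ fund x ∈ N := by
    intro x
    rw [hc, h, Submodule.mem_orthogonal]
    simp only [kip, fund_fund]
    exact forall₂_congr fun y _ => by rw [real_inner_comm]
  have hN : ∀ x ∈ N, N.topologicalClosure.reflection x = x := fun x hx =>
    Submodule.reflection_mem_subspace_eq_self (by rw [hc]; exact hx)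
  have hO : ∀ x ∈ N.topologicalClosureᗮ, N.topologicalClosure.reflection x = -x := fun x hx =>
    Submodule.reflection_mem_subspace_orthogonalComplement_eq_neg hx
  have hdec : ∀ x : V, ∃ y ∈ N, ∃ z ∈ N, x = y + fund z := by
    intro x
    obtain ⟨y, hy, z, hz, hx⟩ := N.topologicalClosure.exists_add_mem_mem_orthogonal x
    exact ⟨y, by rwa [hc] at hy, fund z, (key z).1 hz, by rw [fund_fund]; exact hx⟩
  have hfz : ∀ z ∈ N, fund z ∈ N.topologicalClosureᗮ := fun z hz => (key _).2 (by rwa [fund_fund])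
  constructor
  · rintro ⟨-, h2, -, h4⟩
    ext x
    obtain ⟨y, hy, z, hz, rfl⟩ := hdec x
    change _ = N.topologicalClosure.reflection (y + fund z)
    rw [map_add, map_add, h2, h4 y hy, h4 z hz, hN y hy, hO _ (hfz z hz)]
  · rintro rfl
    have h1 : ∀ x, uMap N x = N.topologicalClosure.reflection x := fun _ => rfl
    have h2 : ∀ x, uMap N (fund x) = -fund (uMap N x) := by
      intro x
      obtain ⟨y, hy, z, hz, rfl⟩ := hdec x
      simp only [h1, map_add, fund_fund, hN y hy, hN z hz, hO _ (hfz z hz), hO _ (hfz y hy),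
        map_neg]
      abel
    refine ⟨fun x => by simp [h1], h2, fun x y => ?_, fun x hx => hN x hx⟩
    have := h2 x
    rw [kip, kip, eq_neg_iff_add_eq_zero.2 (by rw [this]; simp : fund (uMap N x) +
      uMap N (fund x) = 0), inner_neg_left, h1, h1, LinearIsometryEquiv.inner_map_map]

end Krein

/-! ### Fock spaces of functions -/

set_option linter.unusedSectionVars false

section Fock

variable (𝕜 : Type) [RCLike 𝕜] (V : Type u) [NormedAddCommGroup V] [InnerProductSpace ℝ V]

/-- Sequences of functions of `n` arguments, without any condition. -/
abbrev PreFock := (n : ℕ) → (Fin n → V) → 𝕜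

/-- The index set of a fixed Hilbert basis of `V`. -/
def StdIdx [CompleteSpace V] : Set V := (exists_hilbertBasis ℝ V).choose

/-- A fixed Hilbert basis of `V`. By `Fock.hasSum_norm_sq` and `Fock.hasSum_inner` nothing below
depends on its choice. -/
def stdBasis [CompleteSpace V] : HilbertBasis (StdIdx V) ℝ V :=
  (exists_hilbertBasis ℝ V).choose_spec.choose

variable {𝕜 V}

/-- The coefficients, with respect to a basis, of a sequence of functions: the values on tuples
of basis vectors, normalized by `√(n!)` in degree `n`. -/
def coeffs {ι : Type*} (b : ι → V) (σ : PreFock 𝕜 V) (p : (n : ℕ) × (Fin n → ι)) : 𝕜 :=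
  (Real.sqrt (p.1.factorial : ℝ) : 𝕜) * σ p.1 (fun j => b (p.2 j))

theorem norm_coeffs_sq {ι : Type*} (b : ι → V) (σ : PreFock 𝕜 V) (p : (n : ℕ) × (Fin n → ι)) :
    ‖coeffs b σ p‖ ^ 2 = (p.1.factorial : ℝ) * ‖σ p.1 (fun j => b (p.2 j))‖ ^ 2 := by
  rw [coeffs, norm_mul, mul_pow, RCLike.norm_ofReal, sq_abs, Real.sq_sqrt (by positivity)]

variable (𝕜 V)

/-- Elements of the Fock space: in each degree `n` a continuous completely anti-symmetric
real `n`-linear map with values in `𝕜`, such that the sum over all degrees of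
`n! ∑ |σ (ζ_{i_1}, …, ζ_{i_n})|²` is finite. -/
structure IsFock [CompleteSpace V] (σ : PreFock 𝕜 V) : Prop where
  alt : ∀ n, ∃ f : V [⋀^Fin n]→L[ℝ] 𝕜, ∀ x, σ n x = f x
  summable : Summable fun p : (n : ℕ) × (Fin n → StdIdx V) =>
    (p.1.factorial : ℝ) * ‖σ p.1 (fun j => stdBasis V (p.2 j))‖ ^ 2

variable {𝕜 V}

theorem memlp_iff {ι : Type*} (b : ι → V) (σ : PreFock 𝕜 V) :
    Memℓp (coeffs b σ) 2 ↔ Summable fun p : (n : ℕ) × (Fin n → ι) =>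
      (p.1.factorial : ℝ) * ‖σ p.1 (fun j => b (p.2 j))‖ ^ 2 := by
  rw [memℓp_gen_iff (by norm_num)]
  refine summable_congr fun p => ?_
  rw [← norm_coeffs_sq]
  norm_num

theorem coeffs_add {ι : Type*} (b : ι → V) (σ τ : PreFock 𝕜 V) :
    coeffs b (σ + τ) = coeffs b σ + coeffs b τ := by
  ext p
  simp [coeffs, mul_add]

theorem coeffs_smul {ι : Type*} (b : ι → V) (c : 𝕜) (σ : PreFock 𝕜 V) :
    coeffs b (c • σ) = c • coeffs b σ := by
  ext p
  simp only [coeffs, Pi.smul_apply, smul_eq_mul]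
  ring

variable [CompleteSpace V]

variable (𝕜 V) in
/-- The Fock space as a vector space. -/
def fockSubmodule : Submodule 𝕜 (PreFock 𝕜 V) where
  carrier := {σ | IsFock 𝕜 V σ}
  zero_mem' := ⟨fun n => ⟨0, fun x => by simp⟩, by
    convert summable_zero using 2
    simp⟩
  add_mem' := by
    rintro σ τ ⟨h1, h2⟩ ⟨h3, h4⟩
    refine ⟨fun n => ?_, ?_⟩
    · obtain ⟨f, hf⟩ := h1 n
      obtain ⟨g, hg⟩ := h3 n
      exact ⟨f + g, fun x => by simp [hf, hg]⟩
    · rw [← memlp_iff] at h2 h4 ⊢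
      rw [coeffs_add]
      exact h2.add h4
  smul_mem' := by
    rintro c σ ⟨h1, h2⟩
    refine ⟨fun n => ?_, ?_⟩
    · obtain ⟨f, hf⟩ := h1 n
      exact ⟨c • f, fun x => by simp [hf]⟩
    · rw [← memlp_iff] at h2 ⊢
      rw [coeffs_smul]
      exact h2.const_smul c

variable (𝕜 V) in
/-- The `𝕜`-valued Fock space over the real Krein space `V`. Over `ℝ` this is the real Fock space
of `V`; over `ℂ` it is its complexification (complex valued instead of real valued functions). -/
def Fock : Type u := fockSubmodule 𝕜 V

namespace Fock

instance : AddCommGroup (Fock 𝕜 V) := inferInstanceAs (AddCommGroup (fockSubmodule 𝕜 V))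
instance : Module 𝕜 (Fock 𝕜 V) := inferInstanceAs (Module 𝕜 (fockSubmodule 𝕜 V))

/-- The underlying sequence of functions. -/
def fn (σ : Fock 𝕜 V) : PreFock 𝕜 V := σ.1

theorem isFock (σ : Fock 𝕜 V) : IsFock 𝕜 V σ.fn := σ.2

/-- A Fock space element from a sequence of functions. -/
def mk (σ : PreFock 𝕜 V) (h : IsFock 𝕜 V σ) : Fock 𝕜 V := ⟨σ, h⟩

@[simp] theorem fn_mk (σ : PreFock 𝕜 V) (h : IsFock 𝕜 V σ) : (mk σ h).fn = σ := rfl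
@[simp] theorem fn_add (σ τ : Fock 𝕜 V) : (σ + τ).fn = σ.fn + τ.fn := rfl
@[simp] theorem fn_smul (c : 𝕜) (σ : Fock 𝕜 V) : (c • σ).fn = c • σ.fn := rfl
@[simp] theorem fn_zero : (0 : Fock 𝕜 V).fn = 0 := rfl

@[ext] theorem ext {σ τ : Fock 𝕜 V} (h : ∀ n x, σ.fn n x = τ.fn n x) : σ = τ :=
  Subtype.ext (funext fun n => funext fun x => h n x)

end Fock

/-- A continuous real linear map that vanishes on a Hilbert basis is zero. -/
theorem clm_eq_zero {W : Type*} [NormedAddCommGroup W] [NormedSpace ℝ W] {ι : Type*}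
    (b : HilbertBasis ι ℝ V) (f : V →L[ℝ] W) (h : ∀ i, f (b i) = 0) : f = 0 := by
  refine ContinuousLinearMap.ext_on (s := Set.range b) ?_ ?_
  · rw [Submodule.dense_iff_topologicalClosure_eq_top]
    exact b.dense_span
  · rintro _ ⟨i, rfl⟩
    simpa using h i

theorem cmm_eq_zero {ι : Type*} (b : HilbertBasis ι ℝ V) :
    ∀ (n : ℕ) (f : ContinuousMultilinearMap ℝ (fun _ : Fin n => V) 𝕜)
      (_ : ∀ i : Fin n → ι, f (fun j => b (i j)) = 0), f = 0 := by
  intro n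
  induction n with
  | zero =>
    intro f h
    ext x
    rw [show x = fun j => b (Fin.elim0 j : ι) from funext fun j => j.elim0]
    exact h _
  | succ n ih =>
    intro f h
    have h0 : f.curryLeft = 0 := by
      refine clm_eq_zero b _ fun i => ih _ fun k => ?_
      rw [ContinuousMultilinearMap.curryLeft_apply]
      convert h (Fin.cons i k) using 2
      funext j
      refine Fin.cases ?_ (fun j => ?_) j <;> simp
    rw [← ContinuousMultilinearMap.uncurry_curryLeft f, h0]
    ext x
    simp

theorem hasSum_functional_sq {ι : Type*} (b : HilbertBasis ι ℝ V) (l : V →L[ℝ] ℝ) :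
    HasSum (fun i => l (b i) ^ 2) (‖(InnerProductSpace.toDual ℝ V).symm l‖ ^ 2) := by
  have := b.hasSum_inner_mul_inner ((InnerProductSpace.toDual ℝ V).symm l)
    ((InnerProductSpace.toDual ℝ V).symm l)
  rw [real_inner_self_eq_norm_sq] at this
  have e : (fun i => l (b i) ^ 2) = fun i =>
      inner ℝ ((InnerProductSpace.toDual ℝ V).symm l) (b i) *
        inner ℝ (b i) ((InnerProductSpace.toDual ℝ V).symm l) := by
    funext i
    rw [real_inner_comm _ (b i), InnerProductSpace.toDual_symm_apply, sq]
  rw [e]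
  exact this

theorem tsum_clm_sq {ι ι' : Type*} (b : HilbertBasis ι ℝ V) (b' : HilbertBasis ι' ℝ V)
    (f : V →L[ℝ] 𝕜) :
    ∑' i, ENNReal.ofReal (‖f (b i)‖ ^ 2) = ∑' i, ENNReal.ofReal (‖f (b' i)‖ ^ 2) := by
  have key : ∀ x, ‖f x‖ ^ 2 = ((RCLike.reCLM (K := 𝕜)).comp f) x ^ 2 +
      ((RCLike.imCLM (K := 𝕜)).comp f) x ^ 2 := by
    intro x
    rw [← RCLike.normSq_eq_def', RCLike.normSq_apply]
    simp [sq]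
  have h1 := (hasSum_functional_sq b ((RCLike.reCLM (K := 𝕜)).comp f)).add
    (hasSum_functional_sq b ((RCLike.imCLM (K := 𝕜)).comp f))
  have h2 := (hasSum_functional_sq b' ((RCLike.reCLM (K := 𝕜)).comp f)).add
    (hasSum_functional_sq b' ((RCLike.imCLM (K := 𝕜)).comp f))
  simp only [← key] at h1 h2
  rw [← ENNReal.ofReal_tsum_of_nonneg (fun i => by positivity) h1.summable,
    ← ENNReal.ofReal_tsum_of_nonneg (fun i => by positivity) h2.summable, h1.tsum_eq, h2.tsum_eq]

theorem tsum_cons {κ : Type*} (c : κ → V) (n : ℕ) (F : (Fin (n + 1) → V) → ℝ≥0∞) :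
    ∑' i : Fin (n + 1) → κ, F (fun j => c (i j)) =
      ∑' k : κ, ∑' i : Fin n → κ, F (Fin.cons (c k) (fun j => c (i j))) := by
  rw [← ENNReal.tsum_prod, ← (Fin.consEquiv (fun _ : Fin (n + 1) => κ)).tsum_eq]
  refine tsum_congr fun i => ?_
  congr 1
  funext j
  refine Fin.cases ?_ (fun j => ?_) j <;> simp [Fin.consEquiv]

theorem tsum_cmm_sq {ι ι' : Type*} (b : HilbertBasis ι ℝ V) (b' : HilbertBasis ι' ℝ V) :
    ∀ (n : ℕ) (f : ContinuousMultilinearMap ℝ (fun _ : Fin n => V) 𝕜),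
    ∑' i : Fin n → ι, ENNReal.ofReal (‖f (fun j => b (i j))‖ ^ 2) =
      ∑' i : Fin n → ι', ENNReal.ofReal (‖f (fun j => b' (i j))‖ ^ 2) := by
  intro n
  induction n with
  | zero =>
    intro f
    rw [tsum_eq_single (fun j => j.elim0) (fun i hi => (hi (funext fun j => j.elim0)).elim),
      tsum_eq_single (fun j => j.elim0) (fun i hi => (hi (funext fun j => j.elim0)).elim)]
    congr 4
    funext j
    exact j.elim0
  | succ n ih =>
    intro f
    rw [tsum_cons b n (fun x => ENNReal.ofReal (‖f x‖ ^ 2)),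
      tsum_cons b' n (fun x => ENNReal.ofReal (‖f x‖ ^ 2))]
    have h1 : ∀ k, ∑' i : Fin n → ι, ENNReal.ofReal (‖f (Fin.cons (b k) fun j => b (i j))‖ ^ 2) =
        ∑' i : Fin n → ι', ENNReal.ofReal (‖f (Fin.cons (b k) fun j => b' (i j))‖ ^ 2) :=
      fun k => ih (f.curryLeft (b k))
    rw [tsum_congr h1, ENNReal.tsum_comm, ENNReal.tsum_comm (α := ι')]
    refine tsum_congr fun i => ?_
    exact tsum_clm_sq b b'
      ((ContinuousMultilinearMap.apply ℝ (fun _ : Fin n => V) 𝕜 (fun j => b' (i j))).comp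
        f.curryLeft)

/-- The total square sum in `[0, ∞]` does not depend on the basis. -/
theorem tsum_pre_sq {ι ι' : Type*} (b : HilbertBasis ι ℝ V) (b' : HilbertBasis ι' ℝ V)
    {σ : PreFock 𝕜 V} (h : ∀ n, ∃ f : V [⋀^Fin n]→L[ℝ] 𝕜, ∀ x, σ n x = f x) :
    ∑' p : (n : ℕ) × (Fin n → ι), ENNReal.ofReal
        ((p.1.factorial : ℝ) * ‖σ p.1 (fun j => b (p.2 j))‖ ^ 2) =
      ∑' p : (n : ℕ) × (Fin n → ι'), ENNReal.ofReal
        ((p.1.factorial : ℝ) * ‖σ p.1 (fun j => b' (p.2 j))‖ ^ 2) := by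
  rw [ENNReal.tsum_sigma', ENNReal.tsum_sigma']
  refine tsum_congr fun n => ?_
  obtain ⟨f, hf⟩ := h n
  simp only [hf, ENNReal.ofReal_mul (Nat.cast_nonneg _), ENNReal.tsum_mul_left]
  congr 1
  exact tsum_cmm_sq b b' n f.toContinuousMultilinearMap

theorem summable_pre_sq {ι ι' : Type*} (b : HilbertBasis ι ℝ V) (b' : HilbertBasis ι' ℝ V)
    {σ : PreFock 𝕜 V} (h : ∀ n, ∃ f : V [⋀^Fin n]→L[ℝ] 𝕜, ∀ x, σ n x = f x)
    (hs : Summable fun p : (n : ℕ) × (Fin n → ι) =>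
      (p.1.factorial : ℝ) * ‖σ p.1 (fun j => b (p.2 j))‖ ^ 2) :
    Summable fun p : (n : ℕ) × (Fin n → ι') =>
      (p.1.factorial : ℝ) * ‖σ p.1 (fun j => b' (p.2 j))‖ ^ 2 := by
  have h1 := hs.tsum_ofReal_ne_top
  rw [tsum_pre_sq b b' h] at h1
  refine (ENNReal.summable_toReal h1).congr fun p => ?_
  exact ENNReal.toReal_ofReal (by positivity)

namespace Fock

theorem summable_sq {ι : Type*} (b : HilbertBasis ι ℝ V) (σ : Fock 𝕜 V) :
    Summable fun p : (n : ℕ) × (Fin n → ι) =>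
      (p.1.factorial : ℝ) * ‖σ.fn p.1 (fun j => b (p.2 j))‖ ^ 2 :=
  summable_pre_sq (stdBasis V) b σ.isFock.alt σ.isFock.summable

/-- The coefficients with respect to a basis as a square summable family. -/
def coeffLp {ι : Type*} (b : HilbertBasis ι ℝ V) :
    Fock 𝕜 V →ₗ[𝕜] lp (fun _ : (n : ℕ) × (Fin n → ι) => 𝕜) 2 where
  toFun σ := ⟨coeffs b σ.fn, (memlp_iff b σ.fn).2 (σ.summable_sq b)⟩
  map_add' σ τ := Subtype.ext (coeffs_add b σ.fn τ.fn)
  map_smul' c σ := Subtype.ext (coeffs_smul b c σ.fn)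

theorem coeffLp_injective {ι : Type*} (b : HilbertBasis ι ℝ V) :
    Function.Injective (coeffLp (𝕜 := 𝕜) b) := by
  rw [injective_iff_map_eq_zero]
  intro σ h
  ext n x
  obtain ⟨f, hf⟩ := σ.isFock.alt n
  have h0 : f.toContinuousMultilinearMap = 0 := by
    refine cmm_eq_zero b n _ fun i => ?_
    have h1 : coeffs b σ.fn ⟨n, i⟩ = 0 := congrArg (fun g : lp _ 2 => g.1 ⟨n, i⟩) h
    have h2 : (Real.sqrt (n.factorial : ℝ) : 𝕜) ≠ 0 := by
      rw [Ne, RCLike.ofReal_eq_zero, Real.sqrt_eq_zero']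
      exact not_le.2 (by positivity)
    have h3 := (mul_eq_zero.1 h1).resolve_left h2
    change f _ = 0
    rw [← hf]
    exact h3
  rw [hf]
  exact congrArg (fun g : ContinuousMultilinearMap ℝ (fun _ : Fin n => V) 𝕜 => g x) h0

instance : NormedAddCommGroup (Fock 𝕜 V) :=
  NormedAddCommGroup.induced (Fock 𝕜 V) _ (coeffLp (stdBasis V)) (coeffLp_injective _)

/-- The Hilbert space (majorant) inner product of the Fock space:
`⟪σ, τ⟫ = ∑_n n! ∑ conj (σ (ζ_{i_1}, …, ζ_{i_n})) * τ (ζ_{i_1}, …, ζ_{i_n})`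
for any Hilbert basis `ζ`, see `Fock.hasSum_inner`. -/
instance : InnerProductSpace 𝕜 (Fock 𝕜 V) where
  norm_smul_le c σ := by
    change ‖coeffLp (stdBasis V) (c • σ)‖ ≤ ‖c‖ * ‖coeffLp (stdBasis V) σ‖
    rw [map_smul]
    exact norm_smul_le _ _
  inner σ τ := inner 𝕜 (coeffLp (stdBasis V) σ) (coeffLp (stdBasis V) τ)
  norm_sq_eq_re_inner σ := norm_sq_eq_re_inner (𝕜 := 𝕜) (coeffLp (stdBasis V) σ)
  conj_inner_symm σ τ := inner_conj_symm _ _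
  add_left σ τ ρ := by rw [map_add, inner_add_left]
  smul_left σ τ c := by rw [map_smul, inner_smul_left]

theorem hasSum_norm_sq {ι : Type*} (b : HilbertBasis ι ℝ V) (σ : Fock 𝕜 V) :
    HasSum (fun p : (n : ℕ) × (Fin n → ι) =>
      (p.1.factorial : ℝ) * ‖σ.fn p.1 (fun j => b (p.2 j))‖ ^ 2) (‖σ‖ ^ 2) := by
  have h1 : ‖σ‖ ^ 2 = ∑' p : (n : ℕ) × (Fin n → StdIdx V),
      (p.1.factorial : ℝ) * ‖σ.fn p.1 (fun j => stdBasis V (p.2 j))‖ ^ 2 := by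
    have : ‖σ‖ ^ (2 : ℝ≥0∞).toReal = _ :=
      lp.norm_rpow_eq_tsum (by norm_num) (coeffLp (stdBasis V) σ)
    simp only [ENNReal.toReal_ofNat, Real.rpow_two] at this
    rw [this]
    exact tsum_congr fun p => norm_coeffs_sq _ _ p
  rw [h1]
  convert (σ.summable_sq b).hasSum using 1
  have h2 := tsum_pre_sq (stdBasis V) b σ.isFock.alt
  rw [← ENNReal.ofReal_tsum_of_nonneg (fun i => by positivity) (σ.summable_sq _),
    ← ENNReal.ofReal_tsum_of_nonneg (fun i => by positivity) (σ.summable_sq b)] at h2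
  exact (ENNReal.ofReal_eq_ofReal_iff (tsum_nonneg fun i => by positivity)
    (tsum_nonneg fun i => by positivity)).1 h2

theorem norm_coeffLp {ι : Type*} (b : HilbertBasis ι ℝ V) (σ : Fock 𝕜 V) :
    ‖coeffLp b σ‖ = ‖σ‖ := by
  have h : ‖coeffLp b σ‖ ^ (2 : ℝ≥0∞).toReal = _ :=
    lp.norm_rpow_eq_tsum (by norm_num) (coeffLp b σ)
  simp only [ENNReal.toReal_ofNat, Real.rpow_two] at h
  rw [← sq_eq_sq₀ (norm_nonneg _) (norm_nonneg _), h, ← (σ.hasSum_norm_sq b).tsum_eq]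
  exact tsum_congr fun p => norm_coeffs_sq _ _ p

/-- The inner product formula, for an arbitrary Hilbert basis. -/
theorem hasSum_inner {ι : Type*} (b : HilbertBasis ι ℝ V) (σ τ : Fock 𝕜 V) :
    HasSum (fun p : (n : ℕ) × (Fin n → ι) => (p.1.factorial : 𝕜) *
      ((starRingEnd 𝕜) (σ.fn p.1 (fun j => b (p.2 j))) * τ.fn p.1 (fun j => b (p.2 j))))
      (inner 𝕜 σ τ) := by
  let e : Fock 𝕜 V →ₗᵢ[𝕜] lp (fun _ : (n : ℕ) × (Fin n → ι) => 𝕜) 2 :=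
    ⟨coeffLp b, norm_coeffLp b⟩
  rw [← e.inner_map_map σ τ]
  have term : ∀ p : (n : ℕ) × (Fin n → ι), inner 𝕜 (coeffs b σ.fn p) (coeffs b τ.fn p) =
      (p.1.factorial : 𝕜) *
        ((starRingEnd 𝕜) (σ.fn p.1 (fun j => b (p.2 j))) * τ.fn p.1 (fun j => b (p.2 j))) := by
    intro p
    rw [RCLike.inner_apply, coeffs, coeffs, map_mul, RCLike.conj_ofReal]
    have : (Real.sqrt (p.1.factorial : ℝ) : 𝕜) * (Real.sqrt (p.1.factorial : ℝ) : 𝕜) =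
        (p.1.factorial : 𝕜) := by
      rw [← RCLike.ofReal_mul, Real.mul_self_sqrt (by positivity), RCLike.ofReal_natCast]
    rw [← this]
    ring
  have h : HasSum (fun p => inner 𝕜 (coeffs b σ.fn p) (coeffs b τ.fn p))
      (inner 𝕜 (e σ) (e τ)) := lp.hasSum_inner (e σ) (e τ)
  rw [funext term] at h
  exact h

end Fock

/-! ### Operations on Fock spaces -/

theorem isFock_comp {W : Type v} [NormedAddCommGroup W] [InnerProductSpace ℝ W] [CompleteSpace W]
    (e : V ≃ₗᵢ[ℝ] W) (π : ∀ n, Equiv.Perm (Fin n)) (σ : Fock 𝕜 W) :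
    IsFock 𝕜 V (fun n x => σ.fn n (fun j => e (x (π n j)))) := by
  refine ⟨fun n => ?_, ?_⟩
  · obtain ⟨f, hf⟩ := σ.isFock.alt n
    refine ⟨(Equiv.Perm.sign (π n) : ℤ) • f.compContinuousLinearMap
      (e.toContinuousLinearEquiv : V →L[ℝ] W), fun x => ?_⟩
    rw [hf]
    have := f.toAlternatingMap.map_perm (fun j => e (x j)) (π n)
    simpa [Units.smul_def, Function.comp_def] using this
  · let b : HilbertBasis (StdIdx V) ℝ W := HilbertBasis.ofRepr (e.symm.trans (stdBasis V).repr)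
    have hb : ∀ i, b i = e (stdBasis V i) := by
      classical
      intro i
      rw [← HilbertBasis.repr_symm_single, ← HilbertBasis.repr_symm_single]
      simp [b]
    have h := σ.summable_sq b
    rw [← (Equiv.sigmaCongrRight fun n =>
      Equiv.arrowCongr (π n)⁻¹ (Equiv.refl (StdIdx V))).summable_iff] at h
    refine h.congr fun p => ?_
    simp only [Function.comp_apply, hb]
    rfl

namespace Fock

section Pull

variable {W : Type v} [NormedAddCommGroup W] [InnerProductSpace ℝ W] [CompleteSpace W]

/-- Composition of the functions with an isometry, followed by permutations of the arguments. -/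
def pull (e : V ≃ₗᵢ[ℝ] W) (π : ∀ n, Equiv.Perm (Fin n)) : Fock 𝕜 W →ₗᵢ[𝕜] Fock 𝕜 V where
  toFun σ := mk (fun n x => σ.fn n (fun j => e (x (π n j)))) (isFock_comp e π σ)
  map_add' _ _ := rfl
  map_smul' _ _ := rfl
  norm_map' σ := by
    change ‖mk _ (isFock_comp e π σ)‖ = ‖σ‖
    let b : HilbertBasis (StdIdx V) ℝ W := HilbertBasis.ofRepr (e.symm.trans (stdBasis V).repr)
    have hb : ∀ i, b i = e (stdBasis V i) := by
      classical
      intro i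
      rw [← HilbertBasis.repr_symm_single, ← HilbertBasis.repr_symm_single]
      simp [b]
    have h := (Equiv.sigmaCongrRight fun n =>
      Equiv.arrowCongr (π n)⁻¹ (Equiv.refl (StdIdx V))).tsum_eq
        fun p => (p.1.factorial : ℝ) * ‖σ.fn p.1 (fun j => b (p.2 j))‖ ^ 2
    rw [← sq_eq_sq₀ (norm_nonneg _) (norm_nonneg _), ← (σ.hasSum_norm_sq b).tsum_eq,
      ← (hasSum_norm_sq (stdBasis V) _).tsum_eq, ← h]
    refine tsum_congr fun p => ?_
    simp only [hb]
    rfl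

/-- Composition of the functions with an isometry and reversal of the order of the arguments:
`(flip c σ)(ξ_1, …, ξ_n) = σ (c ξ_n, …, c ξ_1)`. -/
def flip (c : V ≃ₗᵢ[ℝ] W) : Fock 𝕜 W →ₗᵢ[𝕜] Fock 𝕜 V := pull c fun _ => Fin.revPerm

theorem flip_fn (c : V ≃ₗᵢ[ℝ] W) (σ : Fock 𝕜 W) (n : ℕ) (x : Fin n → V) :
    (flip c σ).fn n x = σ.fn n (fun j => c (x (Fin.rev j))) := rfl

end Pull

/-- Complex conjugation of complex valued functions. -/
def conj (σ : Fock ℂ V) : Fock ℂ V :=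
  mk (fun n x => (starRingEnd ℂ) (σ.fn n x)) ⟨fun n => by
    obtain ⟨f, hf⟩ := σ.isFock.alt n
    exact ⟨(Complex.conjCLE : ℂ →L[ℝ] ℂ).compContinuousAlternatingMap f, fun x => by simp [hf]⟩,
    by simpa using σ.isFock.summable⟩

theorem conj_fn (σ : Fock ℂ V) (n : ℕ) (x : Fin n → V) :
    (conj σ).fn n x = (starRingEnd ℂ) (σ.fn n x) := rfl

theorem inner_conj (σ τ : Fock ℂ V) : inner ℂ (conj σ) (conj τ) = inner ℂ τ σ := by
  rw [← inner_conj_symm τ σ, ← (hasSum_inner (stdBasis V) (conj σ) (conj τ)).tsum_eq,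
    ← (hasSum_inner (stdBasis V) σ τ).tsum_eq, Complex.conj_tsum]
  refine tsum_congr fun p => ?_
  simp [conj_fn]

/-- A real valued function regarded as a complex valued function. -/
def cplx (σ : Fock ℝ V) : Fock ℂ V :=
  mk (fun n x => ((σ.fn n x : ℝ) : ℂ)) ⟨fun n => by
    obtain ⟨f, hf⟩ := σ.isFock.alt n
    exact ⟨Complex.ofRealCLM.compContinuousAlternatingMap f, fun x => by simp [hf]⟩,
    by simpa using σ.isFock.summable⟩

/-- The f-grading: `fpar 0` consists of the elements of even degree, `fpar 1` of those of odd
degree. -/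
def fpar (p : ZMod 2) : Submodule 𝕜 (Fock 𝕜 V) where
  carrier := {σ | ∀ n : ℕ, (n : ZMod 2) ≠ p → ∀ x, σ.fn n x = 0}
  zero_mem' := fun n _ x => rfl
  add_mem' := fun {σ τ} h1 h2 n hn x => by
    rw [fn_add, Pi.add_apply, Pi.add_apply, h1 n hn x, h2 n hn x, add_zero]
  smul_mem' := fun c σ h n hn x => by
    rw [fn_smul, Pi.smul_apply, Pi.smul_apply, h n hn x, smul_zero]

/-- The elements all of whose components are holomorphic with respect to `J`, i.e. complex linear
in every argument when `J` is the multiplication by the imaginary unit. -/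
def holo (J : V →ₗ[ℝ] V) : Submodule ℂ (Fock ℂ V) where
  carrier := {σ | ∀ (n : ℕ) (x : Fin n → V) (j : Fin n),
    σ.fn n (Function.update x j (J (x j))) = Complex.I * σ.fn n x}
  zero_mem' := fun n x j => by simp
  add_mem' := fun {σ τ} h1 h2 n x j => by
    simp only [fn_add, Pi.add_apply, h1 n x j, h2 n x j, mul_add]
  smul_mem' := fun c σ h n x j => by
    simp only [fn_smul, Pi.smul_apply, h n x j, smul_eq_mul]
    ring

section KreinForm

variable [KreinSpace V]

/-- The map `I` of the Fock space, `(I σ)(ξ_1, …, ξ_n) = σ (I ξ_1, …, I ξ_n)`. -/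
def fundF : Fock 𝕜 V →ₗᵢ[𝕜] Fock 𝕜 V := pull fund fun _ => 1

theorem fundF_fn (σ : Fock 𝕜 V) (n : ℕ) (x : Fin n → V) :
    (fundF σ).fn n x = σ.fn n (fun j => fund (x j)) := rfl

/-- The Krein space inner product of the Fock space. -/
def krein (σ τ : Fock 𝕜 V) : 𝕜 := inner 𝕜 (fundF σ) τ

end KreinForm

end Fock

/-- The Krein space inner product of the Fock space in terms of an arbitrary ON-basis:
`∑_n n! ∑ (-1)^{[ζ_{i_1}] + … + [ζ_{i_n}]} conj (σ (ζ_{i_1}, …)) τ (ζ_{i_1}, …)`. -/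
theorem Fock.hasSum_krein {V : Type u} [NormedAddCommGroup V] [InnerProductSpace ℝ V]
    [KreinSpace V] {ι : Type u} (b : HilbertBasis ι ℝ V) (hb : IsONBasis b) (σ τ : Fock 𝕜 V) :
    HasSum (fun p : (n : ℕ) × (Fin n → ι) => (p.1.factorial : 𝕜) *
      (((∏ j, kip (b (p.2 j)) (b (p.2 j)) : ℝ) : 𝕜) *
        ((starRingEnd 𝕜) (σ.fn p.1 (fun j => b (p.2 j))) * τ.fn p.1 (fun j => b (p.2 j)))))
      (Fock.krein σ τ) := by
  have hk : ∀ i, fund (b i) = kip (b i) (b i) • b i := by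
    intro i
    have h1 : inner ℝ (b i) (b i) = (1 : ℝ) := by
      rw [real_inner_self_eq_norm_sq, b.orthonormal.1 i, one_pow]
    rcases hb i with h | h
    · rw [kip, h, h1, one_smul]
    · rw [kip, h, inner_neg_left, h1, neg_one_smul]
  have h := Fock.hasSum_inner b (Fock.fundF σ) τ
  have term : ∀ p : (n : ℕ) × (Fin n → ι), (p.1.factorial : 𝕜) *
      ((starRingEnd 𝕜) ((Fock.fundF σ).fn p.1 (fun j => b (p.2 j))) *
        τ.fn p.1 (fun j => b (p.2 j))) = (p.1.factorial : 𝕜) *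
      (((∏ j, kip (b (p.2 j)) (b (p.2 j)) : ℝ) : 𝕜) *
        ((starRingEnd 𝕜) (σ.fn p.1 (fun j => b (p.2 j))) * τ.fn p.1 (fun j => b (p.2 j)))) := by
    rintro ⟨n, i⟩
    obtain ⟨f, hf⟩ := σ.isFock.alt n
    have h2 : (Fock.fundF σ).fn n (fun j => b (i j)) =
        ((∏ j, kip (b (i j)) (b (i j)) : ℝ) : 𝕜) * σ.fn n (fun j => b (i j)) := by
      rw [Fock.fundF_fn, hf, hf]
      simp only [hk]
      rw [f.map_smul_univ, RCLike.real_smul_eq_coe_mul]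
    simp only [h2, map_mul, RCLike.conj_ofReal, mul_assoc]
  rw [funext term] at h
  exact h

section Pre

variable {U : Type v} {W : Type w}

/-- The anti-symmetrized product of sequences of functions: in degree `n`,
`∑_{k ≤ n} 1/n! ∑_π (-1)^{|π|} σ_k (x_{π 1}, …, x_{π k}) τ_{n-k} (x_{π (k+1)}, …, x_{π n})`. -/
def wedge (σ τ : PreFock 𝕜 W) : PreFock 𝕜 W := fun n x =>
  ∑ k : Fin (n + 1), (n.factorial : 𝕜)⁻¹ * ∑ π : Equiv.Perm (Fin n),
    ((Equiv.Perm.sign π : ℤ) : 𝕜) *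
      (σ k (fun j : Fin k => x (π ⟨j, by omega⟩)) *
        τ (n - k) (fun j : Fin (n - k) => x (π ⟨k + j, by omega⟩)))

/-- The unit of the anti-symmetrized product, of degree zero. -/
def unitPre : PreFock 𝕜 W := fun n _ => if n = 0 then 1 else 0

/-- Composition with a map in all arguments. -/
def pullPre (f : W → U) (σ : PreFock 𝕜 U) : PreFock 𝕜 W := fun n x => σ n (fun j => f (x j))

end Pre

end Fock

/-! ### Amplitude and probability maps -/

section Amplitude

variable {𝕜 : Type} [RCLike 𝕜] {V : Type u} [NormedAddCommGroup V] [InnerProductSpace ℝ V]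
  [KreinSpace V]

/-- The summand, in degree `2 n` and for the multi-index `i`, of the expression defining the
amplitude and the probability maps,
`(2n)!/(2^n n!) (-1)^n (-1)^{[ζ_{i_1}] + … + [ζ_{i_n}]}
  σ (ζ_{i_1}, …, ζ_{i_n}, u ζ_{i_n}, …, u ζ_{i_1})`. -/
def ampTerm (u : V →ₗ[ℝ] V) (σ : Fock 𝕜 V) {ι : Type u} (ζ : ι → V)
    (p : (n : ℕ) × (Fin n → ι)) : 𝕜 :=
  ((2 * p.1).factorial : 𝕜) / (2 ^ p.1 * (p.1.factorial : 𝕜)) * (-1) ^ p.1 *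
    (((∏ j, kip (ζ (p.2 j)) (ζ (p.2 j)) : ℝ) : 𝕜) *
      σ.fn (p.1 + p.1) (Fin.append (fun j => ζ (p.2 j)) (fun j => u (ζ (p.2 (Fin.rev j))))))

/-- The sum over all degrees and multi-indices converges to `a`, for every ON-basis. -/
def HasAmp (u : V →ₗ[ℝ] V) (σ : Fock 𝕜 V) (a : 𝕜) : Prop :=
  ∀ (ι : Type u) (ζ : HilbertBasis ι ℝ V), IsONBasis ζ → HasSum (ampTerm u σ ζ) a

/-- The domain: elements for which the sum converges and is independent of the ON-basis. -/
def ampDom (𝕜 : Type) [RCLike 𝕜] (u : V →ₗ[ℝ] V) : Set (Fock 𝕜 V) := {σ | ∃ a, HasAmp u σ a}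

open Classical in
/-- The value of the amplitude or probability map (zero outside the domain). -/
def amp (u : V →ₗ[ℝ] V) (σ : Fock 𝕜 V) : 𝕜 := if h : ∃ a, HasAmp u σ a then h.choose else 0

end Amplitude

/-! ### Completed tensor products -/

section Tensor

variable (E : Type u) (F : Type v) [NormedAddCommGroup E] [InnerProductSpace ℂ E]
  [NormedAddCommGroup F] [InnerProductSpace ℂ F]

/-- The completion of the algebraic tensor product of inner product spaces, with
`⟪a ⊗ b, c ⊗ d⟫ = ⟪a, c⟫ ⟪b, d⟫`. -/
def CTensor : Type (max u v) := UniformSpace.Completion (E ⊗[ℂ] F)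

instance : NormedAddCommGroup (CTensor E F) :=
  inferInstanceAs (NormedAddCommGroup (UniformSpace.Completion (E ⊗[ℂ] F)))
instance : InnerProductSpace ℂ (CTensor E F) :=
  inferInstanceAs (InnerProductSpace ℂ (UniformSpace.Completion (E ⊗[ℂ] F)))
instance : CompleteSpace (CTensor E F) :=
  inferInstanceAs (CompleteSpace (UniformSpace.Completion (E ⊗[ℂ] F)))

variable {E F}

/-- The elementary tensors. -/
def ctmul (a : E) (b : F) : CTensor E F :=
  ((a ⊗ₜ[ℂ] b : E ⊗[ℂ] F) : UniformSpace.Completion (E ⊗[ℂ] F))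

theorem inner_ctmul (a c : E) (b d : F) :
    inner ℂ (ctmul a b) (ctmul c d) = inner ℂ a c * inner ℂ b d := by
  rw [← TensorProduct.inner_tmul]
  exact UniformSpace.Completion.inner_coe _ _

end Tensor

set_option linter.checkUnivs false

/-! ### Spacetime systems and classical field theories -/

/-- A spacetime system, reduced to the combinatorial structure used here: oriented hypersurfaces,
regions, orientation reversal, the boundary map, and decompositions of a hypersurface into finitely
many hypersurfaces (`Dec parts s` is the type of the decompositions of `s` with components
`parts`). The manifolds themselves are arbitrary. -/
structure SpacetimeSystem where
  Hyp : Type u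
  Reg : Type v
  rev : Hyp → Hyp
  rev_rev : ∀ s, rev (rev s) = s
  revReg : Reg → Reg
  revReg_revReg : ∀ M, revReg (revReg M) = M
  bdry : Reg → Hyp
  rev_bdry : ∀ M, rev (bdry M) = bdry (revReg M)
  Dec : {n : ℕ} → (Fin n → Hyp) → Hyp → Type w
  revDec : ∀ {n : ℕ} {parts : Fin n → Hyp} {s : Hyp},
    Dec parts s → Dec (fun i => rev (parts i)) (rev s)

universe u₁ u₂

/-- A fermionic classical free field theory on a spacetime system: separable real Krein spaces on
hypersurfaces, and for every region a space of solutions whose image in the space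
on the boundary is hypermaximal neutral. Isomorphisms of Krein spaces are understood to respect the
decompositions into positive and negative parts. -/
structure FermionicTheory (S : SpacetimeSystem.{u, v, w}) where
  L : S.Hyp → Type u₁
  instGroup : ∀ s, NormedAddCommGroup (L s)
  instInner : ∀ s, InnerProductSpace ℝ (L s)
  instKrein : ∀ s, KreinSpace (L s)
  separable : ∀ s, TopologicalSpace.SeparableSpace (L s)
  /-- The identification of the spaces of a hypersurface and its orientation reversal. It changes
  the sign of the inner product, interchanging positive and negative parts. -/
  flip : ∀ {s s' : S.Hyp}, S.rev s = s' → L s ≃ₗᵢ[ℝ] L s'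
  flip_flip : ∀ {s s' : S.Hyp} (h : S.rev s = s') (h' : S.rev s' = s) (x : L s),
    flip h' (flip h x) = x
  flip_fund : ∀ {s s' : S.Hyp} (h : S.rev s = s') (x : L s),
    flip h (fund x) = -fund (flip h x)
  /-- The isomorphism of Krein spaces attached to a decomposition. -/
  glue : ∀ {n : ℕ} {parts : Fin n → S.Hyp} {s : S.Hyp}, S.Dec parts s →
    (PiLp 2 fun i => L (parts i)) ≃ₗᵢ[ℝ] L s
  glue_fund : ∀ {n : ℕ} {parts : Fin n → S.Hyp} {s : S.Hyp} (d : S.Dec parts s) (x : L s) i,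
    (glue d).symm (fund x) i = fund ((glue d).symm x i)
  glue_flip : ∀ {n : ℕ} {parts : Fin n → S.Hyp} {s : S.Hyp} (d : S.Dec parts s) (x : L s) i,
    (glue (S.revDec d)).symm (flip rfl x) i = flip rfl ((glue d).symm x i)
  /-- The space of solutions in a region, and its map to the space on the boundary. -/
  Sol : S.Reg → Type u₂
  instSolGroup : ∀ M, AddCommGroup (Sol M)
  instSolModule : ∀ M, Module ℝ (Sol M)
  r : ∀ M, Sol M →ₗ[ℝ] L (S.bdry M)
  r_hypermaximal : ∀ M, IsHypermaximalNeutral (LinearMap.range (r M))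
  /-- The space of solutions does not depend on the orientation of the region. -/
  r_flip : ∀ M, ∃ e : Sol M ≃ₗ[ℝ] Sol (S.revReg M),
    ∀ φ, r (S.revReg M) (e φ) = flip (S.rev_bdry M) (r M φ)

attribute [instance] FermionicTheory.instGroup FermionicTheory.instInner
  FermionicTheory.instKrein FermionicTheory.instSolGroup FermionicTheory.instSolModule

namespace FermionicTheory

variable {S : SpacetimeSystem.{u, v, w}} (T : FermionicTheory.{u, v, w, u₁, u₂} S)

/-- The map `u_M` of a region. -/
def uReg (M : S.Reg) : T.L (S.bdry M) →ₗ[ℝ] T.L (S.bdry M) := uMap (LinearMap.range (T.r M))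

/-- The real Krein space that the Fock-Feynman quantization associates to a hypersurface. -/
abbrev DR (s : S.Hyp) := Fock ℝ (T.L s)

/-- Its complexification. -/
abbrev DC (s : S.Hyp) := Fock ℂ (T.L s)

/-- The identification of the spaces of a hypersurface and its orientation reversal, with reversal
of the order of the arguments. -/
def flipD (𝕜 : Type) [RCLike 𝕜] {s s' : S.Hyp} (h' : S.rev s' = s) :
    Fock 𝕜 (T.L s) →ₗᵢ[𝕜] Fock 𝕜 (T.L s') := Fock.flip (T.flip h')

/-- The map attached to a decomposition of a hypersurface: the anti-symmetrized product of the
functions pulled back to the sum of the spaces of the components. -/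
def tau {𝕜 : Type} [RCLike 𝕜] {n : ℕ} {parts : Fin n → S.Hyp} {s : S.Hyp} (d : S.Dec parts s)
    (σ : ∀ i, Fock 𝕜 (T.L (parts i))) : PreFock 𝕜 (T.L s) :=
  (List.ofFn fun i => pullPre (fun x => (T.glue d).symm x i) (σ i).fn).foldr wedge unitPre

end FermionicTheory

/-- Complex structures on a subcollection of hypersurfaces, the polarized ones. -/
structure Polarization {S : SpacetimeSystem.{u, v, w}}
    (T : FermionicTheory.{u, v, w, u₁, u₂} S) where
  Pol : Set S.Hyp
  rev_mem : ∀ s ∈ Pol, S.rev s ∈ Pol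
  dec_mem : ∀ {n : ℕ} {parts : Fin n → S.Hyp} {s : S.Hyp}, S.Dec parts s →
    (∀ i, parts i ∈ Pol) → s ∈ Pol
  J : ∀ s, s ∈ Pol → T.L s →ₗ[ℝ] T.L s
  J_J : ∀ s p x, J s p (J s p x) = -x
  J_fund : ∀ s p x, J s p (fund x) = fund (J s p x)
  J_kip : ∀ s p x y, kip (J s p x) (J s p y) = kip x y
  J_flip : ∀ {s s' : S.Hyp} (h : S.rev s = s') (p : s ∈ Pol) (p' : s' ∈ Pol) (x : T.L s),
    J s' p' (T.flip h x) = -T.flip h (J s p x)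
  J_glue : ∀ {n : ℕ} {parts : Fin n → S.Hyp} {s : S.Hyp} (d : S.Dec parts s) (p : s ∈ Pol)
    (q : ∀ i, parts i ∈ Pol) (x : T.L s) i,
    (T.glue d).symm (J s p x) i = J (parts i) (q i) ((T.glue d).symm x i)
  J_uReg : ∀ (M : S.Reg) (p : S.bdry M ∈ Pol) (x : T.L (S.bdry M)),
    J _ p (T.uReg M x) = -T.uReg M (J _ p x)

/-- The sign `(-1)^{|a| |b|}` of f-degrees. -/
def fsgn (a b : ZMod 2) : ℂ := (-1) ^ (a.val * b.val)

namespace Polarization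

variable {S : SpacetimeSystem.{u, v, w}} {T : FermionicTheory.{u, v, w, u₁, u₂} S}
  (P : Polarization T)

/-! ### The amplitude formalism quantization -/

/-- The state space of a polarized hypersurface: the Fock space over `L` as a complex Krein space,
consisting of holomorphic functions. -/
abbrev H {s : S.Hyp} (p : s ∈ P.Pol) : Submodule ℂ (T.DC s) := Fock.holo (P.J s p)

/-- The conjugate linear map of the state spaces of a hypersurface and its orientation reversal,
`(iota ψ)(ξ_1, …, ξ_n) = conj (ψ (ξ_n, …, ξ_1))`. -/
def iota {s s' : S.Hyp} (h : S.rev s = s') (p : s ∈ P.Pol) (p' : s' ∈ P.Pol) :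
    P.H p →ₛₗ[starRingEnd ℂ] P.H p' where
  toFun ψ := ⟨Fock.conj (T.flipD ℂ (by rw [← h, S.rev_rev]) ψ.1), by
    intro n x j
    have h' : S.rev s' = s := by rw [← h, S.rev_rev]
    change (starRingEnd ℂ) (ψ.1.fn n fun k => T.flip h' (Function.update x j _ (Fin.rev k))) =
      Complex.I * (starRingEnd ℂ) (ψ.1.fn n fun k => T.flip h' (x (Fin.rev k)))
    have h1 := ψ.2 n (fun k => T.flip h' (x (Fin.rev k))) (Fin.rev j)
    have h2 : (fun k => T.flip h' (Function.update x j (P.J s' p' (x j)) (Fin.rev k))) =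
        Function.update (fun k => T.flip h' (x (Fin.rev k))) (Fin.rev j)
          ((-1 : ℝ) • P.J s p (T.flip h' (x (Fin.rev (Fin.rev j))))) := by
      funext k
      by_cases hk : k = Fin.rev j
      · subst hk
        simp [P.J_flip h' p' p]
      · have hk' : Fin.rev k ≠ j := fun hh => hk (by rw [← hh, Fin.rev_rev])
        simp [hk, hk']
    obtain ⟨f, hf⟩ := ψ.1.isFock.alt n
    rw [h2, hf, f.map_update_smul, ← hf, h1]
    simp⟩
  map_add' ψ φ := by
    ext n x
    exact map_add (starRingEnd ℂ) _ _
  map_smul' c ψ := by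
    ext n x
    exact map_mul (starRingEnd ℂ) _ _

theorem inner_iota {s s' : S.Hyp} (h : S.rev s = s') (p : s ∈ P.Pol) (p' : s' ∈ P.Pol)
    (ψ φ : P.H p) : inner ℂ (P.iota h p p' ψ) (P.iota h p p' φ) = inner ℂ φ ψ := by
  change inner ℂ (Fock.conj _) (Fock.conj _) = inner ℂ φ.1 ψ.1
  rw [Fock.inner_conj, LinearIsometry.inner_map_map]

theorem iota_iota {s s' : S.Hyp} (h : S.rev s = s') (h' : S.rev s' = s) (p : s ∈ P.Pol)
    (p' : s' ∈ P.Pol) (ψ : P.H p) : P.iota h' p' p (P.iota h p p' ψ) = ψ := by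
  ext n x
  change (starRingEnd ℂ) ((starRingEnd ℂ) (ψ.1.fn n fun k =>
    T.flip h' (T.flip h (x (Fin.rev (Fin.rev k)))))) = _
  simp [T.flip_flip]

/-! ### The modulus square of the amplitude formalism quantization -/

/-- The completed tensor product of the state spaces of a polarized hypersurface and its
orientation reversal (completed with respect to the Hilbert space majorant). -/
abbrev ModSq {s s' : S.Hyp} (p : s ∈ P.Pol) (p' : s' ∈ P.Pol) :=
  CTensor (P.H p) (P.H p')

/-- The components of the bigrading. -/
def bigr {s s' : S.Hyp} (p : s ∈ P.Pol) (p' : s' ∈ P.Pol) (a b : ZMod 2) :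
    Submodule ℂ (P.ModSq p p') :=
  (Submodule.span ℂ {x | ∃ ψ : P.H p, ∃ η : P.H p', ψ.1 ∈ Fock.fpar a ∧ η.1 ∈ Fock.fpar b ∧
    x = ctmul ψ η}).topologicalClosure

/-- The matrix elements `⟨I ζ, x ξ⟩` of an element `x` of the completed tensor product regarded
as a Hilbert-Schmidt operator via `(ψ ⊗ η) ξ = ⟨I (iota η), ξ⟩ ψ`, see `opForm_ctmul`. -/
def opForm {s s' : S.Hyp} (h : S.rev s = s') {p : s ∈ P.Pol} {p' : s' ∈ P.Pol}
    (x : P.ModSq p p') (ζ ξ : P.H p) : ℂ := inner ℂ (ctmul ζ (P.iota h p p' ξ)) x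

/-- `⟪·, ·⟫ = ⟨I ·, ·⟩` is the inner product of the majorant. -/
theorem opForm_ctmul {s s' : S.Hyp} (h : S.rev s = s') (h' : S.rev s' = s) {p : s ∈ P.Pol}
    {p' : s' ∈ P.Pol} (ψ : P.H p) (η : P.H p') (ζ ξ : P.H p) :
    P.opForm h (ctmul ψ η) ζ ξ =
      Fock.krein (Fock.fundF ζ.1) (Fock.krein (Fock.fundF (P.iota h' p' p η).1) ξ.1 • ψ.1) := by
  have hf : ∀ σ : T.DC s, Fock.fundF (Fock.fundF σ) = σ := by
    intro σ
    ext n x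
    simp [Fock.fundF_fn]
  rw [opForm, inner_ctmul, Fock.krein, Fock.krein, hf, hf, inner_smul_right,
    ← P.inner_iota h' p' p, P.iota_iota h h', mul_comm]
  rfl

/-- The positive elements of bidegree `(0, 0)`: those that are positive operators. -/
def posElts {s s' : S.Hyp} (h : S.rev s = s') (p : s ∈ P.Pol) (p' : s' ∈ P.Pol) :
    Set (P.ModSq p p') :=
  {x | x ∈ P.bigr p p' 0 0 ∧ ∀ ξ : P.H p, 0 ≤ (P.opForm h x ξ ξ).re ∧ (P.opForm h x ξ ξ).im = 0}

end Polarization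

/-! ### The positivity axioms -/

section Axioms

variable {V : Type u} [NormedAddCommGroup V] [InnerProductSpace ℝ V] [KreinSpace V]

/-- Bigrading and order of the space of a polarized hypersurface. `B` are the components of the
bigrading on the complexification (complex conjugation exchanges the two degrees, so that only the
components `B 0 0`, `B 1 1` and the sum of `B 0 1` and `B 1 0` are complexifications of real
subspaces), and `C` is the set of positive elements in the real part of `B 0 0`. -/
structure IsPositiveStructure (B : ZMod 2 → ZMod 2 → Submodule ℂ (Fock ℂ V))
    (C : Set (Fock ℝ V)) : Prop where
  /-- `B` is a decomposition into mutually orthogonal Krein subspaces, combining to the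
  f-grading and compatible with the real structure. -/
  internal : DirectSum.IsInternal fun q : ZMod 2 × ZMod 2 => B q.1 q.2
  closed : ∀ a b, IsClosed (B a b : Set (Fock ℂ V))
  fund_mem : ∀ a b, ∀ σ ∈ B a b, Fock.fundF σ ∈ B a b
  orthogonal : ∀ a b a' b', (a, b) ≠ (a', b') → ∀ σ ∈ B a b, ∀ τ ∈ B a' b', Fock.krein σ τ = 0
  even : B 0 0 ⊔ B 1 1 = Fock.fpar 0
  odd : B 0 1 ⊔ B 1 0 = Fock.fpar 1
  conj_mem : ∀ a b, ∀ σ ∈ B a b, Fock.conj σ ∈ B b a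
  real_even : ∀ σ : Fock ℝ V, σ ∈ Fock.fpar 0 → ∃ σ₀ σ₁ : Fock ℝ V,
    Fock.cplx σ₀ ∈ B 0 0 ∧ Fock.cplx σ₁ ∈ B 1 1 ∧ σ = σ₀ + σ₁
  /-- `C` is a generating proper cone in the real part of `B 0 0`, the induced order is
  Archimedean, and the inner product (twisted by `I`) of positive elements is non-negative. -/
  subset : ∀ σ ∈ C, Fock.cplx σ ∈ B 0 0
  zero_mem : 0 ∈ C
  add_mem : ∀ σ ∈ C, ∀ τ ∈ C, σ + τ ∈ C
  smul_mem : ∀ c : ℝ, 0 ≤ c → ∀ σ ∈ C, c • σ ∈ C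
  proper : ∀ σ ∈ C, -σ ∈ C → σ = 0
  generating : ∀ σ : Fock ℝ V, Fock.cplx σ ∈ B 0 0 → ∃ σ₁ ∈ C, ∃ σ₂ ∈ C, σ = σ₁ - σ₂
  archimedean : ∀ σ τ : Fock ℝ V, Fock.cplx σ ∈ B 0 0 → Fock.cplx τ ∈ B 0 0 →
    (∀ n : ℕ, τ - (n : ℝ) • σ ∈ C) → -σ ∈ C
  inner_nonneg : ∀ σ ∈ C, ∀ τ ∈ C, 0 ≤ Fock.krein (Fock.fundF σ) τ

end Axioms

namespace Polarization

variable {S : SpacetimeSystem.{u, v, w}} {T : FermionicTheory.{u, v, w, u₁, u₂} S}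
  (P : Polarization T)

/-- The bigrading of the complexified space of the Fock-Feynman quantization, transported
along an identification with the modulus square. -/
def bigrD {s s' : S.Hyp} {p : s ∈ P.Pol} {p' : s' ∈ P.Pol} (U : P.ModSq p p' ≃ₗᵢ[ℂ] T.DC s)
    (a b : ZMod 2) : Submodule ℂ (T.DC s) := (P.bigr p p' a b).map (U.toLinearEquiv : _ →ₗ[ℂ] _)

/-- The positive elements of the real space of the Fock-Feynman quantization, transported
along an identification with the modulus square. -/
def posD {s s' : S.Hyp} (h : S.rev s = s') {p : s ∈ P.Pol} {p' : s' ∈ P.Pol}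
    (U : P.ModSq p p' ≃ₗᵢ[ℂ] T.DC s) : Set (T.DR s) :=
  {σ | U.symm (Fock.cplx σ) ∈ P.posElts h p p'}

end Polarization

end FermionGBF

end

open FermionGBF

/-!
Everything is derived from the annihilation operators `ins x`, which insert a vector into the first
argument of a sequence of anti-symmetric functions. They are antiderivations for the
anti-symmetrized product (`ins_wedge`), and a component of positive degree is determined by them
(`succ_ext`). Hence identities for products, such as associativity (`wedge_assoc`) and graded
commutativity (`wedge_comm`), follow by induction on the degree.

*Isometry.* Summing the square norms of the sequences `ins z σ` over a frame of vectors `z` gives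
the number operator (`succ_sqN`). If every vector of the frame annihilates one of two factors, then
the Leibniz rule has a single term for each `z`, and by induction on the degree the square norm of
the product is the product of the square norms (`sqT_wedge`). Given a complex structure `J` that
respects the Krein structure, there is an ON-basis consisting of pairs `e`, `J e`
(`exists_adapted`). The vectors `(e ∓ i J e) / √2` then form a frame in which each vector
annihilates either the anti-holomorphic or the holomorphic functions. So the product of a
holomorphic and an anti-holomorphic element multiplies norms (`norm_wedgeB`). Monomials in the dual
functionals of an orthonormal basis span a dense subspace (`dense_monF`), and every functional is
the sum of a holomorphic and an anti-holomorphic one, so such products have a dense span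
(`dense_of_splitMon`). Consequently the product extends to an isometric isomorphism `identU` of the
completed tensor product. The same norm identity, with the union of orthonormal bases of the
components as the frame, makes the maps for decompositions bounded (`sqT_wedgeL_gproj`).

*Algebraic structures.* On products, inner products, orientation reversal, complex conjugation and
the maps for decompositions are computed from graded commutativity and from the behaviour of
products under reversal of the arguments: `krein_wedgeB`, `flipD_wedgeB`, `conj_wedgeB` and
`tau_wedgeB`. The twist of the inner product is the sign with which `I` passes through orientation
reversal in odd degree.

*Probability maps.* A partial sum of the probability map over a finite set of basis vectors is the
value in degree zero of the exponential of an operator `ampQ` of degree `-2`, a sum of products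
of two annihilation operators. For the pair `e`, `J e` of an adapted basis, the mixed terms of the
Leibniz rule on a product of a holomorphic and an anti-holomorphic factor cancel
(`ampPair_wedge`), because `u` anticommutes with `J`. Thus `ampQ` acts as a derivation on such
products and the partial sums are multiplicative (`ampS_wedge`). They converge to the probability
map on its domain (`tendsto_ampL`), which proves the agreement of the probability maps
(`amp_identU`). Monomials lie in all the domains (`monF_mem_ampDom`), which gives density.

*Positivity.* By compression to finite-dimensional subspaces, a real positive element is a limit of
finite sums of the elements `ξ ⊗ ι ξ` with `ξ` even (`mem_closure_rankSums`). Inequalities for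
continuous linear functionals therefore have to be checked on these elements only. The inner
product of such an element with `σ` is a diagonal matrix element of `σ` (`inner_nonneg_posD`), its
image under a map for a decomposition is of the same form (`tau_rankOne`), and on it the partial
sums of the probability map are absolute squares (`amp_nonneg`). The cone is closed and self-dual,
so the metric projection to it writes any real element of bidegree `(0, 0)` as a difference of
positive ones (`generating_posD`).
-/

noncomputable section

namespace FermionGBF

set_option linter.unusedSectionVars false

/-! ### Annihilation operators and the Leibniz rule -/

section

variable {𝕜 : Type} [RCLike 𝕜] {V : Type u}

/-- The annihilation operator of `x`: insertion of `x` into the first argument, normalized so that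
it is an antiderivation for the anti-symmetrized product. -/
def ins (x : V) : PreFock 𝕜 V →ₗ[𝕜] PreFock 𝕜 V where
  toFun σ := fun n y => ((n + 1 : ℕ) : 𝕜) * σ (n + 1) (Fin.cons x y)
  map_add' σ τ := by funext n y; simp [mul_add]
  map_smul' c σ := by funext n y; simp [mul_left_comm]

theorem ins_apply (x : V) (σ : PreFock 𝕜 V) (n : ℕ) (y : Fin n → V) :
    ins x σ n y = ((n + 1 : ℕ) : 𝕜) * σ (n + 1) (Fin.cons x y) := rfl

/-- The sign `(-1) ^ n` in degree `n`. -/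
def par : PreFock 𝕜 V →ₗ[𝕜] PreFock 𝕜 V where
  toFun σ := fun n y => (-1) ^ n * σ n y
  map_add' σ τ := by funext n y; simp [mul_add]
  map_smul' c σ := by funext n y; simp [mul_left_comm]

theorem par_apply (σ : PreFock 𝕜 V) (n : ℕ) (y : Fin n → V) :
    par σ n y = (-1) ^ n * σ n y := rfl

@[simp] theorem par_par (σ : PreFock 𝕜 V) : par (par σ) = σ := by
  funext n y
  rw [par_apply, par_apply, ← mul_assoc, ← mul_pow]
  simp

theorem ins_par (x : V) (σ : PreFock 𝕜 V) : ins x (par σ) = -par (ins x σ) := by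
  funext n y
  simp only [ins_apply, par_apply, Pi.neg_apply]
  ring

/-- A component of positive degree is determined by the annihilation operators. -/
theorem succ_ext {σ τ : PreFock 𝕜 V} {n : ℕ} (h : ∀ x, ins x σ n = ins x τ n) :
    σ (n + 1) = τ (n + 1) := by
  funext y
  have h1 := congrFun (h (y 0)) (Fin.tail y)
  rw [ins_apply, ins_apply, Fin.cons_self_tail] at h1
  exact mul_left_cancel₀ (by exact_mod_cast n.succ_ne_zero) h1

/-- The continuation of a finite tuple by an arbitrary value; allows to split off segments of a
tuple without transports between types. -/
def seq {n : ℕ} [Inhabited V] (x : Fin n → V) (i : ℕ) : V := if h : i < n then x ⟨i, h⟩ else default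

/-- Evaluation of a component on the initial segment of a sequence. -/
def ev (σ : PreFock 𝕜 V) (k : ℕ) (z : ℕ → V) : 𝕜 := σ k fun j => z j

theorem ev_congr (σ : PreFock 𝕜 V) (k : ℕ) {z z' : ℕ → V} (h : ∀ i < k, z i = z' i) :
    ev σ k z = ev σ k z' := by
  unfold ev
  congr 1
  funext j
  exact h j j.2

theorem wedge_eq [Inhabited V] (σ τ : PreFock 𝕜 V) (n : ℕ) (x : Fin n → V) :
    wedge σ τ n x = (n.factorial : 𝕜)⁻¹ *
      ∑ p ∈ Finset.HasAntidiagonal.antidiagonal n, ∑ π : Equiv.Perm (Fin n),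
      ((Equiv.Perm.sign π : ℤ) : 𝕜) * (ev σ p.1 (seq (x ∘ π)) *
        ev τ p.2 (fun i => seq (x ∘ π) (p.1 + i))) := by
  rw [wedge, ← Finset.mul_sum]
  congr 1
  rw [Finset.Nat.sum_antidiagonal_eq_sum_range_succ_mk, Finset.sum_range]
  refine Finset.sum_congr rfl fun k _ => Finset.sum_congr rfl fun π _ => ?_
  congr 2
  · unfold ev
    congr 1
    funext j
    have : (j : ℕ) < n := by omega
    simp [seq, this]
  · unfold ev
    congr 1
    funext j
    have : (k : ℕ) + j < n := by have := j.2; omega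
    simp [seq, this]

/-- Insertion of `x` at position `j` of a sequence. -/
def insSeq (j : ℕ) (x : V) (z : ℕ → V) (i : ℕ) : V :=
  if i < j then z i else if i = j then x else z (i - 1)

theorem seq_insertNth [Inhabited V] {n : ℕ} (j : Fin (n + 1)) (x : V) (y : Fin n → V) :
    seq (j.insertNth x y : Fin (n + 1) → V) = insSeq j x (seq y) := by
  funext i
  simp only [seq, insSeq]
  rcases lt_trichotomy i (j : ℕ) with h | h | h
  · have h1 : i < n + 1 := by omega
    have h2 : i < n := by omega
    have h3 : (⟨i, h1⟩ : Fin (n + 1)) < j := h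
    rw [dif_pos h1, if_pos h, dif_pos h2, Fin.insertNth_apply_below h3]
    simp only [eq_rec_constant]
    rfl
  · subst h
    simp [j.2]
  · rw [if_neg (by omega), if_neg (by omega)]
    by_cases h1 : i < n + 1
    · have h2 : i - 1 < n := by omega
      have h3 : j < (⟨i, h1⟩ : Fin (n + 1)) := h
      rw [dif_pos h1, dif_pos h2, Fin.insertNth_apply_above h3]
      simp only [eq_rec_constant]
      rfl
    · rw [dif_neg h1, dif_neg (by omega)]

/-- Permutations of `n + 1` letters, split by the position that is sent to zero. -/
def permSplit (n : ℕ) : Fin (n + 1) × Equiv.Perm (Fin n) ≃ Equiv.Perm (Fin (n + 1)) :=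
  Equiv.ofBijective (fun p => p.1.cycleRange.trans (Equiv.Perm.decomposeFin.symm (0, p.2))) <| by
    rw [Fintype.bijective_iff_injective_and_card]
    constructor
    · rintro ⟨j, π⟩ ⟨j', π'⟩ h
      have h0 : j = j' := by
        have h1 := Equiv.congr_fun h j
        simp only [Equiv.trans_apply, Fin.cycleRange_self] at h1
        rw [Equiv.Perm.decomposeFin_symm_apply_zero] at h1
        have h2 : Equiv.Perm.decomposeFin.symm (0, π') (j'.cycleRange j) =
          Equiv.Perm.decomposeFin.symm (0, π') 0 := by
          rw [← h1, Equiv.Perm.decomposeFin_symm_apply_zero]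
        have h3 := (Equiv.injective _) h2
        rw [← Fin.cycleRange_self j'] at h3
        exact (Equiv.injective _) h3
      subst h0
      have h1 : Equiv.Perm.decomposeFin.symm (0, π) = Equiv.Perm.decomposeFin.symm (0, π') := by
        ext i
        have := Equiv.congr_fun h (j.cycleRange.symm i)
        simpa using congrArg Fin.val this
      simpa using h1
    · simp [Fintype.card_perm, Nat.factorial_succ]

theorem sign_permSplit {n : ℕ} (j : Fin (n + 1)) (π : Equiv.Perm (Fin n)) :
    Equiv.Perm.sign (permSplit n (j, π)) = (-1) ^ (j : ℕ) * Equiv.Perm.sign π := by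
  change Equiv.Perm.sign (j.cycleRange.trans (Equiv.Perm.decomposeFin.symm (0, π))) = _
  rw [Equiv.Perm.sign_trans, Fin.sign_cycleRange, Equiv.Perm.decomposeFin.symm_sign, if_pos rfl,
    one_mul, mul_comm]

theorem cons_comp_permSplit {n : ℕ} (x : V) (y : Fin n → V) (j : Fin (n + 1))
    (π : Equiv.Perm (Fin n)) :
    (Fin.cons x y : Fin (n + 1) → V) ∘ permSplit n (j, π) = j.insertNth x (y ∘ π) := by
  have h : (Fin.cons x y : Fin (n + 1) → V) ∘ Equiv.Perm.decomposeFin.symm (0, π) =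
      Fin.cons x (y ∘ π) := by
    funext i
    refine Fin.cases ?_ (fun i => ?_) i <;> simp
  have h2 : (Fin.cons x y : Fin (n + 1) → V) ∘ permSplit n (j, π) =
      (Fin.cons x (y ∘ π) : Fin (n + 1) → V) ∘ j.cycleRange := by
    rw [← h]; rfl
  rw [h2, ← Fin.insertNth_comp_cycleRange_symm j, Function.comp_assoc]
  simp

section Alt

variable [NormedAddCommGroup V] [InnerProductSpace ℝ V]

/-- Sequences of continuous completely anti-symmetric multilinear maps. -/
def IsAlt (σ : PreFock 𝕜 V) : Prop := ∀ n, ∃ f : V [⋀^Fin n]→L[ℝ] 𝕜, ∀ x, σ n x = f x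

theorem ev_insSeq_le {σ : PreFock 𝕜 V} (hσ : IsAlt σ) {j k : ℕ} (h : j ≤ k) (x : V) (z : ℕ → V) :
    ((k + 1 : ℕ) : 𝕜) * ev σ (k + 1) (insSeq j x z) = (-1) ^ j * ev (ins x σ) k z := by
  obtain ⟨f, hf⟩ := hσ (k + 1)
  have h1 : (fun i : Fin (k + 1) => insSeq j x z i) =
      (⟨j, Nat.lt_succ_of_le h⟩ : Fin (k + 1)).insertNth x (fun i : Fin k => z i) := by
    refine Fin.eq_insertNth_iff.2 ⟨by simp [insSeq], ?_⟩
    funext i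
    simp only [Fin.removeNth, insSeq]
    by_cases hi : (i : ℕ) < j
    · rw [Fin.succAbove_of_castSucc_lt _ _ (by exact hi)]
      simp [hi]
    · rw [Fin.succAbove_of_le_castSucc _ _ (by simpa [Fin.le_def] using hi)]
      have : ¬ (i : ℕ) + 1 < j := by omega
      have h4 : (i : ℕ) + 1 ≠ j := by omega
      simp [this, h4]
  unfold ev
  rw [h1, ins_apply, hf, hf, f.map_insertNth]
  simp only [Matrix.vecCons, zsmul_eq_mul, Int.cast_pow, Int.cast_neg, Int.cast_one]
  ring_nf

theorem ev_insSeq_ge (σ : PreFock 𝕜 V) {j k : ℕ} (h : k ≤ j) (x : V) (z : ℕ → V) :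
    ev σ k (insSeq j x z) = ev σ k z :=
  ev_congr σ k fun i hi => by simp [insSeq, lt_of_lt_of_le hi h]

open Finset.HasAntidiagonal in
/-- The sum over the positions at which `x` can be inserted into a product. -/
theorem sum_ev_insSeq {σ τ : PreFock 𝕜 V} (hσ : IsAlt σ) (hτ : IsAlt τ) (n : ℕ) (x : V)
    (z : ℕ → V) :
    ∑ p ∈ antidiagonal (n + 1), ∑ j ∈ Finset.range (n + 1), (-1) ^ j *
        (ev σ p.1 (insSeq j x z) * ev τ p.2 (fun i => insSeq j x z (p.1 + i))) =
      ∑ p ∈ antidiagonal n, (ev (ins x σ) p.1 z * ev τ p.2 (fun i => z (p.1 + i)) +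
        ev (par σ) p.1 z * ev (ins x τ) p.2 (fun i => z (p.1 + i))) := by
  have key : ∀ p ∈ antidiagonal (n + 1), ∑ j ∈ Finset.range (n + 1), (-1) ^ j *
        (ev σ p.1 (insSeq j x z) * ev τ p.2 (fun i => insSeq j x z (p.1 + i))) =
      (if p.1 = 0 then 0 else ev (ins x σ) (p.1 - 1) z * ev τ p.2 (fun i => z (p.1 - 1 + i))) +
      (if p.2 = 0 then 0 else
        ev (par σ) p.1 z * ev (ins x τ) (p.2 - 1) (fun i => z (p.1 + i))) := by
    rintro ⟨k, l⟩ h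
    have h : k + l = n + 1 := by simpa using h
    dsimp only
    rw [← h, Finset.sum_range_add]
    congr 1
    · rcases k with _ | k
      · simp
      · have : ∀ j ∈ Finset.range (k + 1), (-1) ^ j *
            (ev σ (k + 1) (insSeq j x z) * ev τ l (fun i => insSeq j x z (k + 1 + i))) =
            ((k + 1 : ℕ) : 𝕜)⁻¹ * (ev (ins x σ) k z * ev τ l (fun i => z (k + i))) := by
          intro j hj
          have hj := Finset.mem_range.1 hj
          have h1 := ev_insSeq_le hσ (Nat.le_of_lt_succ hj) x z
          have h0 : ((k + 1 : ℕ) : 𝕜) ≠ 0 := by exact_mod_cast k.succ_ne_zero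
          have h2 : ev τ l (fun i => insSeq j x z (k + 1 + i)) = ev τ l (fun i => z (k + i)) := by
            refine ev_congr τ l fun i _ => ?_
            simp only [insSeq]
            rw [if_neg (by omega), if_neg (by omega)]
            congr 1
            omega
          have h3 : ev σ (k + 1) (insSeq j x z) = ((k + 1 : ℕ) : 𝕜)⁻¹ *
              ((-1) ^ j * ev (ins x σ) k z) := by
            rw [← h1, inv_mul_cancel_left₀ h0]
          have h4 : ((-1 : 𝕜) ^ j) * (-1) ^ j = 1 := by rw [← mul_pow]; simp
          rw [h2, h3]
          linear_combination (((k + 1 : ℕ) : 𝕜)⁻¹ * ev (ins x σ) k z *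
            ev τ l (fun i => z (k + i))) * h4
        rw [Finset.sum_congr rfl this, Finset.sum_const, Finset.card_range, nsmul_eq_mul,
          mul_inv_cancel_left₀ (by exact_mod_cast k.succ_ne_zero)]
        simp
    · rcases l with _ | l
      · simp
      · have : ∀ j ∈ Finset.range (l + 1), (-1) ^ (k + j) *
            (ev σ k (insSeq (k + j) x z) * ev τ (l + 1) (fun i => insSeq (k + j) x z (k + i))) =
            ((l + 1 : ℕ) : 𝕜)⁻¹ * (ev (par σ) k z * ev (ins x τ) l (fun i => z (k + i))) := by
          intro j hj
          have hj := Finset.mem_range.1 hj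
          have h1 := ev_insSeq_le hτ (Nat.le_of_lt_succ hj) x (fun i => z (k + i))
          have h0 : ((l + 1 : ℕ) : 𝕜) ≠ 0 := by exact_mod_cast l.succ_ne_zero
          have h2 : ev τ (l + 1) (fun i => insSeq (k + j) x z (k + i)) =
              ev τ (l + 1) (insSeq j x (fun i => z (k + i))) := by
            refine ev_congr τ _ fun i _ => ?_
            simp only [insSeq]
            rcases lt_trichotomy i j with hi | hi | hi
            · simp [hi]
            · simp [hi]
            · rw [if_neg (by omega), if_neg (by omega), if_neg (by omega), if_neg (by omega)]
              congr 1
              omega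
          have h3 : ev τ (l + 1) (insSeq j x (fun i => z (k + i))) = ((l + 1 : ℕ) : 𝕜)⁻¹ *
              ((-1) ^ j * ev (ins x τ) l (fun i => z (k + i))) := by
            rw [← h1, inv_mul_cancel_left₀ h0]
          have h4 : ((-1 : 𝕜) ^ j) * (-1) ^ j = 1 := by rw [← mul_pow]; simp
          have h5 : ev (par σ) k z = (-1) ^ k * ev σ k z := rfl
          rw [h2, h3, ev_insSeq_ge σ (by omega), h5, pow_add]
          linear_combination ((-1) ^ k * ((l + 1 : ℕ) : 𝕜)⁻¹ * ev σ k z *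
            ev (ins x τ) l (fun i => z (k + i))) * h4
        rw [Finset.sum_congr rfl this, Finset.sum_const, Finset.card_range, nsmul_eq_mul,
          mul_inv_cancel_left₀ (by exact_mod_cast l.succ_ne_zero)]
        simp
  rw [Finset.sum_congr rfl key, Finset.sum_add_distrib, Finset.sum_add_distrib]
  congr 1
  · rw [Finset.Nat.sum_antidiagonal_succ]
    simp
  · rw [Finset.Nat.sum_antidiagonal_succ']
    simp

/-- The annihilation operators are antiderivations. -/
theorem ins_wedge {σ τ : PreFock 𝕜 V} (hσ : IsAlt σ) (hτ : IsAlt τ) (x : V) :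
    ins x (wedge σ τ) = wedge (ins x σ) τ + wedge (par σ) (ins x τ) := by
  have : Inhabited V := ⟨0⟩
  funext n y
  rw [Pi.add_apply, Pi.add_apply, ins_apply, wedge_eq, wedge_eq, wedge_eq, ← mul_add,
    Finset.sum_comm, ← (permSplit n).sum_comp, Fintype.sum_prod_type_right,
    Finset.sum_comm (s := Finset.HasAntidiagonal.antidiagonal n),
    Finset.sum_comm (s := Finset.HasAntidiagonal.antidiagonal n), ← Finset.sum_add_distrib,
    Nat.factorial_succ, Nat.cast_mul, mul_inv, ← mul_assoc, mul_inv_cancel_left₀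
      (by exact_mod_cast n.succ_ne_zero)]
  congr 1
  refine Finset.sum_congr rfl fun π _ => ?_
  have h := sum_ev_insSeq hσ hτ n x (seq (y ∘ π))
  rw [Finset.sum_comm] at h
  simp only [cons_comp_permSplit, seq_insertNth, sign_permSplit]
  have h2 : ∀ (a b : PreFock 𝕜 V), ∑ p ∈ Finset.HasAntidiagonal.antidiagonal n,
      ((Equiv.Perm.sign π : ℤ) : 𝕜) * (ev a p.1 (seq (y ∘ π)) *
        ev b p.2 (fun i => seq (y ∘ π) (p.1 + i))) = ((Equiv.Perm.sign π : ℤ) : 𝕜) *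
      ∑ p ∈ Finset.HasAntidiagonal.antidiagonal n, (ev a p.1 (seq (y ∘ π)) *
        ev b p.2 (fun i => seq (y ∘ π) (p.1 + i))) := fun a b => by rw [Finset.mul_sum]
  rw [h2, h2, ← mul_add, ← Finset.sum_add_distrib, ← h, Finset.sum_range, Finset.mul_sum]
  refine Finset.sum_congr rfl fun j _ => ?_
  rw [Finset.mul_sum]
  refine Finset.sum_congr rfl fun p _ => ?_
  push_cast
  ring

end Alt

end

/-! ### Algebra of the anti-symmetrized product -/

section

variable {𝕜 : Type} [RCLike 𝕜] {V : Type u}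

theorem wedge_zero_degree (σ τ : PreFock 𝕜 V) (x : Fin 0 → V) :
    wedge σ τ 0 x = σ 0 x * τ 0 x := by
  simp only [wedge, Finset.univ_unique, Finset.sum_singleton]
  simp

theorem wedge_add_left (σ σ' τ : PreFock 𝕜 V) :
    wedge (σ + σ') τ = wedge σ τ + wedge σ' τ := by
  funext n x
  simp only [wedge, Pi.add_apply, add_mul, mul_add, Finset.sum_add_distrib]

theorem wedge_add_right (σ τ τ' : PreFock 𝕜 V) :
    wedge σ (τ + τ') = wedge σ τ + wedge σ τ' := by
  funext n x
  simp only [wedge, Pi.add_apply, mul_add, Finset.sum_add_distrib]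

theorem wedge_smul_left (c : 𝕜) (σ τ : PreFock 𝕜 V) :
    wedge (c • σ) τ = c • wedge σ τ := by
  funext n x
  simp only [wedge, Pi.smul_apply, smul_eq_mul, Finset.mul_sum]
  refine Finset.sum_congr rfl fun _ _ => Finset.sum_congr rfl fun _ _ => ?_
  ring

theorem wedge_smul_right (c : 𝕜) (σ τ : PreFock 𝕜 V) :
    wedge σ (c • τ) = c • wedge σ τ := by
  funext n x
  simp only [wedge, Pi.smul_apply, smul_eq_mul, Finset.mul_sum]
  refine Finset.sum_congr rfl fun _ _ => Finset.sum_congr rfl fun _ _ => ?_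
  ring

/-- The anti-symmetrized product as a bilinear map. -/
def wedgeₗ : PreFock 𝕜 V →ₗ[𝕜] PreFock 𝕜 V →ₗ[𝕜] PreFock 𝕜 V :=
  LinearMap.mk₂ 𝕜 wedge wedge_add_left wedge_smul_left wedge_add_right wedge_smul_right

@[simp] theorem wedge_zero_left (τ : PreFock 𝕜 V) : wedge 0 τ = 0 := map_zero (wedgeₗ.flip τ)
@[simp] theorem wedge_zero_right (σ : PreFock 𝕜 V) : wedge σ 0 = 0 := map_zero (wedgeₗ σ)
theorem wedge_neg_left (σ τ : PreFock 𝕜 V) : wedge (-σ) τ = -wedge σ τ := map_neg (wedgeₗ.flip τ) σ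
theorem wedge_neg_right (σ τ : PreFock 𝕜 V) : wedge σ (-τ) = -wedge σ τ := map_neg (wedgeₗ σ) τ
theorem wedge_sum_right {ι : Type*} (s : Finset ι) (σ : PreFock 𝕜 V) (τ : ι → PreFock 𝕜 V) :
    wedge σ (∑ i ∈ s, τ i) = ∑ i ∈ s, wedge σ (τ i) := map_sum (wedgeₗ σ) τ s

theorem wedge_par_par (σ τ : PreFock 𝕜 V) : wedge (par σ) (par τ) = par (wedge σ τ) := by
  funext n x
  simp only [wedge, par_apply, Finset.mul_sum]
  refine Finset.sum_congr rfl fun k _ => Finset.sum_congr rfl fun π _ => ?_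
  have h : (-1 : 𝕜) ^ n = (-1) ^ (k : ℕ) * (-1) ^ (n - k) := by
    rw [← pow_add, Nat.add_sub_cancel' (Nat.le_of_lt_succ k.2)]
  rw [h]
  ring

@[simp] theorem ins_unit (x : V) : ins x (unitPre : PreFock 𝕜 V) = 0 := by
  funext n y
  simp [ins_apply, unitPre]

/-- Reversal of the order of the arguments. -/
def revPre (σ : PreFock 𝕜 V) : PreFock 𝕜 V := fun n x => σ n fun j => x (Fin.rev j)

theorem pullPre_wedge {W : Type v} (f : W → V) (σ τ : PreFock 𝕜 V) :
    pullPre f (wedge σ τ) = wedge (pullPre f σ) (pullPre f τ) := rfl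

/-- Reversal of the arguments exchanges the factors of a product. -/
theorem revPre_wedge (σ τ : PreFock 𝕜 V) :
    revPre (wedge σ τ) = wedge (revPre τ) (revPre σ) := by
  funext n x
  simp only [revPre, wedge]
  rw [← Equiv.sum_comp (Fin.revPerm (n := n + 1))]
  refine Finset.sum_congr rfl fun k _ => ?_
  congr 1
  rw [← (MulAut.conj (Fin.revPerm : Equiv.Perm (Fin n))).toEquiv.sum_comp]
  refine Finset.sum_congr rfl fun π _ => ?_
  have hk := k.2
  have e1 : ∀ j : Fin n, x (Fin.rev ((MulAut.conj (Fin.revPerm : Equiv.Perm (Fin n))).toEquiv π j))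
      = x (π (Fin.rev j)) := by
    intro j
    simp [MulAut.conj_apply]
  have e2 : Equiv.Perm.sign ((MulAut.conj (Fin.revPerm : Equiv.Perm (Fin n))).toEquiv π) =
      Equiv.Perm.sign π := by
    change Equiv.Perm.sign (Fin.revPerm * π * Fin.revPerm⁻¹) = _
    rw [map_mul, map_mul, map_inv, mul_right_comm, mul_inv_cancel, one_mul]
  have hr : ((Fin.revPerm k : Fin (n + 1)) : ℕ) = n - k := by
    simp [Fin.val_rev]
  rw [e2]
  congr 1
  rw [mul_comm]
  have gen : ∀ (ρ : PreFock 𝕜 V) (a b : ℕ) (h : a = b) (z : Fin a → V) (z' : Fin b → V),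
      (∀ i (h1 : i < a) (h2 : i < b), z ⟨i, h1⟩ = z' ⟨i, h2⟩) → ρ a z = ρ b z' := by
    rintro ρ a _ rfl z z' h
    congr 1
    funext i
    exact h i i.2 i.2
  congr 1
  · refine gen τ _ _ (by rw [hr]; omega) _ _ fun i h1 h2 => ?_
    rw [e1]
    congr 2
    ext
    simp only [Fin.val_rev, hr]
    omega
  · refine gen σ _ _ hr _ _ fun i h1 h2 => ?_
    rw [e1]
    congr 2
    ext
    simp only [Fin.val_rev, hr] at *
    omega

section Alt

variable [NormedAddCommGroup V] [InnerProductSpace ℝ V]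

theorem IsAlt.add {σ τ : PreFock 𝕜 V} (hσ : IsAlt σ) (hτ : IsAlt τ) : IsAlt (σ + τ) := fun n => by
  obtain ⟨f, hf⟩ := hσ n
  obtain ⟨g, hg⟩ := hτ n
  exact ⟨f + g, fun x => by simp [hf, hg]⟩

theorem IsAlt.smul {σ : PreFock 𝕜 V} (c : 𝕜) (hσ : IsAlt σ) : IsAlt (c • σ) := fun n => by
  obtain ⟨f, hf⟩ := hσ n
  exact ⟨c • f, fun x => by simp [hf]⟩

theorem IsAlt.zero : IsAlt (0 : PreFock 𝕜 V) := fun n => ⟨0, fun x => by simp⟩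

theorem IsAlt.sum {ι : Type*} {s : Finset ι} {σ : ι → PreFock 𝕜 V} (h : ∀ i ∈ s, IsAlt (σ i)) :
    IsAlt (∑ i ∈ s, σ i) :=
  Finset.sum_induction _ IsAlt (fun _ _ => IsAlt.add) IsAlt.zero h

theorem IsAlt.par {σ : PreFock 𝕜 V} (hσ : IsAlt σ) : IsAlt (par σ) := fun n => by
  obtain ⟨f, hf⟩ := hσ n
  exact ⟨((-1) ^ n : 𝕜) • f, fun x => by simp [par_apply, hf]⟩

theorem IsAlt.unit : IsAlt (unitPre : PreFock 𝕜 V) := fun n => by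
  rcases n with _ | n
  · exact ⟨ContinuousAlternatingMap.constOfIsEmpty ℝ V (Fin 0) 1, fun x => by simp [unitPre]⟩
  · exact ⟨0, fun x => by simp [unitPre]⟩

theorem IsAlt.ins {σ : PreFock 𝕜 V} (hσ : IsAlt σ) (x : V) : IsAlt (ins x σ) := fun n => by
  obtain ⟨f, hf⟩ := hσ (n + 1)
  exact ⟨((n + 1 : ℕ) : 𝕜) • f.curryLeft x, fun y => by
    simp [ins_apply, hf, Matrix.vecCons]⟩

theorem IsAlt.pull {W : Type v} [NormedAddCommGroup W] [InnerProductSpace ℝ W]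
    {σ : PreFock 𝕜 V} (hσ : IsAlt σ) (f : W →L[ℝ] V) : IsAlt (pullPre f σ) := fun n => by
  obtain ⟨g, hg⟩ := hσ n
  exact ⟨g.compContinuousLinearMap f, fun x => by simp [pullPre, hg]; rfl⟩

theorem IsAlt.wedge {σ τ : PreFock 𝕜 V} (hσ : IsAlt σ) (hτ : IsAlt τ) : IsAlt (wedge σ τ) := by
  intro n
  have key : ∀ k : Fin (n + 1), ∃ f : V [⋀^Fin n]→L[ℝ] 𝕜, ∀ x, f x =
      ∑ π : Equiv.Perm (Fin n), ((Equiv.Perm.sign π : ℤ) : 𝕜) *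
      (σ k (fun j : Fin k => x (π ⟨j, by omega⟩)) *
        τ (n - k) (fun j : Fin (n - k) => x (π ⟨k + j, by omega⟩))) := by
    intro k
    obtain ⟨f, hf⟩ := hσ k
    obtain ⟨g, hg⟩ := hτ (n - k)
    let e : Fin k ⊕ Fin (n - k) ≃ Fin n :=
      finSumFinEquiv.trans (finCongr (by have := k.2; omega))
    let m : MultilinearMap ℝ (fun _ : Fin n => V) 𝕜 := (LinearMap.mul' ℝ 𝕜).compMultilinearMap
      ((f.toMultilinearMap.domCoprod g.toMultilinearMap).domDomCongr e)
    have hm : ∀ x, m x = f (fun j : Fin k => x ⟨j, by omega⟩) *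
          g (fun j : Fin (n - k) => x ⟨k + j, by omega⟩) := fun x => rfl
    have ha : ∀ x, MultilinearMap.alternatization m x =
        ∑ π : Equiv.Perm (Fin n), ((Equiv.Perm.sign π : ℤ) : 𝕜) *
          (f (fun j : Fin k => x (π ⟨j, by omega⟩)) *
            g (fun j : Fin (n - k) => x (π ⟨k + j, by omega⟩))) := by
      intro x
      rw [MultilinearMap.alternatization_apply]
      refine Finset.sum_congr rfl fun π _ => ?_
      rw [MultilinearMap.domDomCongr_apply, hm, Units.smul_def, zsmul_eq_mul]
    refine ⟨{ MultilinearMap.alternatization m with cont := ?_ }, fun x => ?_⟩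
    · change Continuous fun x => MultilinearMap.alternatization m x
      simp only [ha]
      refine continuous_finsetSum _ fun π _ => continuous_const.mul
        ((f.cont.comp (by fun_prop)).mul (g.cont.comp (by fun_prop)))
    · simp only [hf, hg]
      exact ha x
  choose f hf using key
  refine ⟨∑ k, (n.factorial : 𝕜)⁻¹ • f k, fun x => ?_⟩
  simp [FermionGBF.wedge, hf]

theorem ins_ins {σ : PreFock 𝕜 V} (hσ : IsAlt σ) (x y : V) :
    ins x (ins y σ) = -ins y (ins x σ) := by
  funext n z
  obtain ⟨f, hf⟩ := hσ (n + 1 + 1)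
  simp only [ins_apply, Pi.neg_apply, hf]
  have h := f.toAlternatingMap.map_swap (Fin.cons y (Fin.cons x z : Fin (n + 1) → V))
    (i := 0) (j := 1) (by simp)
  have h2 : (Fin.cons y (Fin.cons x z : Fin (n + 1) → V) : Fin (n + 2) → V) ∘ Equiv.swap 0 1 =
      Fin.cons x (Fin.cons y z : Fin (n + 1) → V) := by
    funext i
    refine Fin.cases ?_ (fun i => Fin.cases ?_ (fun i => ?_) i) i
    · simp
    · simp
    · have hs : Equiv.swap (0 : Fin (n + 2)) 1 i.succ.succ = i.succ.succ :=
        Equiv.swap_apply_of_ne_of_ne (Fin.succ_ne_zero _)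
          (fun h => Fin.succ_ne_zero i (Fin.succ_injective _ h))
      simp [hs]
  rw [h2] at h
  change f _ = -f _ at h
  rw [h]
  ring

theorem ins_smul_arg {σ : PreFock 𝕜 V} (hσ : IsAlt σ) (c : ℝ) (x : V) :
    ins (c • x) σ = (c : 𝕜) • ins x σ := by
  funext n z
  obtain ⟨f, hf⟩ := hσ (n + 1)
  have : f (Fin.cons (c • x) z) = c • f (Fin.cons x z) :=
    f.toAlternatingMap.map_vecCons_smul z c x
  simp only [ins_apply, Pi.smul_apply, hf, this, RCLike.real_smul_eq_coe_mul, smul_eq_mul]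
  ring

theorem unit_wedge {σ : PreFock 𝕜 V} (hσ : IsAlt σ) : wedge unitPre σ = σ := by
  suffices h : ∀ n, ∀ σ : PreFock 𝕜 V, IsAlt σ → wedge unitPre σ n = σ n from
    funext fun n => h n σ hσ
  intro n
  induction n with
  | zero => intro σ _; funext x; simp [wedge_zero_degree, unitPre]
  | succ n ih =>
    intro σ hσ
    refine succ_ext fun x => ?_
    have hp : par (unitPre : PreFock 𝕜 V) = unitPre := by
      funext n x
      by_cases h : n = 0
      · subst h; simp [par_apply, unitPre]
      · simp [par_apply, unitPre, h]
    rw [ins_wedge IsAlt.unit hσ, ins_unit, wedge_zero_left, zero_add, hp, ih _ (hσ.ins x)]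

/-- Both sides have the same annihilation operators by the Leibniz rule, so the claim follows by
induction on the degree. -/
theorem wedge_assoc {σ τ ρ : PreFock 𝕜 V} (hσ : IsAlt σ) (hτ : IsAlt τ) (hρ : IsAlt ρ) :
    wedge (wedge σ τ) ρ = wedge σ (wedge τ ρ) := by
  suffices h : ∀ n, ∀ σ τ ρ : PreFock 𝕜 V, IsAlt σ → IsAlt τ → IsAlt ρ →
      wedge (wedge σ τ) ρ n = wedge σ (wedge τ ρ) n from funext fun n => h n σ τ ρ hσ hτ hρ
  intro n
  induction n with
  | zero =>
    intro σ τ ρ _ _ _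
    funext x
    simp only [wedge_zero_degree, mul_assoc]
  | succ n ih =>
    intro σ τ ρ hσ hτ hρ
    refine succ_ext fun x => ?_
    rw [ins_wedge (hσ.wedge hτ) hρ, ins_wedge hσ hτ, ins_wedge hσ (hτ.wedge hρ), ins_wedge hτ hρ,
      wedge_add_left, wedge_add_right, ← wedge_par_par]
    simp only [Pi.add_apply]
    rw [ih _ _ _ (hσ.ins x) hτ hρ, ih _ _ _ hσ.par (hτ.ins x) hρ, ih _ _ _ hσ.par hτ.par (hρ.ins x)]
    abel

/-- Sequences of pure f-degree. -/
def IsPar (a : ZMod 2) (σ : PreFock 𝕜 V) : Prop := ∀ n : ℕ, (n : ZMod 2) ≠ a → ∀ x, σ n x = 0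

theorem IsPar.par_eq {a : ZMod 2} {σ : PreFock 𝕜 V} (h : IsPar a σ) :
    par σ = ((-1) ^ a.val : 𝕜) • σ := by
  funext n x
  rw [par_apply, Pi.smul_apply, Pi.smul_apply, smul_eq_mul]
  by_cases hn : (n : ZMod 2) = a
  · subst hn
    rw [ZMod.val_natCast, ← neg_one_pow_eq_pow_mod_two]
  · rw [h n hn, mul_zero, mul_zero]

theorem IsPar.ins {a : ZMod 2} {σ : PreFock 𝕜 V} (h : IsPar a σ) (x : V) :
    IsPar (a + 1) (ins x σ) := by
  intro n hn y
  rw [ins_apply, h (n + 1) _, mul_zero]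
  intro h1
  apply hn
  rw [← h1]
  push_cast
  rw [add_assoc, (by decide : (1 + 1 : ZMod 2) = 0), add_zero]

/-- The anti-symmetrized product is graded commutative. -/
theorem wedge_comm {a b : ZMod 2} {σ τ : PreFock 𝕜 V} (hσ : IsAlt σ) (hτ : IsAlt τ)
    (ha : IsPar a σ) (hb : IsPar b τ) :
    wedge σ τ = ((-1) ^ (a.val * b.val) : 𝕜) • wedge τ σ := by
  suffices h : ∀ n, ∀ (a b : ZMod 2) (σ τ : PreFock 𝕜 V), IsAlt σ → IsAlt τ → IsPar a σ →
      IsPar b τ → wedge σ τ n = (((-1) ^ (a.val * b.val) : 𝕜) • wedge τ σ) n from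
    funext fun n => h n a b σ τ hσ hτ ha hb
  intro n
  induction n with
  | zero =>
    intro a b σ τ hσ hτ ha hb
    funext x
    rw [Pi.smul_apply, Pi.smul_apply, wedge_zero_degree, wedge_zero_degree]
    by_cases h : a = 0
    · subst h; simp [mul_comm]
    · rw [ha 0 (by simpa [eq_comm] using h)]; simp
  | succ n ih =>
    intro a b σ τ hσ hτ ha hb
    refine succ_ext fun x => ?_
    rw [map_smul, ins_wedge hσ hτ, ins_wedge hτ hσ, ha.par_eq, hb.par_eq, wedge_smul_left,
      wedge_smul_left, Pi.add_apply, Pi.smul_apply, Pi.smul_apply, Pi.add_apply, Pi.smul_apply,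
      ih _ _ _ _ (hσ.ins x) hτ (ha.ins x) hb, ih _ _ _ _ hσ (hτ.ins x) ha (hb.ins x),
      Pi.smul_apply, Pi.smul_apply, smul_add, smul_smul, smul_smul, add_comm]
    have h1 : ∀ a b : ZMod 2, (-1 : ℤ) ^ a.val * (-1) ^ (a.val * (b + 1).val) =
      (-1) ^ (a.val * b.val) := by decide
    have h2 : ∀ a b : ZMod 2, (-1 : ℤ) ^ ((a + 1).val * b.val) =
      (-1) ^ (a.val * b.val) * (-1) ^ b.val := by decide
    have h1' := congrArg (Int.cast : ℤ → 𝕜) (h1 a b)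
    have h2' := congrArg (Int.cast : ℤ → 𝕜) (h2 a b)
    push_cast at h1' h2'
    rw [h1', h2']

end Alt

end

/-! ### Norms of anti-symmetrized products -/

section Norm

variable {𝕜 : Type} [RCLike 𝕜] {V : Type u} [NormedAddCommGroup V] [InnerProductSpace ℝ V]
  [CompleteSpace V]

/-- The square norm, possibly infinite, of the component of degree `n`. -/
def sqN (n : ℕ) (σ : PreFock 𝕜 V) : ℝ≥0∞ :=
  (n.factorial : ℝ≥0∞) * ∑' i : Fin n → StdIdx V,
    ENNReal.ofReal (‖σ n (fun j => stdBasis V (i j))‖ ^ 2)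

/-- The total square norm, possibly infinite. -/
def sqT (σ : PreFock 𝕜 V) : ℝ≥0∞ := ∑' n, sqN n σ

@[simp] theorem sqN_zero (n : ℕ) : sqN n (0 : PreFock 𝕜 V) = 0 := by
  simp [sqN]

theorem sqN_par (n : ℕ) (σ : PreFock 𝕜 V) : sqN n (par σ) = sqN n σ := by
  simp [sqN, par_apply]

theorem sqT_eq (σ : PreFock 𝕜 V) :
    sqT σ = ∑' p : (n : ℕ) × (Fin n → StdIdx V), ENNReal.ofReal
        ((p.1.factorial : ℝ) * ‖σ p.1 (fun j => stdBasis V (p.2 j))‖ ^ 2) := by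
  rw [ENNReal.tsum_sigma', sqT]
  refine tsum_congr fun n => ?_
  simp only [ENNReal.ofReal_mul (Nat.cast_nonneg _), ENNReal.tsum_mul_left, ENNReal.ofReal_natCast]
  rfl

theorem isFock_iff (σ : PreFock 𝕜 V) : IsFock 𝕜 V σ ↔ IsAlt σ ∧ sqT σ ≠ ⊤ := by
  rw [sqT_eq]
  constructor
  · rintro ⟨h1, h2⟩
    exact ⟨h1, h2.tsum_ofReal_ne_top⟩
  · rintro ⟨h1, h2⟩
    refine ⟨h1, (ENNReal.summable_toReal h2).congr fun p => ?_⟩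
    exact ENNReal.toReal_ofReal (by positivity)

theorem Fock.isAlt (σ : Fock 𝕜 V) : IsAlt σ.fn := σ.isFock.alt

theorem ofReal_norm_sq (σ : Fock 𝕜 V) : ENNReal.ofReal (‖σ‖ ^ 2) = sqT σ.fn := by
  rw [sqT_eq, ← (σ.hasSum_norm_sq (stdBasis V)).tsum_eq,
    ENNReal.ofReal_tsum_of_nonneg (fun i => by positivity) (σ.summable_sq _)]

end Norm

section Frame

variable {V : Type u} [NormedAddCommGroup V] [InnerProductSpace ℝ V]

/-- The annihilation operator of the complex vector `z.1 + i z.2`. -/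
def insC (z : V × V) : PreFock ℂ V →ₗ[ℂ] PreFock ℂ V := ins z.1 + Complex.I • ins z.2

theorem insC_apply (z : V × V) (σ : PreFock ℂ V) :
    insC z σ = ins z.1 σ + Complex.I • ins z.2 σ := rfl

theorem IsAlt.insC {σ : PreFock ℂ V} (hσ : IsAlt σ) (z : V × V) : IsAlt (insC z σ) :=
  (hσ.ins _).add ((hσ.ins _).smul _)

theorem insC_wedge {σ τ : PreFock ℂ V} (hσ : IsAlt σ) (hτ : IsAlt τ) (z : V × V) :
    insC z (wedge σ τ) = wedge (insC z σ) τ + wedge (par σ) (insC z τ) := by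
  simp only [insC_apply, ins_wedge hσ hτ, wedge_add_left, wedge_add_right, wedge_smul_left,
    wedge_smul_right, smul_add]
  abel

theorem insC_insC {σ : PreFock ℂ V} (hσ : IsAlt σ) (z w : V × V) :
    insC z (insC w σ) = -insC w (insC z σ) := by
  simp only [insC_apply, map_add, map_smul, smul_add]
  rw [ins_ins hσ z.1 w.1, ins_ins hσ z.1 w.2, ins_ins hσ z.2 w.1, ins_ins hσ z.2 w.2]
  simp only [smul_neg]
  abel

theorem insC_par (z : V × V) (σ : PreFock ℂ V) : insC z (par σ) = -par (insC z σ) := by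
  simp only [insC_apply, ins_par, map_add, map_smul, smul_neg]
  abel

variable [CompleteSpace V]

/-- A family of complex vectors satisfying Parseval's identity for complex functionals. -/
def IsFrame {κ : Type*} (z : κ → V × V) : Prop := ∀ f : V →L[ℝ] ℂ,
  ∑' a, ENNReal.ofReal (‖f (z a).1 + Complex.I * f (z a).2‖ ^ 2) =
    ∑' i, ENNReal.ofReal (‖f (stdBasis V i)‖ ^ 2)

/-- The number operator is the sum, over a frame, of the products of creation and annihilation
operators. -/
theorem succ_sqN {κ : Type*} {z : κ → V × V} (hz : IsFrame z) {σ : PreFock ℂ V} (hσ : IsAlt σ)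
    (n : ℕ) : ((n + 1 : ℕ) : ℝ≥0∞) * sqN (n + 1) σ = ∑' a, sqN n (insC (z a) σ) := by
  obtain ⟨f, hf⟩ := hσ (n + 1)
  let g : (Fin n → StdIdx V) → V →L[ℝ] ℂ := fun i =>
    (ContinuousMultilinearMap.apply ℝ (fun _ : Fin n => V) ℂ
      (fun j => stdBasis V (i j))).comp f.toContinuousMultilinearMap.curryLeft
  have hg : ∀ i v, σ (n + 1) (Fin.cons v fun j => stdBasis V (i j)) = g i v := fun i v => hf _
  have hi : ∀ a i, ENNReal.ofReal (‖insC (z a) σ n fun j => stdBasis V (i j)‖ ^ 2) =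
      ((n + 1 : ℕ) : ℝ≥0∞) ^ 2 *
        ENNReal.ofReal (‖g i (z a).1 + Complex.I * g i (z a).2‖ ^ 2) := by
    intro a i
    have : insC (z a) σ n (fun j => stdBasis V (i j)) =
        ((n + 1 : ℕ) : ℂ) * (g i (z a).1 + Complex.I * g i (z a).2) := by
      rw [insC_apply, Pi.add_apply, Pi.add_apply, Pi.smul_apply, Pi.smul_apply, ins_apply,
        ins_apply, hg, hg, smul_eq_mul]
      ring
    rw [this, norm_mul, mul_pow, ENNReal.ofReal_mul (by positivity), Complex.norm_natCast,
      ENNReal.ofReal_pow (by positivity), ENNReal.ofReal_natCast]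
  simp only [sqN, hi, ENNReal.tsum_mul_left]
  rw [ENNReal.tsum_comm]
  have h1 : ∀ i, ∑' a, ENNReal.ofReal (‖g i (z a).1 + Complex.I * g i (z a).2‖ ^ 2) =
    ∑' k, ENNReal.ofReal (‖g i (stdBasis V k)‖ ^ 2) := fun i => hz (g i)
  rw [tsum_congr h1, ENNReal.tsum_comm,
    tsum_cons (stdBasis V) n (fun x => ENNReal.ofReal (‖σ (n + 1) x‖ ^ 2))]
  simp only [hg]
  rw [Nat.factorial_succ, Nat.cast_mul]
  ring

/-- If every vector of a frame is annihilated by one of two factors, then the square norm of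
their product is the product of their square norms. -/
theorem sqN_wedge {κ : Type*} {z : κ → V × V} (hz : IsFrame z) (n : ℕ) :
    ∀ (σ τ : PreFock ℂ V), IsAlt σ → IsAlt τ → (∀ a, insC (z a) σ = 0 ∨ insC (z a) τ = 0) →
      sqN n (wedge σ τ) =
        ∑ p ∈ Finset.HasAntidiagonal.antidiagonal n, sqN p.1 σ * sqN p.2 τ := by
  induction n with
  | zero =>
    intro σ τ _ _ _
    have : ∀ ρ : PreFock ℂ V, sqN 0 ρ = ENNReal.ofReal (‖ρ 0 (fun j => j.elim0)‖ ^ 2) := by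
      intro ρ
      rw [sqN, tsum_eq_single (fun j => j.elim0) (fun i hi => (hi (funext fun j => j.elim0)).elim)]
      simp only [Nat.factorial_zero, Nat.cast_one, one_mul]
      congr 4
      funext j
      exact j.elim0
    simp only [Finset.Nat.antidiagonal_zero, Finset.sum_singleton, this, wedge_zero_degree,
      norm_mul,
      mul_pow]
    rw [ENNReal.ofReal_mul (by positivity)]
  | succ n ih =>
    intro σ τ hσ hτ h
    have h0 : ((n + 1 : ℕ) : ℝ≥0∞) ≠ 0 := by exact_mod_cast n.succ_ne_zero
    have htop : ((n + 1 : ℕ) : ℝ≥0∞) ≠ ⊤ := ENNReal.natCast_ne_top _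
    rw [← ENNReal.mul_right_inj h0 htop, succ_sqN hz (hσ.wedge hτ)]
    have key : ∀ a, sqN n (insC (z a) (wedge σ τ)) =
        ∑ p ∈ Finset.HasAntidiagonal.antidiagonal n, sqN p.1 (insC (z a) σ) * sqN p.2 τ +
        ∑ p ∈ Finset.HasAntidiagonal.antidiagonal n, sqN p.1 σ * sqN p.2 (insC (z a) τ) := by
      intro a
      rw [insC_wedge hσ hτ]
      rcases h a with h1 | h1
      · rw [h1, wedge_zero_left, zero_add, ih _ _ hσ.par (hτ.insC _)]
        · simp [sqN_par]
        · intro b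
          rcases h b with h2 | h2
          · left; rw [insC_par, h2, map_zero, neg_zero]
          · right; rw [insC_insC hτ, h2, map_zero, neg_zero]
      · rw [h1, wedge_zero_right, add_zero, ih _ _ (hσ.insC _) hτ]
        · simp
        · intro b
          rcases h b with h2 | h2
          · left; rw [insC_insC hσ, h2, map_zero, neg_zero]
          · right; exact h2
    rw [tsum_congr key, ENNReal.tsum_add, Summable.tsum_finsetSum (fun _ _ => ENNReal.summable),
      Summable.tsum_finsetSum (fun _ _ => ENNReal.summable)]
    simp only [ENNReal.tsum_mul_left, ENNReal.tsum_mul_right, ← succ_sqN hz hσ, ← succ_sqN hz hτ]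
    have e : ∀ p ∈ Finset.HasAntidiagonal.antidiagonal (n + 1),
        ((n + 1 : ℕ) : ℝ≥0∞) * (sqN p.1 σ * sqN p.2 τ) =
          ((p.1 : ℕ) : ℝ≥0∞) * sqN p.1 σ * sqN p.2 τ +
            sqN p.1 σ * (((p.2 : ℕ) : ℝ≥0∞) * sqN p.2 τ) := by
      intro p hp
      rw [← Finset.HasAntidiagonal.mem_antidiagonal.1 hp]
      push_cast
      ring
    rw [Finset.mul_sum, Finset.sum_congr rfl e, Finset.sum_add_distrib]
    congr 1
    · rw [Finset.Nat.sum_antidiagonal_succ]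
      simp
    · rw [Finset.Nat.sum_antidiagonal_succ']
      simp

theorem sqT_wedge {κ : Type*} {z : κ → V × V} (hz : IsFrame z) {σ τ : PreFock ℂ V}
    (hσ : IsAlt σ) (hτ : IsAlt τ) (h : ∀ a, insC (z a) σ = 0 ∨ insC (z a) τ = 0) :
    sqT (wedge σ τ) = sqT σ * sqT τ := by
  simp only [sqT, sqN_wedge hz _ σ τ hσ hτ h]
  rw [← ENNReal.tsum_mul_right]
  simp only [← ENNReal.tsum_mul_left]
  rw [← ENNReal.tsum_prod, ← Finset.HasAntidiagonal.sigmaAntidiagonalEquivProd.tsum_eq,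
    ENNReal.tsum_sigma']
  refine tsum_congr fun n => ?_
  rw [tsum_fintype, ← Finset.sum_coe_sort]
  rfl

end Frame

/-- A bilinear map which multiplies norms multiplies inner products. -/
theorem inner_map_of_norm_map {X Y Z : Type*} [NormedAddCommGroup X] [InnerProductSpace ℂ X]
    [NormedAddCommGroup Y] [InnerProductSpace ℂ Y] [NormedAddCommGroup Z] [InnerProductSpace ℂ Z]
    (W : X →ₗ[ℂ] Y →ₗ[ℂ] Z) (h : ∀ x y, ‖W x y‖ = ‖x‖ * ‖y‖) (x x' : X) (y y' : Y) :
    inner ℂ (W x y) (W x' y') = inner ℂ x x' * inner ℂ y y' := by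
  have h1 : ∀ x x' y, inner ℂ (W x y) (W x' y) = inner ℂ x x' * inner ℂ y y := by
    intro x x' y
    have e : ∀ a b : X, W a y + W b y = W (a + b) y := fun a b => by simp
    have e' : ∀ a b : X, W a y - W b y = W (a - b) y := fun a b => by simp
    have e2 : ∀ b : X, Complex.I • W b y = W (Complex.I • b) y := fun b => by simp
    rw [inner_eq_sum_norm_sq_div_four (𝕜 := ℂ), inner_eq_sum_norm_sq_div_four (𝕜 := ℂ) x,
      inner_self_eq_norm_sq_to_K]
    simp only [RCLike.I_to_complex]
    rw [e2, e, e, e', e', h, h, h, h]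
    push_cast
    ring
  set B : Y → Y → ℂ := fun y y' => inner ℂ (W x y) (W x' y') - inner ℂ x x' * inner ℂ y y' with hB
  have b0 : ∀ y, B y y = 0 := fun y => by simp [hB, h1]
  have b1 := b0 (y + y')
  have b2 := b0 (y + Complex.I • y')
  have c1 := b0 y
  have c2 := b0 y'
  simp only [hB, map_add, map_smul, inner_add_left, inner_add_right, inner_smul_left,
    inner_smul_right, Complex.conj_I] at b1 b2 c1 c2
  have hI : Complex.I * Complex.I = -1 := Complex.I_mul_I
  have : (2 * Complex.I) * (inner ℂ (W x y) (W x' y') - inner ℂ x x' * inner ℂ y y') = 0 := by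
    linear_combination b2 + Complex.I * b1 - (1 + Complex.I) * c1 -
      (1 + Complex.I) * c2 + (inner ℂ (W x y') (W x' y') - inner ℂ x x' * inner ℂ y' y') * hI
  have h2I : (2 * Complex.I) ≠ 0 := by simp
  exact sub_eq_zero.1 ((mul_eq_zero.1 this).resolve_left h2I)

/-! ### Evaluation functionals and completeness of the Fock space -/

section

variable {𝕜 : Type} [RCLike 𝕜] {V : Type u} [NormedAddCommGroup V] [InnerProductSpace ℝ V]
  [CompleteSpace V]

/-- A functional is bounded by the square sum of its values on an orthonormal basis. -/
theorem clm_sq_le {ι : Type*} (b : HilbertBasis ι ℝ V) (f : V →L[ℝ] 𝕜) (x : V) :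
    ENNReal.ofReal (‖f x‖ ^ 2) ≤
      ENNReal.ofReal (‖x‖ ^ 2) * ∑' i, ENNReal.ofReal (‖f (b i)‖ ^ 2) := by
  have key : ∀ x, ‖f x‖ ^ 2 = ((RCLike.reCLM (K := 𝕜)).comp f) x ^ 2 +
      ((RCLike.imCLM (K := 𝕜)).comp f) x ^ 2 := by
    intro x
    rw [← RCLike.normSq_eq_def', RCLike.normSq_apply]
    simp [sq]
  have h1 := (hasSum_functional_sq b ((RCLike.reCLM (K := 𝕜)).comp f)).add
    (hasSum_functional_sq b ((RCLike.imCLM (K := 𝕜)).comp f))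
  simp only [← key] at h1
  rw [← ENNReal.ofReal_tsum_of_nonneg (fun i => by positivity) h1.summable, h1.tsum_eq,
    ← ENNReal.ofReal_mul (by positivity), key]
  refine ENNReal.ofReal_le_ofReal ?_
  have h2 : ∀ l : V →L[ℝ] ℝ, l x ^ 2 ≤ ‖x‖ ^ 2 * ‖(InnerProductSpace.toDual ℝ V).symm l‖ ^ 2 := by
    intro l
    have h3 := l.le_opNorm x
    rw [← mul_pow, LinearIsometryEquiv.norm_map, ← sq_abs, mul_comm]
    exact pow_le_pow_left₀ (abs_nonneg _) h3 2
  rw [mul_add]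
  exact add_le_add (h2 _) (h2 _)

/-- A multilinear map is bounded by the square sum of its values on an orthonormal basis, by
induction on the number of arguments. -/
theorem cmm_sq_le {ι : Type*} (b : HilbertBasis ι ℝ V) :
    ∀ (n : ℕ) (f : ContinuousMultilinearMap ℝ (fun _ : Fin n => V) 𝕜) (x : Fin n → V),
    ENNReal.ofReal (‖f x‖ ^ 2) ≤ (∏ j, ENNReal.ofReal (‖x j‖ ^ 2)) *
      ∑' i : Fin n → ι, ENNReal.ofReal (‖f (fun j => b (i j))‖ ^ 2) := by
  intro n
  induction n with
  | zero =>
    intro f x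
    rw [tsum_eq_single (fun j => j.elim0) (fun i hi => (hi (funext fun j => j.elim0)).elim),
      Finset.univ_eq_empty, Finset.prod_empty, one_mul]
    refine le_of_eq ?_
    congr 4
    funext j
    exact j.elim0
  | succ n ih =>
    intro f x
    have h1 := ih (f.curryLeft (x 0)) (Fin.tail x)
    rw [ContinuousMultilinearMap.curryLeft_apply, Fin.cons_self_tail] at h1
    refine h1.trans ?_
    rw [Fin.prod_univ_succ, tsum_cons b n (fun x => ENNReal.ofReal (‖f x‖ ^ 2)),
      mul_comm (ENNReal.ofReal (‖x 0‖ ^ 2)), mul_assoc, ENNReal.tsum_comm,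
      ← ENNReal.tsum_mul_left (a := ENNReal.ofReal (‖x 0‖ ^ 2))]
    refine mul_le_mul_right (ENNReal.tsum_le_tsum fun i => ?_) _
    exact clm_sq_le b ((ContinuousMultilinearMap.apply ℝ (fun _ : Fin n => V) 𝕜
      (fun j => b (i j))).comp f.curryLeft) (x 0)

/-- Evaluation at a fixed tuple is bounded on the Fock space. -/
theorem Fock.norm_fn_le (σ : Fock 𝕜 V) (n : ℕ) (x : Fin n → V) :
    ‖σ.fn n x‖ ≤ ‖σ‖ * ∏ j, ‖x j‖ := by
  obtain ⟨f, hf⟩ := σ.isAlt n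
  have h1 := cmm_sq_le (stdBasis V) n f.toContinuousMultilinearMap x
  have h2 : ∑' i : Fin n → StdIdx V, ENNReal.ofReal (‖f.toContinuousMultilinearMap
      (fun j => stdBasis V (i j))‖ ^ 2) ≤ sqN n σ.fn := by
    simp only [sqN, hf]
    refine le_mul_of_one_le_left zero_le ?_
    exact_mod_cast n.factorial_pos
  have h3 : sqN n σ.fn ≤ ENNReal.ofReal (‖σ‖ ^ 2) := by
    rw [ofReal_norm_sq]
    exact ENNReal.le_tsum n
  have h4 := h1.trans (mul_le_mul_right (h2.trans h3) _)
  rw [← ENNReal.ofReal_prod_of_nonneg (fun _ _ => by positivity),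
    ← ENNReal.ofReal_mul (Finset.prod_nonneg fun _ _ => by positivity),
    ENNReal.ofReal_le_ofReal_iff (by positivity), Finset.prod_pow, ← mul_pow] at h4
  rw [hf, mul_comm]
  exact (sq_le_sq₀ (norm_nonneg _) (by positivity)).1 h4

/-- Evaluation at a fixed tuple. -/
def evalL (n : ℕ) (x : Fin n → V) : Fock 𝕜 V →L[𝕜] 𝕜 :=
  LinearMap.mkContinuous ⟨⟨fun σ => σ.fn n x, fun _ _ => rfl⟩, fun _ _ => rfl⟩ (∏ j, ‖x j‖)
    fun σ => by rw [mul_comm]; exact σ.norm_fn_le n x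

@[simp] theorem evalL_apply (n : ℕ) (x : Fin n → V) (σ : Fock 𝕜 V) :
    evalL n x σ = σ.fn n x := rfl

/-- A Cauchy sequence converges componentwise, in the operator norm, as well as in the space of
coefficients; the two limits determine each other. -/
instance Fock.instCompleteSpace : CompleteSpace (Fock 𝕜 V) := by
  refine Metric.complete_of_cauchySeq_tendsto fun u hu => ?_
  choose f hf using fun m n => (u m).isAlt n
  have hd : ∀ m m' n, dist (f m n) (f m' n) ≤ dist (u m) (u m') := by
    intro m m' n
    rw [dist_eq_norm, dist_eq_norm]
    refine ContinuousAlternatingMap.opNorm_le_bound _ (norm_nonneg _) fun x => ?_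
    have h := (u m - u m').norm_fn_le n x
    have h2 : (u m - u m').fn n x = (f m n - f m' n) x := by
      rw [ContinuousAlternatingMap.sub_apply, ← hf, ← hf]
      rfl
    rwa [h2] at h
  have hc : ∀ n, CauchySeq fun m => f m n := by
    intro n
    rw [Metric.cauchySeq_iff] at hu ⊢
    intro ε hε
    obtain ⟨N, hN⟩ := hu ε hε
    exact ⟨N, fun m hm m' hm' => (hd m m' n).trans_lt (hN m hm m' hm')⟩
  choose F hF using fun n => cauchySeq_tendsto_of_complete (hc n)
  let e : Fock 𝕜 V →ₗᵢ[𝕜] lp (fun _ : (n : ℕ) × (Fin n → StdIdx V) => 𝕜) 2 :=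
    ⟨coeffLp (stdBasis V), norm_coeffLp (stdBasis V)⟩
  obtain ⟨c, hcl⟩ := cauchySeq_tendsto_of_complete
    (e.isometry.uniformContinuous.comp_cauchySeq hu)
  have hce : (c : ∀ p : (n : ℕ) × (Fin n → StdIdx V), 𝕜) =
      coeffs (stdBasis V) (fun n x => F n x) := by
    funext p
    have h1 : Filter.Tendsto (fun m => (e (u m) : ∀ p : (n : ℕ) × (Fin n → StdIdx V), 𝕜) p)
        Filter.atTop (nhds (c p)) :=
      ((lp.lipschitzWith_one_eval (E := fun _ : (n : ℕ) × (Fin n → StdIdx V) => 𝕜) 2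
        p).continuous.tendsto c).comp hcl
    have h2 : Filter.Tendsto (fun m => (e (u m) : ∀ p : (n : ℕ) × (Fin n → StdIdx V), 𝕜) p)
        Filter.atTop (nhds (coeffs (stdBasis V) (fun n x => F n x) p)) := by
      have h3 : ∀ m, (e (u m) : ∀ p : (n : ℕ) × (Fin n → StdIdx V), 𝕜) p =
          (Real.sqrt (p.1.factorial : ℝ) : 𝕜) * f m p.1 (fun j => stdBasis V (p.2 j)) := by
        intro m
        rw [← hf]
        rfl
      simp only [h3]
      refine Filter.Tendsto.const_mul _ ?_
      exact ((ContinuousEvalConst.continuous_eval_const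
        (fun j => stdBasis V (p.2 j))).tendsto (F p.1)).comp (hF p.1)
    exact tendsto_nhds_unique h1 h2
  have hσ : IsFock 𝕜 V (fun n x => F n x) := by
    have h1 : Memℓp (coeffs (stdBasis V) (fun n x => F n x : PreFock 𝕜 V)) 2 := by
      rw [← hce]
      exact lp.memℓp c
    exact ⟨fun n => ⟨F n, fun x => rfl⟩, (memlp_iff (stdBasis V) (fun n x => F n x)).1 h1⟩
  obtain ⟨σ, hσ'⟩ : ∃ σ : Fock 𝕜 V, σ.fn = fun n x => F n x := ⟨Fock.mk _ hσ, rfl⟩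
  have hec : e σ = c := by
    refine lp.ext ?_
    rw [hce, ← hσ']
    rfl
  refine ⟨σ, ?_⟩
  rw [e.isometry.isEmbedding.isInducing.tendsto_nhds_iff, hec]
  exact hcl

end

/-! ### Holomorphic functions and adapted bases -/

section

variable {V : Type u} [NormedAddCommGroup V] [InnerProductSpace ℝ V]

/-- Sequences of functions on which `J` acts in every argument as multiplication by `c`,
expressed by annihilation operators. For `c = i` these are the holomorphic and for `c = -i` the
anti-holomorphic functions. -/
def IsHolo (c : ℂ) (J : V →ₗ[ℝ] V) (σ : PreFock ℂ V) : Prop :=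
  ∀ x, ins (J x) σ = c • ins x σ

/-- For anti-symmetric functions it is enough to consider the first argument. -/
theorem isHolo_iff {c : ℂ} {J : V →ₗ[ℝ] V} {σ : PreFock ℂ V} (hσ : IsAlt σ) :
    IsHolo c J σ ↔ ∀ (n : ℕ) (x : Fin n → V) (j : Fin n),
      σ n (Function.update x j (J (x j))) = c * σ n x := by
  constructor
  · intro h n x j
    obtain _ | n := n
    · exact j.elim0
    obtain ⟨f, hf⟩ := hσ (n + 1)
    have h1 := congrFun (congrFun (h (x j)) n) (j.removeNth x)
    rw [Pi.smul_apply, Pi.smul_apply, ins_apply, ins_apply, smul_eq_mul, mul_left_comm] at h1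
    have h2 := mul_left_cancel₀ (by exact_mod_cast n.succ_ne_zero) h1
    have h3 : Function.update x j (J (x j)) = j.insertNth (J (x j)) (j.removeNth x) := by
      rw [Fin.insertNth_removeNth]
    have h4 : x = j.insertNth (x j) (j.removeNth x) := by simp
    rw [hf, hf] at h2 ⊢
    rw [h3, f.map_insertNth]
    conv_rhs => rw [h4, f.map_insertNth]
    simp only [Matrix.vecCons]
    rw [h2]
    simp only [zsmul_eq_mul]
    ring
  · intro h x
    funext n y
    have := h (n + 1) (Fin.cons x y) 0
    rw [Fin.update_cons_zero, Fin.cons_zero] at this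
    rw [Pi.smul_apply, Pi.smul_apply, ins_apply, ins_apply, this, smul_eq_mul]
    ring

theorem IsHolo.ins {c : ℂ} {J : V →ₗ[ℝ] V} {σ : PreFock ℂ V} (h : IsHolo c J σ) (hσ : IsAlt σ)
    (x : V) : IsHolo c J (ins x σ) := fun y => by
  rw [ins_ins hσ, h y, map_smul, ins_ins hσ y x, smul_neg]

theorem IsHolo.add {c : ℂ} {J : V →ₗ[ℝ] V} {σ τ : PreFock ℂ V} (h : IsHolo c J σ)
    (h' : IsHolo c J τ) : IsHolo c J (σ + τ) := fun y => by
  rw [map_add, map_add, h, h', smul_add]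

theorem IsHolo.smul {c : ℂ} {J : V →ₗ[ℝ] V} {σ : PreFock ℂ V} (h : IsHolo c J σ) (a : ℂ) :
    IsHolo c J (a • σ) := fun y => by
  rw [map_smul, map_smul, h, smul_comm]

theorem IsHolo.zero {c : ℂ} {J : V →ₗ[ℝ] V} : IsHolo c J (0 : PreFock ℂ V) := fun y => by simp

theorem IsHolo.par {c : ℂ} {J : V →ₗ[ℝ] V} {σ : PreFock ℂ V} (h : IsHolo c J σ) :
    IsHolo c J (par σ) := fun y => by
  rw [ins_par, ins_par, h, map_smul, smul_neg]

theorem IsHolo.unit {c : ℂ} {J : V →ₗ[ℝ] V} : IsHolo c J (unitPre : PreFock ℂ V) := fun y => by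
  simp

theorem IsHolo.wedge {c : ℂ} {J : V →ₗ[ℝ] V} {σ τ : PreFock ℂ V} (h : IsHolo c J σ)
    (h' : IsHolo c J τ) (hσ : IsAlt σ) (hτ : IsAlt τ) : IsHolo c J (wedge σ τ) := fun y => by
  rw [ins_wedge hσ hτ, ins_wedge hσ hτ, h, h', wedge_smul_left, wedge_smul_right, smul_add]

/-- The condition on `r` and `t` says that a functional with `l (J x) = c * l x` vanishes on
`r x + i t J x`. -/
theorem insC_eq_zero {c : ℂ} {J : V →ₗ[ℝ] V} {σ : PreFock ℂ V} (h : IsHolo c J σ) (hσ : IsAlt σ)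
    {r t : ℝ} {x : V} (hr : (r : ℂ) + Complex.I * t * c = 0) : insC (r • x, t • J x) σ = 0 := by
  rw [insC_apply, ins_smul_arg hσ, ins_smul_arg hσ, h x, smul_smul, smul_smul, ← add_smul]
  exact (congrArg (· • FermionGBF.ins x σ) hr).trans (zero_smul ℂ _)

/-- A complex orthonormal basis `e` for `J`, compatible with the decomposition into the positive and
the negative part, together with the vectors `J e`, forms an ON-basis. -/
theorem exists_adapted [KreinSpace V] (J : V →ₗ[ℝ] V) (hJJ : ∀ x, J (J x) = -x)
    (hJf : ∀ x, J (fund x) = fund (J x)) (hJk : ∀ x y, kip (J x) (J y) = kip x y) :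
    ∃ (κ : Set V) (b : HilbertBasis (κ × Bool) ℝ V), (∀ a, b (a, true) = J (b (a, false))) ∧
      IsONBasis b := by
  have hJ : ∀ x y, inner ℝ (J x) (J y) = inner ℝ x y := by
    intro x y
    have := hJk (fund x) y
    rwa [kip, kip, hJf, fund_fund, fund_fund] at this
  have hJ0 : ∀ x, inner ℝ x (J x) = 0 := by
    intro x
    have := hJ x (J x)
    rw [hJJ, inner_neg_right, real_inner_comm] at this
    linarith
  -- By Zorn's lemma there is a maximal set of unit vectors, each in the positive or in the negative
  -- part, which are orthonormal over the complex numbers.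
  let S : Set (Set V) := {s | (∀ x ∈ s, ‖x‖ = 1 ∧ (fund x = x ∨ fund x = -x)) ∧
    ∀ x ∈ s, ∀ y ∈ s, x ≠ y → inner ℝ x y = 0 ∧ inner ℝ x (J y) = 0}
  obtain ⟨s, hs⟩ := zorn_subset S fun c hc hch => by
    refine ⟨⋃₀ c, ⟨?_, ?_⟩, fun t ht => Set.subset_sUnion_of_mem ht⟩
    · rintro x ⟨t, ht, hx⟩
      exact (hc ht).1 x hx
    · rintro x ⟨t, ht, hx⟩ y ⟨t', ht', hy⟩ hxy
      rcases hch.total ht ht' with h | h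
      · exact (hc ht').2 x (h hx) y hy hxy
      · exact (hc ht).2 x hx y (h hy) hxy
  obtain ⟨h1, h2⟩ := hs.prop
  let b : s × Bool → V := fun a => if a.2 then J a.1 else a.1
  have hb : Orthonormal ℝ b := by
    refine ⟨?_, ?_⟩
    · rintro ⟨a, β⟩
      have h := (h1 a a.2).1
      rw [norm_eq_sqrt_real_inner] at h ⊢
      cases β
      · exact h
      · change √(inner ℝ (J a.1) (J a.1)) = 1
        rwa [hJ]
    · rintro ⟨a, β⟩ ⟨a', β'⟩ hne
      by_cases haa : a = a'
      · subst haa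
        cases β <;> cases β'
        · exact (hne rfl).elim
        · exact hJ0 _
        · change inner ℝ (J a.1) a.1 = 0
          rw [real_inner_comm]
          exact hJ0 _
        · exact (hne rfl).elim
      · have h3 : (a : V) ≠ a' := fun h => haa (Subtype.ext h)
        have h4 := h2 a a.2 a' a'.2 h3
        have h5 := h2 a' a'.2 a a.2 h3.symm
        cases β <;> cases β'
        · exact h4.1
        · exact h4.2
        · change inner ℝ (J a.1) a'.1 = 0
          rw [real_inner_comm]
          exact h5.2
        · change inner ℝ (J a.1) (J a'.1) = 0
          rw [hJ]
          exact h4.1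
  have hfb : ∀ i, fund (b i) = b i ∨ fund (b i) = -b i := by
    rintro ⟨a, β⟩
    cases β
    · exact (h1 a a.2).2
    · change fund (J a.1) = J a.1 ∨ fund (J a.1) = -J a.1
      rw [← hJf]
      rcases (h1 a a.2).2 with h | h <;> simp [h]
  have hsp : (Submodule.span ℝ (Set.range b))ᗮ = ⊥ := by
    rw [eq_bot_iff]
    intro v hv
    rw [Submodule.mem_bot]
    by_contra hv0
    have hv1 : ∀ i, inner ℝ (b i) v = 0 := fun i =>
      (Submodule.mem_orthogonal _ _).1 hv _ (Submodule.subset_span ⟨i, rfl⟩)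
    have hv2 : ∀ i, inner ℝ (b i) (fund v) = 0 := fun i => by
      rw [← fund_inner]
      rcases hfb i with h | h <;> simp [h, hv1]
    -- One of `v + I v` and `v` is a non-zero vector in the positive or the negative part; its
    -- normalization contradicts maximality.
    obtain ⟨w, hw0, hwf, hw⟩ : ∃ w : V, w ≠ 0 ∧ (fund w = w ∨ fund w = -w) ∧
        ∀ i, inner ℝ (b i) w = 0 := by
      by_cases h : v + fund v = 0
      · refine ⟨v, hv0, Or.inr ?_, hv1⟩
        rw [eq_neg_iff_add_eq_zero, add_comm, h]
      · refine ⟨v + fund v, h, Or.inl ?_, fun i => ?_⟩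
        · rw [map_add, fund_fund, add_comm]
        · rw [inner_add_right, hv1, hv2, add_zero]
    have hn : ‖w‖ ≠ 0 := norm_ne_zero_iff.2 hw0
    set e : V := ‖w‖⁻¹ • w with he
    have hen : ‖e‖ = 1 := by rw [he, norm_smul, norm_inv, norm_norm, inv_mul_cancel₀ hn]
    have hei : ∀ i, inner ℝ (b i) e = 0 := fun i => by rw [he, inner_smul_right, hw, mul_zero]
    have hmem : insert e s ∈ S := by
      refine ⟨?_, ?_⟩
      · rintro x (rfl | hx)
        · refine ⟨hen, ?_⟩
          rcases hwf with h | h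
          · left; rw [he, map_smul, h]
          · right; rw [he, map_smul, h, smul_neg]
        · exact h1 x hx
      · rintro x (rfl | hx) y (rfl | hy) hxy
        · exact (hxy rfl).elim
        · have e1 : inner ℝ y e = 0 := hei (⟨y, hy⟩, false)
          have e2 : inner ℝ (J y) e = 0 := hei (⟨y, hy⟩, true)
          exact ⟨by rw [real_inner_comm]; exact e1, by rw [real_inner_comm]; exact e2⟩
        · have e1 : inner ℝ x e = 0 := hei (⟨x, hx⟩, false)
          have e2 : inner ℝ (J x) e = 0 := hei (⟨x, hx⟩, true)
          refine ⟨e1, ?_⟩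
          rw [← hJ, hJJ, inner_neg_right, e2, neg_zero]
        · exact h2 x hx y hy hxy
    have hes : e ∈ s := hs.le_of_ge hmem (Set.subset_insert e s) (Set.mem_insert e s)
    have e1 : inner ℝ e e = 0 := hei (⟨e, hes⟩, false)
    rw [real_inner_self_eq_norm_sq, hen] at e1
    norm_num at e1
  refine ⟨s, HilbertBasis.mkOfOrthogonalEqBot hb hsp, ?_, ?_⟩
  · intro a
    simp only [HilbertBasis.coe_mkOfOrthogonalEqBot]
    rfl
  · intro i
    simp only [HilbertBasis.coe_mkOfOrthogonalEqBot]
    exact hfb i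

variable [CompleteSpace V]

theorem isFrame_basis {ι : Type*} (b : HilbertBasis ι ℝ V) : IsFrame fun i => (b i, (0 : V)) := by
  intro f
  simp only [map_zero, mul_zero, add_zero]
  exact tsum_clm_sq b (stdBasis V) f

/-- The frame of the vectors `(e - i J e) / √2` and `(e + i J e) / √2` for the vectors `e` of an
orthonormal basis over the complex numbers. -/
def complexFrame (J : V →ₗ[ℝ] V) {κ : Type*} (b : κ → V) (a : κ × Bool) : V × V :=
  ((√2)⁻¹ • b a.1, (if a.2 then (√2)⁻¹ else -(√2)⁻¹) • J (b a.1))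

theorem isFrame_complexFrame {κ : Type*} (J : V →ₗ[ℝ] V) (b : HilbertBasis (κ × Bool) ℝ V)
    (hb : ∀ a, b (a, true) = J (b (a, false))) :
    IsFrame (complexFrame J fun a => b (a, false)) := by
  intro f
  rw [← tsum_clm_sq b (stdBasis V) f, ENNReal.tsum_prod',
    ENNReal.tsum_prod']
  refine tsum_congr fun a => ?_
  rw [tsum_bool, tsum_bool, hb, ← ENNReal.ofReal_add (by positivity) (by positivity),
    ← ENNReal.ofReal_add (by positivity) (by positivity)]
  congr 1
  simp only [complexFrame, map_smul, Bool.false_eq_true, if_true, if_false, Complex.real_smul]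
  have h : ((√2)⁻¹ : ℝ) ^ 2 = 1 / 2 := by
    rw [inv_pow, Real.sq_sqrt (by norm_num)]
    norm_num
  set c := (√2)⁻¹
  set A := f (b (a, false))
  set B := f (J (b (a, false)))
  simp only [← Complex.normSq_eq_norm_sq, Complex.normSq_apply]
  simp
  linear_combination (2 * (A.re ^ 2 + A.im ^ 2 + B.re ^ 2 + B.im ^ 2)) * h

/-- Every vector of the frame annihilates either the holomorphic or the anti-holomorphic factor. -/
theorem insC_complexFrame {J : V →ₗ[ℝ] V} {κ : Type*} (b : κ → V) {σ τ : PreFock ℂ V}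
    (hσ : IsAlt σ) (hτ : IsAlt τ) (h : IsHolo Complex.I J σ) (h' : IsHolo (-Complex.I) J τ)
    (a : κ × Bool) :
    insC (complexFrame J b a) σ = 0 ∨ insC (complexFrame J b a) τ = 0 := by
  rcases a with ⟨a, _ | _⟩
  · right
    refine insC_eq_zero h' hτ ?_
    have := Complex.I_mul_I
    simp only [Bool.false_eq_true, if_false]
    push_cast
    linear_combination ((√2 : ℝ) : ℂ)⁻¹ * this
  · left
    refine insC_eq_zero h hσ ?_
    have := Complex.I_mul_I
    simp only [if_true]
    push_cast
    linear_combination ((√2 : ℝ) : ℂ)⁻¹ * this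

end

/-! ### Monomials -/

section Mon

variable {V : Type u} [NormedAddCommGroup V] [InnerProductSpace ℝ V]

/-- A functional as an element of degree one. -/
def lin (l : V →L[ℝ] ℂ) : PreFock ℂ V := fun n x => if h : n = 1 then l (x ⟨0, by omega⟩) else 0

theorem IsAlt.lin (l : V →L[ℝ] ℂ) : IsAlt (lin l) := fun n => by
  by_cases h : n = 1
  · subst h
    exact ⟨ContinuousAlternatingMap.ofSubsingleton ℝ V ℂ (0 : Fin 1) l, fun x => by
      simp [FermionGBF.lin]⟩
  · exact ⟨0, fun x => by simp [FermionGBF.lin, h]⟩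

theorem ins_lin (x : V) (l : V →L[ℝ] ℂ) : ins x (lin l) = l x • unitPre := by
  funext n y
  by_cases h : n = 0
  · subst h
    simp [ins_apply, lin, unitPre]
  · simp [ins_apply, lin, unitPre, h]

theorem IsPar.lin (l : V →L[ℝ] ℂ) : IsPar 1 (lin l) := fun n hn x => by
  rw [FermionGBF.lin, dif_neg]
  rintro rfl
  exact hn (by simp)

theorem par_lin (l : V →L[ℝ] ℂ) : par (lin l) = -lin l := by
  rw [(IsPar.lin l).par_eq, (by decide : (1 : ZMod 2).val = 1), pow_one, neg_one_smul]

theorem lin_add (l l' : V →L[ℝ] ℂ) : lin (l + l') = lin l + lin l' := by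
  funext n x
  by_cases h : n = 1 <;> simp [lin, h]

/-- The anti-symmetrized product of functionals. -/
def mon : (n : ℕ) → (Fin n → V →L[ℝ] ℂ) → PreFock ℂ V
  | 0, _ => unitPre
  | n + 1, l => wedge (lin (l 0)) (mon n (Fin.tail l))

theorem IsAlt.mon : ∀ (n : ℕ) (l : Fin n → V →L[ℝ] ℂ), IsAlt (mon n l)
  | 0, _ => IsAlt.unit
  | n + 1, _ => (IsAlt.lin _).wedge (IsAlt.mon n _)

/-- Laplace expansion. -/
theorem ins_mon (x : V) : ∀ (n : ℕ) (l : Fin (n + 1) → V →L[ℝ] ℂ),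
    ins x (mon (n + 1) l) =
      ∑ i : Fin (n + 1), ((-1) ^ (i : ℕ) * l i x) • mon n (i.removeNth l) := by
  intro n
  induction n with
  | zero =>
    intro l
    simp [mon, ins_wedge (IsAlt.lin _) IsAlt.unit, ins_lin, wedge_smul_left, unit_wedge IsAlt.unit]
  | succ n ih =>
    intro l
    rw [mon, ins_wedge (IsAlt.lin _) (IsAlt.mon _ _), ins_lin, wedge_smul_left,
      unit_wedge (IsAlt.mon _ _), ih, par_lin, wedge_sum_right, Fin.sum_univ_succ (n := n + 1)]
    congr 1
    · simp
    · refine Finset.sum_congr rfl fun i _ => ?_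
      rw [wedge_smul_right, wedge_neg_left, mon]
      have h0 : i.succ.removeNth l 0 = l 0 := by simp [Fin.removeNth]
      have h1 : Fin.tail (i.succ.removeNth l) = i.removeNth (Fin.tail l) := by
        funext j
        simp [Fin.removeNth, Fin.tail]
      rw [h0, h1, smul_neg, ← neg_smul, Fin.val_succ, pow_succ]
      congr 1
      simp [Fin.tail]

theorem mon_of_ne : ∀ (m n : ℕ) (l : Fin n → V →L[ℝ] ℂ), m ≠ n → mon n l m = 0 := by
  intro m
  induction m with
  | zero =>
    intro n l h
    obtain _ | n := n
    · exact (h rfl).elim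
    · funext x
      rw [mon, wedge_zero_degree]
      simp [lin]
  | succ m ih =>
    intro n l h
    obtain _ | n := n
    · funext x
      simp [mon, unitPre]
    · have : mon (n + 1) l (m + 1) = (0 : PreFock ℂ V) (m + 1) := by
        refine succ_ext fun x => ?_
        rw [ins_mon, map_zero, Finset.sum_apply]
        refine Finset.sum_eq_zero fun i _ => ?_
        rw [Pi.smul_apply, ih n _ (fun hh => h (by rw [hh])), smul_zero]
      exact this

theorem IsPar.mon (n : ℕ) (l : Fin n → V →L[ℝ] ℂ) : IsPar (n : ZMod 2) (mon n l) :=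
  fun m hm x => by rw [mon_of_ne m n l (fun h => hm (by rw [h]))]; rfl

/-- Monomials are determinants. -/
theorem mon_apply : ∀ (n : ℕ) (l : Fin n → V →L[ℝ] ℂ) (x : Fin n → V),
    (n.factorial : ℂ) * mon n l n x = (Matrix.of fun i j => l i (x j)).det := by
  intro n
  induction n with
  | zero => intro l x; simp [mon, unitPre]
  | succ n ih =>
    intro l x
    have h := congrFun (congrFun (ins_mon (x 0) n l) n) (Fin.tail x)
    rw [ins_apply, Fin.cons_self_tail] at h
    rw [Nat.factorial_succ, Nat.cast_mul, mul_comm ((n + 1 : ℕ) : ℂ), mul_assoc, h,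
      Matrix.det_succ_column_zero, Finset.sum_apply, Finset.sum_apply, Finset.mul_sum]
    refine Finset.sum_congr rfl fun i _ => ?_
    rw [Pi.smul_apply, Pi.smul_apply, smul_eq_mul, mul_left_comm, ih]
    rfl

theorem IsHolo.lin {c : ℂ} {J : V →ₗ[ℝ] V} {l : V →L[ℝ] ℂ} (h : ∀ x, l (J x) = c * l x) :
    IsHolo c J (lin l) := fun x => by
  rw [ins_lin, ins_lin, h, mul_smul]

theorem IsHolo.mon {c : ℂ} {J : V →ₗ[ℝ] V} : ∀ (n : ℕ) (l : Fin n → V →L[ℝ] ℂ)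
    (_ : ∀ i x, l i (J x) = c * l i x), IsHolo c J (mon n l)
  | 0, _, _ => IsHolo.unit
  | n + 1, _, h => (IsHolo.lin (h 0)).wedge (IsHolo.mon n _ fun i => h i.succ) (IsAlt.lin _)
      (IsAlt.mon _ _)

/-- Products of a monomial in holomorphic and a monomial in anti-holomorphic functionals. -/
def splitMon (J : V →ₗ[ℝ] V) : Set (PreFock ℂ V) :=
  {σ | ∃ (k m : ℕ) (p : Fin k → V →L[ℝ] ℂ) (q : Fin m → V →L[ℝ] ℂ),
    (∀ i x, p i (J x) = Complex.I * p i x) ∧ (∀ i x, q i (J x) = -Complex.I * q i x) ∧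
      σ = wedge (mon k p) (mon m q)}

/-- Every functional is the sum of a holomorphic and an anti-holomorphic one. -/
theorem mon_mem_span_splitMon {J : V →ₗ[ℝ] V} (hJ : Continuous J) (hJJ : ∀ x, J (J x) = -x) :
    ∀ (n : ℕ) (l : Fin n → V →L[ℝ] ℂ), mon n l ∈ Submodule.span ℂ (splitMon J) := by
  intro n
  induction n with
  | zero =>
    intro l
    refine Submodule.subset_span ⟨0, 0, Fin.elim0, Fin.elim0, fun i => i.elim0, fun i => i.elim0,
      ?_⟩
    exact (unit_wedge IsAlt.unit).symm
  | succ n ih =>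
    intro l
    rw [mon]
    let Jc : V →L[ℝ] V := ⟨J, hJ⟩
    let l₁ : V →L[ℝ] ℂ := (1 / 2 : ℂ) • (l 0 - Complex.I • (l 0).comp Jc)
    let l₂ : V →L[ℝ] ℂ := (1 / 2 : ℂ) • (l 0 + Complex.I • (l 0).comp Jc)
    have hI := Complex.I_mul_I
    have h₁ : ∀ x, l₁ (J x) = Complex.I * l₁ x := by
      intro x
      have : l₁ (J x) = (1 / 2 : ℂ) * (l 0 (J x) - Complex.I * l 0 (J (J x))) := rfl
      rw [this, hJJ, map_neg]
      change _ = Complex.I * ((1 / 2 : ℂ) * (l 0 x - Complex.I * l 0 (J x)))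
      linear_combination (1 / 2 : ℂ) * l 0 (J x) * hI
    have h₂ : ∀ x, l₂ (J x) = -Complex.I * l₂ x := by
      intro x
      have : l₂ (J x) = (1 / 2 : ℂ) * (l 0 (J x) + Complex.I * l 0 (J (J x))) := rfl
      rw [this, hJJ, map_neg]
      change _ = -Complex.I * ((1 / 2 : ℂ) * (l 0 x + Complex.I * l 0 (J x)))
      linear_combination (1 / 2 : ℂ) * l 0 (J x) * hI
    have hl : l 0 = l₁ + l₂ := by
      ext x
      change l 0 x = (1 / 2 : ℂ) * (l 0 x - Complex.I * l 0 (J x)) +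
        (1 / 2 : ℂ) * (l 0 x + Complex.I * l 0 (J x))
      ring
    refine Submodule.span_induction (p := fun σ _ => wedge (lin (l 0)) σ ∈
      Submodule.span ℂ (splitMon J)) ?_ ?_ ?_ ?_ (ih (Fin.tail l))
    · rintro _ ⟨k, m, p, q, hp, hq, rfl⟩
      rw [hl, lin_add, wedge_add_left]
      refine add_mem (Submodule.subset_span ⟨k + 1, m, Fin.cons l₁ p, q, ?_, hq, ?_⟩) ?_
      · intro i
        refine Fin.cases ?_ (fun i => ?_) i
        · exact h₁
        · simpa using hp i
      · rw [mon, Fin.cons_zero, Fin.tail_cons, wedge_assoc (IsAlt.lin _) (IsAlt.mon _ _)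
          (IsAlt.mon _ _)]
      · rw [← wedge_assoc (IsAlt.lin _) (IsAlt.mon _ _) (IsAlt.mon _ _),
          wedge_comm (IsAlt.lin _) (IsAlt.mon _ _) (IsPar.lin _) (IsPar.mon _ _), wedge_smul_left,
          wedge_assoc (IsAlt.mon _ _) (IsAlt.lin _) (IsAlt.mon _ _)]
        refine Submodule.smul_mem _ _ (Submodule.subset_span ⟨k, m + 1, p, Fin.cons l₂ q, hp, ?_,
          ?_⟩)
        · intro i
          refine Fin.cases ?_ (fun i => ?_) i
          · exact h₂
          · simpa using hq i
        · rw [mon, Fin.cons_zero, Fin.tail_cons]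
    · rw [wedge_zero_right]
      exact zero_mem _
    · intro σ τ _ _ h h'
      rw [wedge_add_right]
      exact add_mem h h'
    · intro c σ _ h
      rw [wedge_smul_right]
      exact Submodule.smul_mem _ _ h

end Mon

section MonFock

variable {V : Type u} [NormedAddCommGroup V] [InnerProductSpace ℝ V] [CompleteSpace V]

theorem sqN_smul {𝕜 : Type} [RCLike 𝕜] (n : ℕ) (c : 𝕜) (σ : PreFock 𝕜 V) :
    sqN n (c • σ) = ENNReal.ofReal (‖c‖ ^ 2) * sqN n σ := by
  simp only [sqN, Pi.smul_apply, norm_smul, mul_pow, ENNReal.ofReal_mul (sq_nonneg ‖c‖),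
    ENNReal.tsum_mul_left]
  ring

theorem sqN_sum_le (n : ℕ) {ι : Type*} (s : Finset ι) (σ : ι → PreFock ℂ V) :
    sqN n (∑ i ∈ s, σ i) ≤ (s.card : ℝ≥0∞) * ∑ i ∈ s, sqN n (σ i) := by
  simp only [sqN]
  rw [← Finset.mul_sum, ← Summable.tsum_finsetSum (fun _ _ => ENNReal.summable), mul_left_comm,
    ← ENNReal.tsum_mul_left (a := (s.card : ℝ≥0∞))]
  refine mul_le_mul_right (ENNReal.tsum_le_tsum fun i => ?_) _
  rw [← ENNReal.ofReal_sum_of_nonneg (fun _ _ => by positivity), ← ENNReal.ofReal_natCast,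
    ← ENNReal.ofReal_mul (by positivity), Finset.sum_apply, Finset.sum_apply]
  refine ENNReal.ofReal_le_ofReal ?_
  refine (pow_le_pow_left₀ (norm_nonneg _) (norm_sum_le _ _) 2).trans ?_
  exact sq_sum_le_card_mul_sum_sq

theorem sqN_mon_ne_top : ∀ (n : ℕ) (l : Fin n → V →L[ℝ] ℂ), sqN n (mon n l) ≠ ⊤ := by
  intro n
  induction n with
  | zero =>
    intro l
    rw [sqN, tsum_eq_single (fun j => j.elim0) (fun i hi => (hi (funext fun j => j.elim0)).elim)]
    exact ENNReal.mul_ne_top (ENNReal.natCast_ne_top _) ENNReal.ofReal_ne_top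
  | succ n ih =>
    intro l h
    have h1 := succ_sqN (isFrame_basis (stdBasis V)) (IsAlt.mon (n + 1) l) n
    rw [h, ENNReal.mul_top (by exact_mod_cast n.succ_ne_zero)] at h1
    refine absurd h1.symm (ne_of_lt ?_)
    have h2 : ∀ a, sqN n (insC (stdBasis V a, (0 : V)) (mon (n + 1) l)) ≤
        ((Finset.univ : Finset (Fin (n + 1))).card : ℝ≥0∞) *
        ∑ i, ENNReal.ofReal (‖l i (stdBasis V a)‖ ^ 2) * sqN n (mon n (i.removeNth l)) := by
      intro a
      have h3 : insC (stdBasis V a, (0 : V)) (mon (n + 1) l) =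
          ins (stdBasis V a) (mon (n + 1) l) := by
        rw [insC_apply]
        have := ins_smul_arg (IsAlt.mon (n + 1) l) 0 (0 : V)
        simp only [smul_zero, RCLike.ofReal_zero, zero_smul] at this
        simp [this]
      rw [h3, ins_mon]
      refine (sqN_sum_le _ _ _).trans (le_of_eq ?_)
      simp [sqN_smul]
    refine (ENNReal.tsum_le_tsum h2).trans_lt ?_
    rw [ENNReal.tsum_mul_left, Summable.tsum_finsetSum (fun _ _ => ENNReal.summable)]
    refine ENNReal.mul_lt_top (ENNReal.natCast_lt_top _) (ENNReal.sum_lt_top.2 fun i _ => ?_)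
    rw [ENNReal.tsum_mul_right]
    refine ENNReal.mul_lt_top ?_ (lt_top_iff_ne_top.2 (ih _))
    have h4 := (hasSum_functional_sq (stdBasis V) (Complex.reCLM.comp (l i))).add
      (hasSum_functional_sq (stdBasis V) (Complex.imCLM.comp (l i)))
    refine lt_of_eq_of_lt ?_ (lt_top_iff_ne_top.2 h4.summable.tsum_ofReal_ne_top)
    refine tsum_congr fun a => ?_
    congr 1
    rw [← Complex.normSq_eq_norm_sq, Complex.normSq_apply]
    simp [sq]

theorem isFock_mon (n : ℕ) (l : Fin n → V →L[ℝ] ℂ) : IsFock ℂ V (mon n l) := by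
  rw [isFock_iff]
  refine ⟨IsAlt.mon n l, ?_⟩
  rw [sqT, tsum_eq_single n]
  · exact sqN_mon_ne_top n l
  · intro m hm
    rw [sqN, mon_of_ne m n l hm]
    simp

/-- Monomials as elements of the Fock space. -/
def monF (n : ℕ) (l : Fin n → V →L[ℝ] ℂ) : Fock ℂ V := Fock.mk (mon n l) (isFock_mon n l)

/-- The functional `⟨v, ·⟩`, complex valued. -/
def dualC (v : V) : V →L[ℝ] ℂ := Complex.ofRealCLM.comp (innerSL ℝ v)

theorem dualC_apply (v x : V) : dualC v x = ((inner ℝ v x : ℝ) : ℂ) := rfl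

/-- The inner product with a monomial in the dual functionals of an orthonormal basis is evaluation
on the basis vectors. -/
theorem inner_monF {ι : Type*} (b : HilbertBasis ι ℝ V) (σ : Fock ℂ V) (n : ℕ) (i : Fin n → ι) :
    inner ℂ (monF n fun j => dualC (b (i j))) σ = (n.factorial : ℂ) * σ.fn n fun j => b (i j) := by
  classical
  obtain ⟨f, hf⟩ := σ.isAlt n
  refine (Fock.hasSum_inner b _ σ).unique ?_
  rw [← (sigma_mk_injective (i := n)).hasSum_iff]
  · have h1 : ∀ k : Fin n → ι, (n.factorial : ℂ) * ((starRingEnd ℂ)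
        (mon n (fun j => dualC (b (i j))) n fun j => b (k j)) * σ.fn n fun j => b (k j)) =
        ∑ π : Equiv.Perm (Fin n), if k = i ∘ π then σ.fn n (fun j => b (i j)) else 0 := by
      intro k
      have h2 := congrArg (starRingEnd ℂ) (mon_apply n (fun j => dualC (b (i j))) fun j => b (k j))
      rw [map_mul, map_natCast] at h2
      rw [← mul_assoc, h2, Matrix.det_apply, map_sum, Finset.sum_mul]
      refine Finset.sum_congr rfl fun π _ => ?_
      have h3 : ∀ j, (Matrix.of fun p q => dualC (b (i p)) (b (k q))) (π j) j =
          if i (π j) = k j then 1 else 0 := by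
        intro j
        rw [Matrix.of_apply, dualC_apply, (orthonormal_iff_ite.1 b.orthonormal)]
        split_ifs <;> simp
      simp only [h3]
      by_cases hk : k = i ∘ π
      · rw [if_pos hk, hk]
        have h4 : f (fun j => b (i (π j))) = Equiv.Perm.sign π • f fun j => b (i j) :=
          f.toAlternatingMap.map_perm (fun j => b (i j)) π
        simp only [Function.comp_apply, if_true, Finset.prod_const_one, hf]
        rw [h4]
        rcases Int.units_eq_one_or (Equiv.Perm.sign π) with h | h <;> simp [h]
      · rw [if_neg hk]
        obtain ⟨j, hj⟩ : ∃ j, i (π j) ≠ k j := by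
          by_contra! h
          exact hk (funext fun j => (h j).symm)
        rw [Finset.prod_eq_zero (Finset.mem_univ j) (by rw [if_neg hj])]
        simp
    have h5 : (fun k : Fin n → ι => (n.factorial : ℂ) * ((starRingEnd ℂ)
        (mon n (fun j => dualC (b (i j))) n fun j => b (k j)) * σ.fn n fun j => b (k j))) =
        fun k => ∑ π : Equiv.Perm (Fin n), if k = i ∘ π then σ.fn n (fun j => b (i j)) else 0 :=
      funext h1
    have h6 : HasSum (fun k : Fin n → ι => ∑ π : Equiv.Perm (Fin n),
        if k = i ∘ π then σ.fn n (fun j => b (i j)) else 0)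
        (∑ _π : Equiv.Perm (Fin n), σ.fn n (fun j => b (i j))) :=
      hasSum_sum fun π _ => hasSum_ite_eq (i ∘ π) _
    rw [← h5, Finset.sum_const, Finset.card_univ, Fintype.card_perm, Fintype.card_fin,
      nsmul_eq_mul] at h6
    exact h6
  · rintro ⟨m, k⟩ hm
    have hmn : m ≠ n := by
      rintro rfl
      exact hm ⟨k, rfl⟩
    have : (monF n fun j => dualC (b (i j))).fn m = 0 := mon_of_ne m n _ hmn
    simp [this]

theorem dense_monF {ι : Type*} (b : HilbertBasis ι ℝ V) :
    Dense (Submodule.span ℂ {σ : Fock ℂ V | ∃ (n : ℕ) (i : Fin n → ι),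
      σ = monF n fun j => dualC (b (i j))} : Set (Fock ℂ V)) := by
  rw [Submodule.dense_iff_topologicalClosure_eq_top, Submodule.topologicalClosure_eq_top_iff,
    eq_bot_iff]
  intro σ hσ
  rw [Submodule.mem_bot]
  refine Fock.coeffLp_injective b ?_
  rw [map_zero]
  refine lp.ext (funext fun p => ?_)
  have h1 : inner ℂ (monF p.1 fun j => dualC (b (p.2 j))) σ = 0 :=
    (Submodule.mem_orthogonal _ _).1 hσ _ (Submodule.subset_span ⟨p.1, p.2, rfl⟩)
  rw [inner_monF] at h1
  have h2 := (mul_eq_zero.1 h1).resolve_left (by exact_mod_cast p.1.factorial_ne_zero)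
  change coeffs b σ.fn p = 0
  rw [coeffs, h2, mul_zero]

end MonFock

/-! ### Amplitude and probability maps on monomials -/

section AmpMon

theorem hasSum_of_eq {ι M : Type*} [AddCommMonoid M] [TopologicalSpace M] {f g : ι → M} {a : M}
    (h : HasSum f a) (e : ∀ i, g i = f i) : HasSum g a := by rwa [funext e]

theorem hasSum_mul_prod {α β : Type*} {f : α → ℂ} {g : β → ℂ} {a b : ℂ} (hf : HasSum f a)
    (hg : HasSum g b) : HasSum (fun p : α × β => f p.1 * g p.2) (a * b) :=
  hf.mul hg (summable_mul_of_summable_norm (summable_norm_iff.2 hf.summable)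
    (summable_norm_iff.2 hg.summable))

theorem hasSum_prod_fin {ι : Type*} : ∀ (n : ℕ) (h : Fin n → ι → ℂ) (s : Fin n → ℂ)
    (_ : ∀ j, HasSum (h j) (s j)), HasSum (fun i : Fin n → ι => ∏ j, h j (i j)) (∏ j, s j) := by
  intro n
  induction n with
  | zero =>
    intro h s _
    simp only [Finset.univ_eq_empty, Finset.prod_empty]
    simp
  | succ n ih =>
    intro h s hs
    rw [← (Fin.consEquiv (fun _ : Fin (n + 1) => ι)).hasSum_iff, Fin.prod_univ_succ]
    have h1 : HasSum (h 0) (s 0) := hs 0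
    have h2 : HasSum (fun i : Fin n → ι => ∏ j, h j.succ (i j)) (∏ j, s (Fin.succ j)) :=
      ih (fun j => h j.succ) (fun j => s j.succ) fun j => hs j.succ
    have h3 := hasSum_mul_prod h1 h2
    refine hasSum_of_eq h3 fun p => ?_
    simp [Fin.prod_univ_succ, Fin.consEquiv]

variable {V : Type u} [NormedAddCommGroup V] [InnerProductSpace ℝ V]

/-- The bilinear pairing of two complex functionals, whose value does not depend on the basis. -/
theorem exists_hasSum_mul [CompleteSpace V] (f g : V →L[ℝ] ℂ) :
    ∃ B : ℂ, ∀ (ι : Type u) (b : HilbertBasis ι ℝ V), HasSum (fun i => f (b i) * g (b i)) B := by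
  have real : ∀ l l' : V →L[ℝ] ℝ, ∃ B : ℝ, ∀ (ι : Type u) (b : HilbertBasis ι ℝ V),
      HasSum (fun i => ((l (b i) * l' (b i) : ℝ) : ℂ)) (B : ℂ) := by
    intro l l'
    refine ⟨inner ℝ ((InnerProductSpace.toDual ℝ V).symm l)
      ((InnerProductSpace.toDual ℝ V).symm l'), fun ι b => ?_⟩
    rw [Complex.hasSum_ofReal]
    have := b.hasSum_inner_mul_inner ((InnerProductSpace.toDual ℝ V).symm l)
      ((InnerProductSpace.toDual ℝ V).symm l')
    refine hasSum_of_eq this fun i => ?_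
    rw [real_inner_comm _ (b i), InnerProductSpace.toDual_symm_apply,
      InnerProductSpace.toDual_symm_apply]
  obtain ⟨B₁, h₁⟩ := real (Complex.reCLM.comp f) (Complex.reCLM.comp g)
  obtain ⟨B₂, h₂⟩ := real (Complex.reCLM.comp f) (Complex.imCLM.comp g)
  obtain ⟨B₃, h₃⟩ := real (Complex.imCLM.comp f) (Complex.reCLM.comp g)
  obtain ⟨B₄, h₄⟩ := real (Complex.imCLM.comp f) (Complex.imCLM.comp g)
  refine ⟨B₁ + Complex.I * B₂ + Complex.I * B₃ - B₄, fun ι b => ?_⟩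
  have h := (((h₁ ι b).add ((h₂ ι b).mul_left Complex.I)).add ((h₃ ι b).mul_left Complex.I)).sub
    (h₄ ι b)
  refine hasSum_of_eq h fun i => ?_
  have e : ∀ z : ℂ, z = (z.re : ℂ) + z.im * Complex.I := fun z => (Complex.re_add_im z).symm
  conv_lhs => rw [e (f (b i)), e (g (b i))]
  simp only [ContinuousLinearMap.comp_apply, Complex.reCLM_apply, Complex.imCLM_apply]
  push_cast
  linear_combination ((f (b i)).im : ℂ) * (g (b i)).im * Complex.I_mul_I

variable [KreinSpace V]

theorem IsONBasis.fund_eq {ι : Type u} {b : HilbertBasis ι ℝ V} (hb : IsONBasis b) (i : ι) :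
    fund (b i) = kip (b i) (b i) • b i := by
  have h1 : inner ℝ (b i) (b i) = (1 : ℝ) := by
    rw [real_inner_self_eq_norm_sq, b.orthonormal.1 i, one_pow]
  rcases hb i with h | h
  · rw [kip, h, h1, one_smul]
  · rw [kip, h, inner_neg_left, h1, neg_one_smul]

theorem ampDom_add {u : V →ₗ[ℝ] V} {σ τ : Fock ℂ V} (hσ : σ ∈ ampDom ℂ u) (hτ : τ ∈ ampDom ℂ u) :
    σ + τ ∈ ampDom ℂ u := by
  obtain ⟨a, ha⟩ := hσ
  obtain ⟨b, hb⟩ := hτ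
  refine ⟨a + b, fun ι ζ hζ => ?_⟩
  refine hasSum_of_eq ((ha ι ζ hζ).add (hb ι ζ hζ)) fun p => ?_
  simp only [ampTerm, Fock.fn_add, Pi.add_apply]
  ring

theorem ampDom_smul {u : V →ₗ[ℝ] V} (c : ℂ) {σ : Fock ℂ V} (hσ : σ ∈ ampDom ℂ u) :
    c • σ ∈ ampDom ℂ u := by
  obtain ⟨a, ha⟩ := hσ
  refine ⟨c * a, fun ι ζ hζ => ?_⟩
  refine hasSum_of_eq ((ha ι ζ hζ).mul_left c) fun p => ?_
  simp only [ampTerm, Fock.fn_smul, Pi.smul_apply, smul_eq_mul]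
  ring

theorem ampDom_zero {u : V →ₗ[ℝ] V} : (0 : Fock ℂ V) ∈ ampDom ℂ u :=
  ⟨0, fun ι ζ _ => by
    refine hasSum_of_eq hasSum_zero fun p => ?_
    simp [ampTerm]⟩

/-- The sum defining the amplitude map converges on monomials, since it is a finite sum of
products of absolutely convergent sums. -/
theorem monF_mem_ampDom {u : V →ₗ[ℝ] V} (hu : Continuous u) (n : ℕ) (l : Fin n → V →L[ℝ] ℂ) :
    monF n l ∈ ampDom ℂ u := by
  by_cases hn : ∃ m, m + m = n
  swap
  · refine ⟨0, fun ι ζ _ => ?_⟩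
    refine hasSum_of_eq hasSum_zero fun p => ?_
    have : (monF n l).fn (p.1 + p.1) = 0 := mon_of_ne _ _ _ fun h => hn ⟨_, h⟩
    simp [ampTerm, this]
  obtain ⟨m, rfl⟩ := hn
  let f₁ : Fin (m + m) → V →L[ℝ] ℂ := fun k =>
    (l k).comp ((fund (V := V)).toContinuousLinearEquiv : V →L[ℝ] V)
  let f₂ : Fin (m + m) → V →L[ℝ] ℂ := fun k => (l k).comp ⟨u, hu⟩
  choose B hB using fun k k' => exists_hasSum_mul (f₁ k) (f₂ k')
  refine ⟨((2 * m).factorial : ℂ) / (2 ^ m * (m.factorial : ℂ)) * (-1) ^ m *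
    (((m + m).factorial : ℂ)⁻¹ * ∑ π : Equiv.Perm (Fin (m + m)), ((Equiv.Perm.sign π : ℤ) : ℂ) *
      ∏ j : Fin m, B (π (Fin.castAdd m j)) (π (Fin.natAdd m (Fin.rev j)))), fun ι ζ hζ => ?_⟩
  rw [← (sigma_mk_injective (i := m)).hasSum_iff]
  · refine hasSum_of_eq ((((hasSum_sum (s := Finset.univ) fun (π : Equiv.Perm (Fin (m + m))) _ =>
      (hasSum_prod_fin m (fun j i => f₁ (π (Fin.castAdd m j)) (ζ i) *
        f₂ (π (Fin.natAdd m (Fin.rev j))) (ζ i)) _ fun j => hB _ _ ι ζ).mul_left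
          ((Equiv.Perm.sign π : ℤ) : ℂ)).mul_left _).mul_left _)) fun i => ?_
    change _ * (_ * mon (m + m) l (m + m) _) = _
    have h1 := mon_apply (m + m) l
      (Fin.append (fun j => ζ (i j)) (fun j => u (ζ (i (Fin.rev j)))))
    rw [Matrix.det_apply] at h1
    have h2 : mon (m + m) l (m + m)
        (Fin.append (fun j => ζ (i j)) (fun j => u (ζ (i (Fin.rev j))))) =
        ((m + m).factorial : ℂ)⁻¹ * ∑ π : Equiv.Perm (Fin (m + m)),
          ((Equiv.Perm.sign π : ℤ) : ℂ) * ∏ j : Fin m, (l (π (Fin.castAdd m j)) (ζ (i j)) *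
            l (π (Fin.natAdd m (Fin.rev j))) (u (ζ (i j)))) := by
      rw [eq_inv_mul_iff_mul_eq₀ (by exact_mod_cast (m + m).factorial_ne_zero), h1]
      refine Finset.sum_congr rfl fun π _ => ?_
      rw [Units.smul_def, zsmul_eq_mul, Fin.prod_univ_add, Finset.prod_mul_distrib]
      congr 2
      · simp
      · rw [← Equiv.prod_comp Fin.revPerm]
        refine Finset.prod_congr rfl fun j _ => ?_
        rw [Matrix.of_apply, Fin.revPerm_apply, Fin.append_right, Fin.rev_rev]
    rw [h2]
    congr 1
    rw [mul_left_comm]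
    congr 1
    rw [Finset.mul_sum]
    refine Finset.sum_congr rfl fun π _ => ?_
    rw [mul_left_comm]
    congr 1
    push_cast
    rw [← Finset.prod_mul_distrib]
    refine Finset.prod_congr rfl fun j _ => ?_
    have h3 : f₁ (π (Fin.castAdd m j)) (ζ (i j)) =
        (kip (ζ (i j)) (ζ (i j)) : ℂ) * l (π (Fin.castAdd m j)) (ζ (i j)) := by
      change l _ (fund (ζ (i j))) = _
      rw [hζ.fund_eq, map_smul, Complex.real_smul]
    rw [h3, mul_assoc]
    rfl
  · rintro ⟨k, i⟩ hk
    have hkm : k + k ≠ m + m := by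
      intro h
      obtain rfl : k = m := by omega
      exact hk ⟨i, rfl⟩
    have : (monF (m + m) l).fn (k + k) = 0 := mon_of_ne _ _ _ hkm
    simp [ampTerm, this]

end AmpMon

/-! ### Partial sums of the amplitude and probability maps -/

section AmpSum

theorem preFock_congr {𝕜 : Type} {V : Type u} (σ : PreFock 𝕜 V) {a b : ℕ} (h : a = b)
    (z : Fin a → V) (z' : Fin b → V) (hz : z = z' ∘ Fin.cast h) : σ a z = σ b z' := by
  subst h hz
  rfl

theorem snoc_comp_cast {V : Type u} {a c : ℕ} (h : a = c) (h' : a + 1 = c + 1) (z : Fin c → V)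
    (b : V) : (Fin.snoc (z ∘ Fin.cast h) b : Fin (a + 1) → V) =
      (Fin.snoc z b : Fin (c + 1) → V) ∘ Fin.cast h' := by
  subst h
  rfl

variable {V : Type u} [NormedAddCommGroup V] [InnerProductSpace ℝ V] [KreinSpace V]

/-- The summands of the amplitude map for sequences of functions. -/
def ampPre (u : V →ₗ[ℝ] V) {ι : Type*} (ζ : ι → V) (n : ℕ) (i : Fin n → ι) (σ : PreFock ℂ V) : ℂ :=
  ((2 * n).factorial : ℂ) / (2 ^ n * (n.factorial : ℂ)) * (-1) ^ n *
    (((∏ j, kip (ζ (i j)) (ζ (i j)) : ℝ) : ℂ) *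
      σ (n + n) (Fin.append (fun j => ζ (i j)) (fun j => u (ζ (i (Fin.rev j))))))

/-- The contribution of degree `2 n` and the multi-indices in a finite set to the amplitude map. -/
def ampE (u : V →ₗ[ℝ] V) {ι : Type*} (ζ : ι → V) (I : Finset ι) (n : ℕ) (σ : PreFock ℂ V) : ℂ :=
  ∑ i ∈ Fintype.piFinset (fun _ : Fin n => I), ampPre u ζ n i σ

/-- The operator of degree `-2` whose exponential yields the amplitude map. -/
def ampQ (u : V →ₗ[ℝ] V) {ι : Type*} (ζ : ι → V) (I : Finset ι) : PreFock ℂ V →ₗ[ℂ] PreFock ℂ V :=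
  ∑ k ∈ I, (-(1 / 2) * kip (ζ k) (ζ k) : ℂ) • (ins (u (ζ k)) ∘ₗ ins (ζ k))

theorem ampQ_apply (u : V →ₗ[ℝ] V) {ι : Type*} (ζ : ι → V) (I : Finset ι) (σ : PreFock ℂ V) :
    ampQ u ζ I σ = ∑ k ∈ I, (-(1 / 2) * kip (ζ k) (ζ k) : ℂ) • ins (u (ζ k)) (ins (ζ k) σ) := by
  simp [ampQ]

theorem ampE_add (u : V →ₗ[ℝ] V) {ι : Type*} (ζ : ι → V) (I : Finset ι) (n : ℕ)
    (σ τ : PreFock ℂ V) : ampE u ζ I n (σ + τ) = ampE u ζ I n σ + ampE u ζ I n τ := by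
  simp [ampE, ampPre, mul_add, Finset.sum_add_distrib]

theorem ampE_smul (u : V →ₗ[ℝ] V) {ι : Type*} (ζ : ι → V) (I : Finset ι) (n : ℕ) (c : ℂ)
    (σ : PreFock ℂ V) : ampE u ζ I n (c • σ) = c * ampE u ζ I n σ := by
  simp only [ampE, ampPre, Finset.mul_sum, Pi.smul_apply, smul_eq_mul]
  refine Finset.sum_congr rfl fun i _ => ?_
  ring

theorem ampE_sum (u : V →ₗ[ℝ] V) {ι : Type*} (ζ : ι → V) (I : Finset ι) (n : ℕ) {κ : Type*}
    (s : Finset κ) (σ : κ → PreFock ℂ V) :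
    ampE u ζ I n (∑ k ∈ s, σ k) = ∑ k ∈ s, ampE u ζ I n (σ k) :=
  map_sum (⟨⟨ampE u ζ I n, ampE_add u ζ I n⟩, ampE_smul u ζ I n⟩ : PreFock ℂ V →ₗ[ℂ] ℂ) σ s

/-- The first index of the multi-index occurs in the first and in the last argument. Moving the last
argument past the `2 n` arguments in between gives no sign. -/
theorem ampPre_cons (u : V →ₗ[ℝ] V) {ι : Type*} (ζ : ι → V) (n : ℕ) (k : ι) (i : Fin n → ι)
    {σ : PreFock ℂ V} (hσ : IsAlt σ) :
    ((n + 1 : ℕ) : ℂ) * ampPre u ζ (n + 1) (Fin.cons k i) σ =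
      (-(1 / 2) * kip (ζ k) (ζ k) : ℂ) * ampPre u ζ n i (ins (u (ζ k)) (ins (ζ k) σ)) := by
  obtain ⟨f, hf⟩ := hσ (n + n + 1 + 1)
  set y : Fin (n + n) → V := Fin.append (fun j => ζ (i j)) (fun j => u (ζ (i (Fin.rev j)))) with hy
  have h1 : σ (n + 1 + (n + 1)) (Fin.append
      (fun j => ζ ((Fin.cons k i : Fin (n + 1) → ι) j))
      (fun j => u (ζ ((Fin.cons k i : Fin (n + 1) → ι) (Fin.rev j))))) =
      σ (n + n + 1 + 1) (Fin.cons (ζ k) (Fin.snoc y (u (ζ k)) : Fin (n + n + 1) → V)) := by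
    refine preFock_congr σ (by omega) _ _ ?_
    have e1 : (fun j => ζ ((Fin.cons k i : Fin (n + 1) → ι) j)) =
        (Fin.cons (ζ k) (fun j => ζ (i j)) : Fin (n + 1) → V) := by
      funext j
      refine Fin.cases ?_ (fun j => ?_) j <;> simp
    have e2 : (fun j => u (ζ ((Fin.cons k i : Fin (n + 1) → ι) (Fin.rev j)))) =
        (Fin.snoc (fun j => u (ζ (i (Fin.rev j)))) (u (ζ k)) : Fin (n + 1) → V) := by
      funext j
      refine Fin.lastCases ?_ (fun j => ?_) j
      · simp
      · rw [Fin.rev_castSucc]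
        simp
    rw [e1, e2, Fin.append_snoc, Fin.append_cons, Fin.cons_snoc_eq_snoc_cons, ← hy]
    exact snoc_comp_cast _ _ _ _
  have h2 : f (Fin.cons (ζ k) (Fin.snoc y (u (ζ k)) : Fin (n + n + 1) → V)) =
      f (Fin.cons (ζ k) (Fin.cons (u (ζ k)) y : Fin (n + n + 1) → V)) := by
    have := (f.curryLeft (ζ k)).map_insertNth (Fin.last _) (u (ζ k)) y
    rw [Fin.insertNth_last'] at this
    have h3 : (-1 : ℤ) ^ ((Fin.last (n + n) : Fin (n + n + 1)) : ℕ) = 1 := by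
      rw [Fin.val_last, ← two_mul, pow_mul]
      simp
    rw [h3, one_smul] at this
    exact this
  rw [ampPre, ampPre, h1, ins_apply, ins_apply, hf, hf, h2, Fin.prod_univ_succ]
  simp only [Fin.cons_zero, Fin.cons_succ]
  rw [show 2 * (n + 1) = 2 * n + 1 + 1 by ring, Nat.factorial_succ (2 * n + 1),
    Nat.factorial_succ (2 * n), Nat.factorial_succ n]
  have hn : (n.factorial : ℂ) ≠ 0 := by exact_mod_cast n.factorial_ne_zero
  have hn1 : ((n : ℂ) + 1) ≠ 0 := by exact_mod_cast n.succ_ne_zero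
  push_cast
  field_simp
  ring

/-- By this recursion, `ampE` in degree `n` is the coefficient of order `n` of the exponential
of `ampQ`, evaluated in degree zero. -/
theorem ampE_succ (u : V →ₗ[ℝ] V) {ι : Type*} (ζ : ι → V) (I : Finset ι) (n : ℕ)
    {σ : PreFock ℂ V} (hσ : IsAlt σ) :
    ((n + 1 : ℕ) : ℂ) * ampE u ζ I (n + 1) σ = ampE u ζ I n (ampQ u ζ I σ) := by
  rw [ampQ_apply, ampE_sum, ampE, Finset.mul_sum]
  have h1 : ∑ i ∈ Fintype.piFinset (fun _ : Fin (n + 1) => I),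
      ((n + 1 : ℕ) : ℂ) * ampPre u ζ (n + 1) i σ =
      ∑ p ∈ I ×ˢ Fintype.piFinset (fun _ : Fin n => I),
        ((n + 1 : ℕ) : ℂ) * ampPre u ζ (n + 1) (Fin.cons p.1 p.2) σ := by
    refine Finset.sum_equiv (Fin.consEquiv (fun _ : Fin (n + 1) => ι)).symm ?_ ?_
    · intro i
      simp [Fin.forall_fin_succ, Fin.consEquiv, Fin.tail]
    · intro i _
      simp [Fin.consEquiv]
  rw [h1, Finset.sum_product]
  refine Finset.sum_congr rfl fun k _ => ?_
  rw [ampE_smul, ampE, Finset.mul_sum]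
  exact Finset.sum_congr rfl fun i _ => ampPre_cons u ζ n k i hσ

theorem ampE_zero_degree (u : V →ₗ[ℝ] V) {ι : Type*} (ζ : ι → V) (I : Finset ι)
    (σ : PreFock ℂ V) : ampE u ζ I 0 σ = σ 0 Fin.elim0 := by
  simp [ampE, ampPre]
  congr 1
  exact funext fun j => j.elim0

/-- A multi-index with a repeated index does not contribute, so only finitely many degrees do. -/
theorem ampE_eq_zero (u : V →ₗ[ℝ] V) {ι : Type*} (ζ : ι → V) (I : Finset ι) {n : ℕ}
    (hn : I.card < n) {σ : PreFock ℂ V} (hσ : IsAlt σ) : ampE u ζ I n σ = 0 := by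
  obtain ⟨f, hf⟩ := hσ (n + n)
  refine Finset.sum_eq_zero fun i hi => ?_
  rw [Fintype.mem_piFinset] at hi
  obtain ⟨j, -, j', -, hne, hj⟩ := Finset.exists_ne_map_eq_of_card_lt_of_maps_to
    (s := (Finset.univ : Finset (Fin n))) (t := I) (by simpa using hn) (f := i)
    (fun j _ => hi j)
  rw [ampPre, hf, f.map_eq_zero_of_eq _ (i := Fin.castAdd n j) (j := Fin.castAdd n j')]
  · simp
  · simp [hj]
  · simpa using hne

end AmpSum

/-! ### Multiplicativity of the partial sums -/

section AmpMul

variable {V : Type u} [NormedAddCommGroup V] [InnerProductSpace ℝ V] [KreinSpace V]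

theorem ins_neg_arg {σ : PreFock ℂ V} (hσ : IsAlt σ) (x : V) : ins (-x) σ = -ins x σ := by
  have := ins_smul_arg hσ (-1) x
  simpa using this

theorem ins_ins_wedge {σ τ : PreFock ℂ V} (hσ : IsAlt σ) (hτ : IsAlt τ) (x y : V) :
    ins x (ins y (wedge σ τ)) = wedge (ins x (ins y σ)) τ + wedge (par (ins y σ)) (ins x τ) -
      wedge (par (ins x σ)) (ins y τ) + wedge σ (ins x (ins y τ)) := by
  rw [ins_wedge hσ hτ, map_add, ins_wedge (hσ.ins y) hτ, ins_wedge hσ.par (hτ.ins y), ins_par,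
    par_par, wedge_neg_left]
  abel

/-- On products of a holomorphic and an anti-holomorphic factor, the mixed terms of the two
directions `e` and `J e` cancel. -/
theorem ampPair_wedge {J : V →ₗ[ℝ] V} {σ τ : PreFock ℂ V} (hσ : IsAlt σ) (hτ : IsAlt τ)
    (h : IsHolo Complex.I J σ) (h' : IsHolo (-Complex.I) J τ) (x y : V) :
    ins x (ins y (wedge σ τ)) + ins (-J x) (ins (J y) (wedge σ τ)) =
      wedge (ins x (ins y σ) + ins (-J x) (ins (J y) σ)) τ +
        wedge σ (ins x (ins y τ) + ins (-J x) (ins (J y) τ)) := by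
  rw [ins_neg_arg ((hσ.wedge hτ).ins _), ins_neg_arg (hσ.ins _), ins_neg_arg (hτ.ins _),
    ins_ins_wedge hσ hτ, ins_ins_wedge hσ hτ, wedge_add_left, wedge_add_right, wedge_neg_left,
    wedge_neg_right]
  have e1 : wedge (par (ins (J y) σ)) (ins (J x) τ) = wedge (par (ins y σ)) (ins x τ) := by
    rw [h y, h' x, map_smul, wedge_smul_left, wedge_smul_right, smul_smul]
    simp
  have e2 : wedge (par (ins (J x) σ)) (ins (J y) τ) = wedge (par (ins x σ)) (ins y τ) := by
    rw [h x, h' y, map_smul, wedge_smul_left, wedge_smul_right, smul_smul]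
    simp
  rw [e1, e2]
  abel

variable {J u : V →ₗ[ℝ] V} {κ : Type*} {b : κ × Bool → V}

theorem ampQ_prod (hb : ∀ a, b (a, true) = J (b (a, false)))
    (hJk : ∀ x y, kip (J x) (J y) = kip x y)
    (hJu : ∀ x, u (J x) = -J (u x)) (F : Finset κ) (σ : PreFock ℂ V) :
    ampQ u b (F ×ˢ Finset.univ) σ = ∑ a ∈ F, (-(1 / 2) * kip (b (a, false)) (b (a, false)) : ℂ) •
      (ins (u (b (a, false))) (ins (b (a, false)) σ) +
        ins (-J (u (b (a, false)))) (ins (J (b (a, false))) σ)) := by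
  rw [ampQ_apply, Finset.sum_product]
  refine Finset.sum_congr rfl fun a _ => ?_
  rw [Fintype.sum_bool, hb, hJk, hJu, smul_add, add_comm]

theorem wedge_sum_left {ι : Type*} (s : Finset ι) (σ : ι → PreFock ℂ V) (τ : PreFock ℂ V) :
    wedge (∑ i ∈ s, σ i) τ = ∑ i ∈ s, wedge (σ i) τ := map_sum (wedgeₗ.flip τ) σ s

/-- Over an adapted basis, `ampQ` is a derivation on products of a holomorphic and an
anti-holomorphic factor. -/
theorem ampQ_wedge (hb : ∀ a, b (a, true) = J (b (a, false)))
    (hJk : ∀ x y, kip (J x) (J y) = kip x y) (hJu : ∀ x, u (J x) = -J (u x)) (F : Finset κ)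
    {σ τ : PreFock ℂ V} (hσ : IsAlt σ) (hτ : IsAlt τ) (h : IsHolo Complex.I J σ)
    (h' : IsHolo (-Complex.I) J τ) :
    ampQ u b (F ×ˢ Finset.univ) (wedge σ τ) =
      wedge (ampQ u b (F ×ˢ Finset.univ) σ) τ + wedge σ (ampQ u b (F ×ˢ Finset.univ) τ) := by
  rw [ampQ_prod hb hJk hJu, ampQ_prod hb hJk hJu, ampQ_prod hb hJk hJu, wedge_sum_right,
    wedge_sum_left, ← Finset.sum_add_distrib]
  refine Finset.sum_congr rfl fun a _ => ?_
  rw [wedge_smul_left, wedge_smul_right, ← smul_add,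
    ampPair_wedge hσ hτ h h']

theorem IsAlt.ampQ {ι : Type*} (ζ : ι → V) (I : Finset ι) {σ : PreFock ℂ V} (hσ : IsAlt σ) :
    IsAlt (ampQ u ζ I σ) := by
  rw [ampQ_apply]
  exact IsAlt.sum fun k _ => ((hσ.ins _).ins _).smul _

theorem IsHolo.ampQ {ι : Type*} (ζ : ι → V) (I : Finset ι) {c : ℂ} {σ : PreFock ℂ V}
    (h : IsHolo c J σ) (hσ : IsAlt σ) : IsHolo c J (ampQ u ζ I σ) := by
  rw [ampQ_apply]
  exact Finset.sum_induction _ (IsHolo c J) (fun _ _ => IsHolo.add) IsHolo.zero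
    fun k _ => ((h.ins hσ _).ins (hσ.ins _) _).smul _

/-- The binomial formula for the powers of a derivation. -/
theorem ampE_wedge (hb : ∀ a, b (a, true) = J (b (a, false)))
    (hJk : ∀ x y, kip (J x) (J y) = kip x y) (hJu : ∀ x, u (J x) = -J (u x)) (F : Finset κ)
    (n : ℕ) :
    ∀ σ τ : PreFock ℂ V, IsAlt σ → IsAlt τ → IsHolo Complex.I J σ → IsHolo (-Complex.I) J τ →
    ampE u b (F ×ˢ Finset.univ) n (wedge σ τ) =
      ∑ p ∈ Finset.HasAntidiagonal.antidiagonal n,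
        ampE u b (F ×ˢ Finset.univ) p.1 σ * ampE u b (F ×ˢ Finset.univ) p.2 τ := by
  induction n with
  | zero =>
    intro σ τ _ _ _ _
    simp only [Finset.Nat.antidiagonal_zero, Finset.sum_singleton, ampE_zero_degree,
      wedge_zero_degree]
  | succ n ih =>
    intro σ τ hσ hτ h h'
    have h0 : ((n + 1 : ℕ) : ℂ) ≠ 0 := by exact_mod_cast n.succ_ne_zero
    refine mul_left_cancel₀ h0 ?_
    rw [ampE_succ _ _ _ _ (hσ.wedge hτ), ampQ_wedge hb hJk hJu F hσ hτ h h', ampE_add,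
      ih _ _ (hσ.ampQ _ _) hτ (h.ampQ _ _ hσ) h', ih _ _ hσ (hτ.ampQ _ _) h (h'.ampQ _ _ hτ)]
    have e : ∀ p ∈ Finset.HasAntidiagonal.antidiagonal (n + 1), ((n + 1 : ℕ) : ℂ) *
        (ampE u b (F ×ˢ Finset.univ) p.1 σ * ampE u b (F ×ˢ Finset.univ) p.2 τ) =
          ((p.1 : ℕ) : ℂ) * ampE u b (F ×ˢ Finset.univ) p.1 σ *
            ampE u b (F ×ˢ Finset.univ) p.2 τ +
          ampE u b (F ×ˢ Finset.univ) p.1 σ *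
            (((p.2 : ℕ) : ℂ) * ampE u b (F ×ˢ Finset.univ) p.2 τ) := by
      intro p hp
      rw [← Finset.HasAntidiagonal.mem_antidiagonal.1 hp]
      push_cast
      ring
    rw [Finset.mul_sum, Finset.sum_congr rfl e, Finset.sum_add_distrib]
    congr 1
    · rw [Finset.Nat.sum_antidiagonal_succ]
      simp only [Nat.cast_zero, zero_mul, zero_add, ampE_succ _ _ _ _ hσ]
    · rw [Finset.Nat.sum_antidiagonal_succ']
      simp only [Nat.cast_zero, zero_mul, mul_zero, zero_add, ampE_succ _ _ _ _ hτ]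

/-- The partial sum of the amplitude map over all degrees and the multi-indices in a finite set. -/
def ampS (u : V →ₗ[ℝ] V) {ι : Type*} (ζ : ι → V) (I : Finset ι) (σ : PreFock ℂ V) : ℂ :=
  ∑' n, ampE u ζ I n σ

theorem hasSum_ampE (u : V →ₗ[ℝ] V) {ι : Type*} (ζ : ι → V) (I : Finset ι) {σ : PreFock ℂ V}
    (hσ : IsAlt σ) (N : ℕ) :
    HasSum (fun n => ampE u ζ I n σ) (∑ n ∈ Finset.range (N + I.card + 1), ampE u ζ I n σ) :=
  hasSum_sum_of_ne_finset_zero fun n hn => ampE_eq_zero u ζ I (by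
    rw [Finset.mem_range] at hn
    omega) hσ

theorem ampS_eq (u : V →ₗ[ℝ] V) {ι : Type*} (ζ : ι → V) (I : Finset ι) {σ : PreFock ℂ V}
    (hσ : IsAlt σ) (N : ℕ) :
    ampS u ζ I σ = ∑ n ∈ Finset.range (N + I.card + 1), ampE u ζ I n σ :=
  (hasSum_ampE u ζ I hσ N).tsum_eq

theorem tsum_antidiagonal_mul {f g : ℕ → ℂ} (hf : Summable f) (hg : Summable g) :
    ∑' n, ∑ p ∈ Finset.HasAntidiagonal.antidiagonal n, f p.1 * g p.2 = (∑' n, f n) * ∑' n, g n := by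
  have h1 : Summable fun n => ‖f n‖ := summable_norm_iff.2 hf
  have h2 : Summable fun n => ‖g n‖ := summable_norm_iff.2 hg
  rw [tsum_mul_tsum_eq_tsum_sum_antidiagonal_of_summable_norm h1 h2]

theorem ampS_wedge (hb : ∀ a, b (a, true) = J (b (a, false)))
    (hJk : ∀ x y, kip (J x) (J y) = kip x y) (hJu : ∀ x, u (J x) = -J (u x)) (F : Finset κ)
    {σ τ : PreFock ℂ V} (hσ : IsAlt σ) (hτ : IsAlt τ) (h : IsHolo Complex.I J σ)
    (h' : IsHolo (-Complex.I) J τ) :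
    ampS u b (F ×ˢ Finset.univ) (wedge σ τ) =
      ampS u b (F ×ˢ Finset.univ) σ * ampS u b (F ×ˢ Finset.univ) τ := by
  simp only [ampS, ampE_wedge hb hJk hJu F _ σ τ hσ hτ h h']
  exact tsum_antidiagonal_mul (f := fun n => ampE u b (F ×ˢ Finset.univ) n σ)
    (g := fun n => ampE u b (F ×ˢ Finset.univ) n τ)
    (hasSum_ampE u b _ hσ 0).summable (hasSum_ampE u b _ hτ 0).summable

theorem ampS_add (u : V →ₗ[ℝ] V) {ι : Type*} (ζ : ι → V) (I : Finset ι) {σ τ : PreFock ℂ V}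
    (hσ : IsAlt σ) (hτ : IsAlt τ) : ampS u ζ I (σ + τ) = ampS u ζ I σ + ampS u ζ I τ := by
  rw [ampS_eq _ _ _ (hσ.add hτ) 0, ampS_eq _ _ _ hσ 0, ampS_eq _ _ _ hτ 0,
    ← Finset.sum_add_distrib]
  exact Finset.sum_congr rfl fun n _ => ampE_add _ _ _ _ _ _

theorem ampS_smul (u : V →ₗ[ℝ] V) {ι : Type*} (ζ : ι → V) (I : Finset ι) (c : ℂ)
    (σ : PreFock ℂ V) : ampS u ζ I (c • σ) = c * ampS u ζ I σ := by
  simp only [ampS, ampE_smul, tsum_mul_left]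

theorem ampS_conj (u : V →ₗ[ℝ] V) {ι : Type*} (ζ : ι → V) (I : Finset ι) (σ : Fock ℂ V) :
    ampS u ζ I (Fock.conj σ).fn = (starRingEnd ℂ) (ampS u ζ I σ.fn) := by
  rw [ampS, ampS, Complex.conj_tsum]
  refine tsum_congr fun n => ?_
  simp only [ampE, map_sum, ampPre, map_mul, map_div₀, map_pow, map_neg, map_one, map_natCast,
    map_ofNat, Complex.conj_ofReal, Fock.conj_fn]

/-- Partial sums vanish on elements of odd degree. -/
theorem ampS_odd (u : V →ₗ[ℝ] V) {ι : Type*} (ζ : ι → V) (I : Finset ι) {σ : PreFock ℂ V}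
    (hσ : IsPar 1 σ) : ampS u ζ I σ = 0 := by
  refine (tsum_congr fun n => ?_).trans tsum_zero
  refine Finset.sum_eq_zero fun i _ => ?_
  rw [ampPre, hσ (n + n), mul_zero, mul_zero]
  rw [← two_mul, Nat.cast_mul, (by decide : ((2 : ℕ) : ZMod 2) = 0), zero_mul]
  decide

/-- Partial sums as continuous functionals on the Fock space. -/
def ampL (u : V →ₗ[ℝ] V) {ι : Type*} (ζ : ι → V) (I : Finset ι) : Fock ℂ V →L[ℂ] ℂ where
  toFun σ := ampS u ζ I σ.fn
  map_add' σ τ := ampS_add u ζ I σ.isAlt τ.isAlt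
  map_smul' c σ := ampS_smul u ζ I c σ.fn
  cont := by
    have : (fun σ : Fock ℂ V => ampS u ζ I σ.fn) = fun σ =>
        ∑ n ∈ Finset.range (0 + I.card + 1), ampE u ζ I n σ.fn :=
      funext fun σ => ampS_eq u ζ I σ.isAlt 0
    change Continuous fun σ : Fock ℂ V => ampS u ζ I σ.fn
    rw [this]
    refine continuous_finsetSum _ fun n _ => continuous_finsetSum _ fun i _ =>
      continuous_const.mul (continuous_const.mul ?_)
    exact (evalL (n + n) _).continuous

@[simp] theorem ampL_apply (u : V →ₗ[ℝ] V) {ι : Type*} (ζ : ι → V) (I : Finset ι) (σ : Fock ℂ V) :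
    ampL u ζ I σ = ampS u ζ I σ.fn := rfl

/-- The partial sums converge to the value of the amplitude map. -/
theorem tendsto_ampL {u : V →ₗ[ℝ] V} {σ : Fock ℂ V} {a : ℂ} (h : HasAmp u σ a) {κ : Type u}
    (b : HilbertBasis (κ × Bool) ℝ V) (hb : IsONBasis b) :
    Filter.Tendsto (fun p : ℕ × Finset κ => ampL u b (p.2 ×ˢ Finset.univ) σ) Filter.atTop
      (nhds a) := by
  have h1 := h _ b hb
  -- Beyond the number of available indices all summands vanish. The parameter `p.1` is needed only
  -- to let the finite sets exhaust all degrees.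
  let T : ℕ × Finset κ → Finset ((n : ℕ) × (Fin n → κ × Bool)) := fun p =>
    (Finset.range (p.1 + (p.2 ×ˢ (Finset.univ : Finset Bool)).card + 1)).sigma
      fun n => Fintype.piFinset fun _ : Fin n => p.2 ×ˢ (Finset.univ : Finset Bool)
  have hT : Filter.Tendsto T Filter.atTop Filter.atTop := by
    classical
    refine Filter.tendsto_atTop_finset_of_monotone ?_ ?_
    · rintro ⟨N, F⟩ ⟨N', F'⟩ ⟨h1, h2⟩ ⟨n, i⟩ hi
      have hc : F.card ≤ F'.card := Finset.card_le_card h2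
      simp only [T, Finset.mem_sigma, Finset.mem_range, Fintype.mem_piFinset, Finset.mem_product,
        Finset.card_product] at hi ⊢
      dsimp only at h1
      refine ⟨?_, fun j => ⟨h2 (hi.2 j).1, Finset.mem_univ _⟩⟩
      have := Nat.mul_le_mul_right (Finset.univ : Finset Bool).card hc
      omega
    · rintro ⟨n, i⟩
      refine ⟨(n, Finset.univ.image fun j => (i j).1), ?_⟩
      simp only [T, Finset.mem_sigma, Finset.mem_range, Fintype.mem_piFinset, Finset.mem_product]
      exact ⟨by omega, fun j => ⟨Finset.mem_image_of_mem _ (Finset.mem_univ j), Finset.mem_univ _⟩⟩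
  refine (h1.comp hT).congr fun p => ?_
  rw [ampL_apply, ampS_eq u b _ σ.isAlt p.1, Function.comp_apply, Finset.sum_sigma]
  rfl

theorem ampTerm_cplx (u : V →ₗ[ℝ] V) (σ : Fock ℝ V) {ι : Type u} (ζ : ι → V)
    (p : (n : ℕ) × (Fin n → ι)) :
    ampTerm u (Fock.cplx σ) ζ p = ((ampTerm u σ ζ p : ℝ) : ℂ) := by
  have : ∀ n x, (Fock.cplx σ).fn n x = ((σ.fn n x : ℝ) : ℂ) := fun _ _ => rfl
  simp [ampTerm, this]

theorem HasAmp.cplx {u : V →ₗ[ℝ] V} {σ : Fock ℝ V} {a : ℝ} (h : HasAmp u σ a) :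
    HasAmp u (Fock.cplx σ) (a : ℂ) := fun ι ζ hζ => by
  refine hasSum_of_eq (Complex.hasSum_ofReal.2 (h ι ζ hζ)) fun p => ?_
  exact ampTerm_cplx u σ ζ p

theorem hasAmp_amp {𝕜 : Type} [RCLike 𝕜] {u : V →ₗ[ℝ] V} {σ : Fock 𝕜 V} (h : σ ∈ ampDom 𝕜 u) :
    HasAmp u σ (amp u σ) := by
  have h' : ∃ a, HasAmp u σ a := h
  rw [amp, dif_pos h']
  exact h'.choose_spec

end AmpMul

/-! ### Elementary tensors in the completed tensor product -/

section CTensor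

variable {E : Type u} {F : Type v} [NormedAddCommGroup E] [InnerProductSpace ℂ E]
  [NormedAddCommGroup F] [InnerProductSpace ℂ F]

variable (E F) in
/-- The inclusion of the algebraic tensor product in its completion. -/
def ctmulₗ : E ⊗[ℂ] F →ₗᵢ[ℂ] CTensor E F :=
  (UniformSpace.Completion.toComplₗᵢ : E ⊗[ℂ] F →ₗᵢ[ℂ] UniformSpace.Completion (E ⊗[ℂ] F))

theorem denseRange_ctmulₗ : DenseRange (ctmulₗ E F) :=
  UniformSpace.Completion.denseRange_coe (α := E ⊗[ℂ] F)

variable {Z : Type w} [NormedAddCommGroup Z] [InnerProductSpace ℂ Z]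

theorem inner_lift_of_norm {B : E →ₗ[ℂ] F →ₗ[ℂ] Z} (hB : ∀ a b, ‖B a b‖ = ‖a‖ * ‖b‖)
    (x y : E ⊗[ℂ] F) :
    inner ℂ (TensorProduct.lift B x) (TensorProduct.lift B y) = inner ℂ x y := by
  induction x with
  | zero => simp
  | add x x' hx hx' => rw [map_add, inner_add_left, inner_add_left, hx, hx']
  | tmul a b =>
    induction y with
    | zero => simp
    | add y y' hy hy' => rw [map_add, inner_add_right, inner_add_right, hy, hy']
    | tmul a' b' =>
      rw [TensorProduct.inner_tmul]
      exact inner_map_of_norm_map B hB a a' b b'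

theorem norm_lift_of_norm {B : E →ₗ[ℂ] F →ₗ[ℂ] Z} (hB : ∀ a b, ‖B a b‖ = ‖a‖ * ‖b‖)
    (x : E ⊗[ℂ] F) : ‖TensorProduct.lift B x‖ = ‖x‖ := by
  rw [← sq_eq_sq₀ (norm_nonneg _) (norm_nonneg _), norm_sq_eq_re_inner (𝕜 := ℂ),
    norm_sq_eq_re_inner (𝕜 := ℂ) x, inner_lift_of_norm hB]

variable [CompleteSpace Z]

/-- A bilinear map which multiplies norms, with dense linear span, extends to an isometric
isomorphism of the completed tensor product. -/
def ctensorEquiv (B : E →ₗ[ℂ] F →ₗ[ℂ] Z) (hB : ∀ a b, ‖B a b‖ = ‖a‖ * ‖b‖)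
    (hd : DenseRange (TensorProduct.lift B)) : CTensor E F ≃ₗᵢ[ℂ] Z :=
  (LinearEquiv.refl ℂ (E ⊗[ℂ] F)).extendOfIsometry (ctmulₗ _ _).toLinearMap
    (TensorProduct.lift B) denseRange_ctmulₗ hd
    fun x => (norm_lift_of_norm hB x).trans ((ctmulₗ _ _).norm_map x).symm

theorem ctensorEquiv_ctmul (B : E →ₗ[ℂ] F →ₗ[ℂ] Z) (hB : ∀ a b, ‖B a b‖ = ‖a‖ * ‖b‖)
    (hd : DenseRange (TensorProduct.lift B)) (a : E) (b : F) :
    ctensorEquiv B hB hd (ctmul a b) = B a b :=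
  LinearEquiv.extendOfIsometry_eq (LinearEquiv.refl ℂ (E ⊗[ℂ] F))
    (ctmulₗ _ _).toLinearMap (TensorProduct.lift B) denseRange_ctmulₗ hd
    (fun x => (norm_lift_of_norm hB x).trans ((ctmulₗ _ _).norm_map x).symm) (a ⊗ₜ b)

end CTensor

section Mon

variable {V : Type u} [NormedAddCommGroup V] [InnerProductSpace ℝ V]

theorem exists_wedge_mon {m : ℕ} (q : Fin m → V →L[ℝ] ℂ) : ∀ (k : ℕ) (p : Fin k → V →L[ℝ] ℂ),
    ∃ (n : ℕ) (l : Fin n → V →L[ℝ] ℂ), wedge (mon k p) (mon m q) = mon n l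
  | 0, _ => ⟨m, q, unit_wedge (IsAlt.mon m q)⟩
  | k + 1, p => by
    obtain ⟨n, l, h⟩ := exists_wedge_mon q k fun i => p i.succ
    refine ⟨n + 1, Fin.cons (p 0) l, ?_⟩
    change wedge (wedge (lin (p 0)) (mon k fun i => p i.succ)) (mon m q) =
      wedge (lin (Fin.cons (α := fun _ => V →L[ℝ] ℂ) (p 0) l 0)) (mon n fun i => l i)
    rw [wedge_assoc (IsAlt.lin _) (IsAlt.mon _ _) (IsAlt.mon _ _), h]
    rfl

variable [CompleteSpace V]

/-- The underlying sequence of functions, as a linear map. -/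
def fnₗ : Fock ℂ V →ₗ[ℂ] PreFock ℂ V where
  toFun σ := σ.fn
  map_add' _ _ := rfl
  map_smul' _ _ := rfl

theorem isHolo_of_mem {J : V →ₗ[ℝ] V} {σ : Fock ℂ V} (h : σ ∈ Fock.holo J) :
    IsHolo Complex.I J σ.fn := (isHolo_iff σ.isAlt).2 h

theorem mem_holo {J : V →ₗ[ℝ] V} {σ : Fock ℂ V} (h : IsHolo Complex.I J σ.fn) :
    σ ∈ Fock.holo J := (isHolo_iff σ.isAlt).1 h

theorem IsHolo.conj {J : V →ₗ[ℝ] V} {σ : Fock ℂ V} {c : ℂ} (h : IsHolo c J σ.fn) :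
    IsHolo ((starRingEnd ℂ) c) J (Fock.conj σ).fn := by
  rw [isHolo_iff (Fock.isAlt _)]
  intro n x j
  rw [Fock.conj_fn, Fock.conj_fn, (isHolo_iff σ.isAlt).1 h, map_mul]

theorem conj_conj (σ : Fock ℂ V) : Fock.conj (Fock.conj σ) = σ := by
  ext n x
  simp [Fock.conj_fn]

end Mon

section HoloWedge

variable {V : Type u} [NormedAddCommGroup V] [InnerProductSpace ℝ V] [KreinSpace V]

/-- The norm of the product of a holomorphic and an anti-holomorphic element. -/
theorem sqT_wedge_holo {J : V →ₗ[ℝ] V} (hJJ : ∀ x, J (J x) = -x)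
    (hJf : ∀ x, J (fund x) = fund (J x)) (hJk : ∀ x y, kip (J x) (J y) = kip x y)
    {σ τ : PreFock ℂ V} (hσ : IsAlt σ) (hτ : IsAlt τ) (h : IsHolo Complex.I J σ)
    (h' : IsHolo (-Complex.I) J τ) : sqT (wedge σ τ) = sqT σ * sqT τ := by
  obtain ⟨κ, b, hb, -⟩ := exists_adapted J hJJ hJf hJk
  exact sqT_wedge (isFrame_complexFrame J b hb) hσ hτ
    (insC_complexFrame (fun a => b (a, false)) hσ hτ h h')

theorem norm_of_sqT {σ τ ρ : Fock ℂ V} (h : sqT ρ.fn = sqT σ.fn * sqT τ.fn) :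
    ‖ρ‖ = ‖σ‖ * ‖τ‖ := by
  rw [← ofReal_norm_sq, ← ofReal_norm_sq, ← ofReal_norm_sq,
    ← ENNReal.ofReal_mul (by positivity), ← mul_pow,
    ENNReal.ofReal_eq_ofReal_iff (by positivity) (by positivity)] at h
  exact (sq_eq_sq₀ (by positivity) (by positivity)).1 h

theorem continuous_of_krein {J : V →ₗ[ℝ] V}
    (hJf : ∀ x, J (fund x) = fund (J x)) (hJk : ∀ x y, kip (J x) (J y) = kip x y) :
    Continuous J := by
  refine AddMonoidHomClass.continuous_of_bound J 1 fun x => ?_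
  rw [one_mul]
  refine le_of_eq ((sq_eq_sq₀ (norm_nonneg _) (norm_nonneg _)).1 ?_)
  have := hJk (fund x) x
  rw [kip, kip, hJf, fund_fund, fund_fund, real_inner_self_eq_norm_sq,
    real_inner_self_eq_norm_sq] at this
  exact this

end HoloWedge

/-! ### The decomposition into holomorphic and anti-holomorphic parts -/

namespace Polarization

variable {S : SpacetimeSystem.{u, v, w}} {T : FermionicTheory.{u, v, w, u₁, u₂} S}
  (P : Polarization T) {s s' : S.Hyp}

theorem iota_coe (h : S.rev s = s') (h' : S.rev s' = s) (p : s ∈ P.Pol) (p' : s' ∈ P.Pol)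
    (ψ : P.H p) : (P.iota h p p' ψ).1 = Fock.conj (T.flipD ℂ h' ψ.1) := rfl

theorem flipD_flipD {𝕜 : Type} [RCLike 𝕜] (h : S.rev s = s') (h' : S.rev s' = s)
    (σ : Fock 𝕜 (T.L s)) : T.flipD 𝕜 h (T.flipD 𝕜 h' σ) = σ := by
  ext n x
  change σ.fn n (fun j => T.flip h' (T.flip h (x (Fin.rev (Fin.rev j))))) = _
  simp [T.flip_flip]

theorem isHolo_H (p : s ∈ P.Pol) (ψ : P.H p) : IsHolo Complex.I (P.J s p) ψ.1.fn :=
  isHolo_of_mem ψ.2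

/-- The identification for the opposite orientations maps holomorphic to anti-holomorphic
elements. -/
theorem isHolo_flipD (h : S.rev s = s') (p : s ∈ P.Pol) (p' : s' ∈ P.Pol) (η : P.H p') :
    IsHolo (-Complex.I) (P.J s p) (T.flipD ℂ h η.1).fn := by
  have h' : S.rev s' = s := by rw [← h, S.rev_rev]
  have h1 := (P.isHolo_H p (P.iota h' p' p η)).conj
  rwa [P.iota_coe h' h, conj_conj, Complex.conj_I] at h1

theorem sqT_wedge_flipD (h : S.rev s = s') (p : s ∈ P.Pol) (p' : s' ∈ P.Pol) (ψ : P.H p)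
    (η : P.H p') : sqT (wedge ψ.1.fn (T.flipD ℂ h η.1).fn) =
      sqT ψ.1.fn * sqT (T.flipD ℂ h η.1).fn :=
  sqT_wedge_holo (P.J_J s p) (P.J_fund s p) (P.J_kip s p) ψ.1.isAlt (Fock.isAlt _)
    (P.isHolo_H p ψ) (P.isHolo_flipD h p p' η)

/-- The product of a holomorphic and an anti-holomorphic element, as a bilinear map. -/
def wedgeB (h : S.rev s = s') (p : s ∈ P.Pol) (p' : s' ∈ P.Pol) :
    P.H p →ₗ[ℂ] P.H p' →ₗ[ℂ] T.DC s :=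
  LinearMap.mk₂ ℂ (fun ψ η => Fock.mk (wedge ψ.1.fn (T.flipD ℂ h η.1).fn)
    ((isFock_iff _).2 ⟨ψ.1.isAlt.wedge (Fock.isAlt _), by
      rw [P.sqT_wedge_flipD, ← ofReal_norm_sq, ← ofReal_norm_sq]
      exact ENNReal.mul_ne_top ENNReal.ofReal_ne_top ENNReal.ofReal_ne_top⟩))
    (fun _ _ _ => Subtype.ext (wedge_add_left _ _ _))
    (fun _ _ _ => Subtype.ext (wedge_smul_left _ _ _))
    (fun ψ η η' => Subtype.ext ((congrArg (wedge ψ.1.fn) (congrArg Fock.fn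
      (map_add (T.flipD ℂ h) η.1 η'.1))).trans (wedge_add_right _ _ _)))
    (fun c ψ η => Subtype.ext ((congrArg (wedge ψ.1.fn) (congrArg Fock.fn
      (map_smul (T.flipD ℂ h) c η.1))).trans (wedge_smul_right _ _ _)))

theorem wedgeB_fn (h : S.rev s = s') (p : s ∈ P.Pol) (p' : s' ∈ P.Pol) (ψ : P.H p) (η : P.H p') :
    (P.wedgeB h p p' ψ η).fn = wedge ψ.1.fn (T.flipD ℂ h η.1).fn := rfl

theorem norm_wedgeB (h : S.rev s = s') (p : s ∈ P.Pol) (p' : s' ∈ P.Pol) (ψ : P.H p)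
    (η : P.H p') : ‖P.wedgeB h p p' ψ η‖ = ‖ψ‖ * ‖η‖ := by
  have := norm_of_sqT (σ := ψ.1) (τ := T.flipD ℂ h η.1) (ρ := P.wedgeB h p p' ψ η)
    (P.sqT_wedge_flipD h p p' ψ η)
  rw [LinearIsometry.norm_map] at this
  exact this

/-- Products of holomorphic and anti-holomorphic monomials arise from the tensor product. -/
theorem exists_of_splitMon (h : S.rev s = s') (h' : S.rev s' = s) (p : s ∈ P.Pol)
    (p' : s' ∈ P.Pol) {σ : PreFock ℂ (T.L s)} (hσ : σ ∈ splitMon (P.J s p)) :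
    ∃ (ψ : P.H p) (η : P.H p') (k m : ℕ) (a : Fin k → T.L s →L[ℝ] ℂ) (b : Fin m → T.L s →L[ℝ] ℂ),
      ψ.1 = monF k a ∧ η.1 = T.flipD ℂ h' (monF m b) ∧
        wedge ψ.1.fn (T.flipD ℂ h η.1).fn = σ := by
  obtain ⟨k, m, a, b, ha, hb, rfl⟩ := hσ
  have hψ : monF k a ∈ P.H p := mem_holo (IsHolo.mon k a ha)
  have hc : Fock.conj (monF m b) ∈ P.H p := by
    refine mem_holo ?_
    have : IsHolo _ (P.J s p) (Fock.conj (monF m b)).fn := IsHolo.conj (IsHolo.mon m b hb)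
    simpa using this
  refine ⟨⟨_, hψ⟩, P.iota h p p' ⟨_, hc⟩, k, m, a, b, rfl, ?_, ?_⟩
  · ext n x
    simp [P.iota_coe h h', Fock.conj_fn, FermionicTheory.flipD, Fock.flip_fn]
  · congr 1
    have : T.flipD ℂ h (P.iota h p p' ⟨_, hc⟩).1 = monF m b := by
      ext n x
      simp [P.iota_coe h h', Fock.conj_fn, FermionicTheory.flipD, Fock.flip_fn, T.flip_flip]
    rw [this]
    rfl

theorem monF_mem_map {p : s ∈ P.Pol} (N : Submodule ℂ (T.DC s))
    (hN : ∀ σ : T.DC s, σ.fn ∈ splitMon (P.J s p) → σ ∈ N) (n : ℕ) (l : Fin n → T.L s →L[ℝ] ℂ) :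
    monF n l ∈ N := by
  have h1 := mon_mem_span_splitMon (continuous_of_krein (P.J_fund s p) (P.J_kip s p))
    (P.J_J s p) n l
  have h2 : Submodule.span ℂ (splitMon (P.J s p)) ≤ N.map fnₗ := by
    rw [Submodule.span_le]
    intro σ hσ
    obtain ⟨k, m, a, b, ha, hb, rfl⟩ := id hσ
    obtain ⟨n, l, e⟩ := exists_wedge_mon b k a
    refine ⟨monF n l, hN _ ?_, e.symm⟩
    rw [e] at hσ
    exact hσ
  obtain ⟨τ, hτ, e⟩ := h2 h1
  rwa [show monF n l = τ from Subtype.ext e.symm]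

/-- A subspace containing the products of holomorphic and anti-holomorphic monomials is dense. -/
theorem dense_of_splitMon (p : s ∈ P.Pol) (N : Submodule ℂ (T.DC s))
    (hN : ∀ σ : T.DC s, σ.fn ∈ splitMon (P.J s p) → σ ∈ N) : Dense (N : Set (T.DC s)) := by
  refine (dense_monF (stdBasis (T.L s))).mono ?_
  change (Submodule.span ℂ _ : Submodule ℂ (T.DC s)) ≤ N
  rw [Submodule.span_le]
  rintro _ ⟨n, i, rfl⟩
  exact P.monF_mem_map N hN n _

theorem denseRange_wedgeB (h : S.rev s = s') (p : s ∈ P.Pol) (p' : s' ∈ P.Pol) :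
    DenseRange (TensorProduct.lift (P.wedgeB h p p')) := by
  have h' : S.rev s' = s := by rw [← h, S.rev_rev]
  refine P.dense_of_splitMon p (LinearMap.range (TensorProduct.lift (P.wedgeB h p p')))
    fun σ hσ => ?_
  obtain ⟨ψ, η, k, m, a, b, -, -, e⟩ := P.exists_of_splitMon h h' p p' hσ
  exact ⟨ψ ⊗ₜ η, Subtype.ext e⟩

/-- The decomposition into holomorphic and anti-holomorphic parts. -/
def identU (h : S.rev s = s') (p : s ∈ P.Pol) (p' : s' ∈ P.Pol) : P.ModSq p p' ≃ₗᵢ[ℂ] T.DC s :=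
  ctensorEquiv (P.wedgeB h p p') (P.norm_wedgeB h p p') (P.denseRange_wedgeB h p p')

theorem identU_ctmul (h : S.rev s = s') (p : s ∈ P.Pol) (p' : s' ∈ P.Pol) (ψ : P.H p)
    (η : P.H p') : P.identU h p p' (ctmul ψ η) = P.wedgeB h p p' ψ η :=
  ctensorEquiv_ctmul _ _ _ _ _

end Polarization

/-! ### Inner products, orientation reversal, and real structure -/

section FockOps

theorem wedge_conj {V : Type u} (σ τ : PreFock ℂ V) :
    (fun n x => (starRingEnd ℂ) (wedge σ τ n x)) =
      wedge (fun n x => (starRingEnd ℂ) (σ n x)) (fun n x => (starRingEnd ℂ) (τ n x)) := by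
  funext n x
  simp only [wedge, map_sum, map_mul, map_inv₀, map_natCast, map_intCast]

theorem wedge_cplx {V : Type u} (σ τ : PreFock ℝ V) :
    (fun n x => ((wedge σ τ n x : ℝ) : ℂ)) =
      wedge (fun n x => ((σ n x : ℝ) : ℂ)) (fun n x => ((τ n x : ℝ) : ℂ)) := by
  funext n x
  simp only [wedge, Complex.ofReal_sum, Complex.ofReal_mul, Complex.ofReal_inv,
    Complex.ofReal_natCast, Complex.ofReal_intCast]

variable {V : Type u} [NormedAddCommGroup V] [InnerProductSpace ℝ V]

theorem Fock.inner_eq_zero [CompleteSpace V] {a b : ZMod 2} (hab : a ≠ b) {σ τ : Fock ℂ V}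
    (hσ : σ ∈ Fock.fpar a) (hτ : τ ∈ Fock.fpar b) : inner ℂ σ τ = 0 := by
  refine (Fock.hasSum_inner (stdBasis V) σ τ).unique (hasSum_of_eq hasSum_zero fun p => ?_)
  by_cases h : ((p.1 : ℕ) : ZMod 2) = a
  · rw [hτ p.1 (by rw [h]; exact hab), mul_zero, mul_zero]
  · rw [hσ p.1 h, map_zero, zero_mul, mul_zero]

variable [KreinSpace V]

theorem fundF_fundF {𝕜 : Type} [RCLike 𝕜] (σ : Fock 𝕜 V) : Fock.fundF (Fock.fundF σ) = σ := by
  ext n x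
  simp [Fock.fundF_fn]

theorem fundF_mem_fpar {𝕜 : Type} [RCLike 𝕜] {a : ZMod 2} {σ : Fock 𝕜 V} (h : σ ∈ Fock.fpar a) :
    Fock.fundF σ ∈ Fock.fpar a := fun n hn _ => h n hn _

theorem fundF_mem_holo {J : V →ₗ[ℝ] V} (hJ : ∀ x, J (fund x) = fund (J x)) {σ : Fock ℂ V}
    (h : σ ∈ Fock.holo J) : Fock.fundF σ ∈ Fock.holo J := by
  intro n x j
  rw [Fock.fundF_fn, Fock.fundF_fn, ← h n _ j]
  congr 1
  funext k
  by_cases hk : k = j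
  · subst hk
    simp [hJ]
  · simp [hk]

theorem krein_eq_zero {a b : ZMod 2} (hab : a ≠ b) {σ τ : Fock ℂ V}
    (hσ : σ ∈ Fock.fpar a) (hτ : τ ∈ Fock.fpar b) : Fock.krein σ τ = 0 :=
  Fock.inner_eq_zero hab (fundF_mem_fpar hσ) hτ

end FockOps

namespace Polarization

variable {S : SpacetimeSystem.{u, v, w}} {T : FermionicTheory.{u, v, w, u₁, u₂} S}
  (P : Polarization T) {s s' : S.Hyp}

/-- The map `I` on the holomorphic elements. -/
def fundH (p : s ∈ P.Pol) (ψ : P.H p) : P.H p := ⟨Fock.fundF ψ.1, fundF_mem_holo (P.J_fund s p) ψ.2⟩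

/-- Orientation reversal exchanges the positive and the negative part, which gives a sign in
odd degree. -/
theorem fundF_flipD {𝕜 : Type} [RCLike 𝕜] (h : S.rev s = s') {b : ZMod 2} {η : Fock 𝕜 (T.L s')}
    (hη : η ∈ Fock.fpar b) :
    Fock.fundF (T.flipD 𝕜 h η) = ((-1) ^ b.val : 𝕜) • T.flipD 𝕜 h (Fock.fundF η) := by
  ext n x
  change η.fn n (fun j => T.flip h (fund (x (Fin.rev j)))) =
    (-1) ^ b.val * η.fn n (fun j => fund (T.flip h (x (Fin.rev j))))
  by_cases hn : (n : ZMod 2) = b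
  · obtain ⟨f, hf⟩ := η.isFock.alt n
    have := f.toMultilinearMap.map_smul_univ (fun _ => (-1 : ℝ))
      (fun j => fund (T.flip h (x (Fin.rev j))))
    simp only [neg_smul, one_smul, Finset.prod_const, Finset.card_univ, Fintype.card_fin] at this
    rw [hf, hf]
    simp only [T.flip_fund]
    refine this.trans ?_
    rw [← hn, ZMod.val_natCast, RCLike.real_smul_eq_coe_mul]
    push_cast
    rw [← neg_one_pow_eq_pow_mod_two]
    rfl
  · rw [hη n hn, hη n hn, mul_zero]

theorem fundF_wedgeB (h : S.rev s = s') (p : s ∈ P.Pol) (p' : s' ∈ P.Pol) {b : ZMod 2}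
    (ψ : P.H p) {η : P.H p'} (hη : η.1 ∈ Fock.fpar b) :
    Fock.fundF (P.wedgeB h p p' ψ η) =
      ((-1) ^ b.val : ℂ) • P.wedgeB h p p' (P.fundH p ψ) (P.fundH p' η) := by
  apply Subtype.ext
  change pullPre fund (wedge ψ.1.fn (T.flipD ℂ h η.1).fn) = ((-1) ^ b.val : ℂ) •
    wedge (Fock.fundF ψ.1).fn (T.flipD ℂ h (Fock.fundF η.1)).fn
  rw [pullPre_wedge, ← wedge_smul_right, ← Fock.fn_smul, ← fundF_flipD h hη]
  rfl

/-- The sign comes from the map `I`, which passes through orientation reversal up to the parity of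
the degree. Elements of different f-degrees are orthogonal, so the degree of either second factor
may be used in the sign. -/
theorem krein_wedgeB (h : S.rev s = s') (p : s ∈ P.Pol) (p' : s' ∈ P.Pol) (a b : ZMod 2)
    (ψ ψ' : P.H p) (η η' : P.H p') (hη : η.1 ∈ Fock.fpar a) (hη' : η'.1 ∈ Fock.fpar b) :
    Fock.krein (P.wedgeB h p p' ψ' η') (P.wedgeB h p p' ψ η) =
      Fock.krein ψ'.1 ψ.1 * (fsgn b a * Fock.krein η'.1 η.1) := by
  have h1 : Fock.krein (P.wedgeB h p p' ψ' η') (P.wedgeB h p p' ψ η) =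
      (-1) ^ b.val * (Fock.krein ψ'.1 ψ.1 * Fock.krein η'.1 η.1) := by
    rw [Fock.krein, P.fundF_wedgeB h p p' ψ' hη', inner_smul_left,
      inner_map_of_norm_map _ (P.norm_wedgeB h p p')]
    simp only [map_pow, map_neg, map_one]
    rfl
  rw [h1]
  -- For different degrees both sides vanish.
  by_cases hab : b = a
  · subst hab
    have : fsgn b b = (-1) ^ b.val := by
      rw [fsgn, (by decide : ∀ c : ZMod 2, c.val * c.val = c.val) b]
    rw [this]
    ring
  · rw [krein_eq_zero hab hη' hη]
    ring

theorem flipD_wedgeB (h : S.rev s = s') (h' : S.rev s' = s) (p : s ∈ P.Pol) (p' : s' ∈ P.Pol)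
    (ψ : P.H p) (η : P.H p') :
    T.flipD ℂ h' (P.wedgeB h p p' ψ η) = P.wedgeB h' p' p η ψ := by
  apply Subtype.ext
  change revPre (pullPre (T.flip h') (wedge ψ.1.fn (T.flipD ℂ h η.1).fn)) =
    wedge η.1.fn (T.flipD ℂ h' ψ.1).fn
  rw [pullPre_wedge, revPre_wedge]
  congr 1
  exact congrArg Fock.fn (flipD_flipD h' h η.1)

theorem flipD_mem_fpar {𝕜 : Type} [RCLike 𝕜] (h : S.rev s = s') {b : ZMod 2} {η : Fock 𝕜 (T.L s')}
    (hη : η ∈ Fock.fpar b) : T.flipD 𝕜 h η ∈ Fock.fpar b := fun n hn _ => hη n hn _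

theorem flipD_iota (h : S.rev s = s') (h' : S.rev s' = s) (p : s ∈ P.Pol) (p' : s' ∈ P.Pol)
    (ψ : P.H p) : T.flipD ℂ h (P.iota h p p' ψ).1 = Fock.conj ψ.1 := by
  rw [P.iota_coe h h']
  exact congrArg Fock.conj (flipD_flipD h h' ψ.1)

/-- Complex conjugation exchanges holomorphic and anti-holomorphic factors, which have to be
commuted to restore their order. -/
theorem conj_wedgeB (h : S.rev s = s') (h' : S.rev s' = s) (p : s ∈ P.Pol) (p' : s' ∈ P.Pol)
    (a b : ZMod 2) (ψ : P.H p) (η : P.H p') (hψ : ψ.1 ∈ Fock.fpar a) (hη : η.1 ∈ Fock.fpar b) :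
    Fock.conj (P.wedgeB h p p' ψ η) =
      fsgn a b • P.wedgeB h p p' (P.iota h' p' p η) (P.iota h p p' ψ) := by
  apply Subtype.ext
  have e : (P.wedgeB h p p' (P.iota h' p' p η) (P.iota h p p' ψ)).fn =
      wedge (Fock.conj (T.flipD ℂ h η.1)).fn (Fock.conj ψ.1).fn := by
    rw [P.wedgeB_fn, P.flipD_iota h h', P.iota_coe h' h]
  change (fun n x => (starRingEnd ℂ) (wedge ψ.1.fn (T.flipD ℂ h η.1).fn n x)) = fsgn a b •
    (P.wedgeB h p p' (P.iota h' p' p η) (P.iota h p p' ψ)).fn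
  rw [e, wedge_conj]
  refine wedge_comm (a := a) (b := b) (Fock.conj ψ.1).isAlt (Fock.conj _).isAlt ?_ ?_
  · intro n hn x
    exact (congrArg (starRingEnd ℂ) (hψ n hn x)).trans (map_zero _)
  · intro n hn x
    exact (congrArg (starRingEnd ℂ) (hη n hn _)).trans (map_zero _)

end Polarization

/-! ### Products over the components of a decomposition -/

section WedgeL

variable {𝕜 : Type} [RCLike 𝕜] {W : Type u}

/-- The iterated anti-symmetrized product of a finite family. -/
def wedgeL {m : ℕ} (F : Fin m → PreFock 𝕜 W) : PreFock 𝕜 W := (List.ofFn F).foldr wedge unitPre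

/-- The iterated anti-symmetrized product of a finite family, in the reversed order. -/
def wedgeR {m : ℕ} (F : Fin m → PreFock 𝕜 W) : PreFock 𝕜 W :=
  revPre (wedgeL fun i => revPre (F i))

theorem wedgeL_zero (F : Fin 0 → PreFock 𝕜 W) : wedgeL F = unitPre := by
  rw [wedgeL, List.ofFn_zero]
  rfl

theorem wedgeL_succ {m : ℕ} (F : Fin (m + 1) → PreFock 𝕜 W) :
    wedgeL F = wedge (F 0) (wedgeL fun i => F i.succ) := by
  rw [wedgeL, List.ofFn_succ]
  rfl

theorem revPre_revPre (σ : PreFock 𝕜 W) : revPre (revPre σ) = σ := by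
  funext n x
  simp [revPre]

theorem wedgeR_zero (F : Fin 0 → PreFock 𝕜 W) : wedgeR F = unitPre := by
  rw [wedgeR, wedgeL_zero]
  rfl

theorem wedgeR_succ {m : ℕ} (F : Fin (m + 1) → PreFock 𝕜 W) :
    wedgeR F = wedge (wedgeR fun i => F i.succ) (F 0) := by
  rw [wedgeR, wedgeL_succ, revPre_wedge, revPre_revPre]
  rfl

theorem wedgeL_update_add {m : ℕ} (F : Fin m → PreFock 𝕜 W) (i : Fin m) (σ τ : PreFock 𝕜 W) :
    wedgeL (Function.update F i (σ + τ)) =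
      wedgeL (Function.update F i σ) + wedgeL (Function.update F i τ) := by
  induction m with
  | zero => exact i.elim0
  | succ m ih =>
    simp only [wedgeL_succ]
    refine Fin.cases ?_ (fun i => ?_) i
    · simp [wedge_add_left, Fin.succ_ne_zero]
    · have : ∀ ρ : PreFock 𝕜 W, (fun j : Fin m => Function.update F i.succ ρ j.succ) =
          Function.update (fun j => F j.succ) i ρ := fun ρ =>
        (Function.update_comp_eq_of_injective F (Fin.succ_injective m) i ρ)
      simp [this, ih, wedge_add_right, (Fin.succ_ne_zero i).symm]

theorem wedgeL_update_smul {m : ℕ} (F : Fin m → PreFock 𝕜 W) (i : Fin m) (c : 𝕜)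
    (σ : PreFock 𝕜 W) : wedgeL (Function.update F i (c • σ)) =
      c • wedgeL (Function.update F i σ) := by
  induction m with
  | zero => exact i.elim0
  | succ m ih =>
    simp only [wedgeL_succ]
    refine Fin.cases ?_ (fun i => ?_) i
    · simp [wedge_smul_left, Fin.succ_ne_zero]
    · have : ∀ ρ : PreFock 𝕜 W, (fun j : Fin m => Function.update F i.succ ρ j.succ) =
          Function.update (fun j => F j.succ) i ρ := fun ρ =>
        (Function.update_comp_eq_of_injective F (Fin.succ_injective m) i ρ)
      simp [this, ih, wedge_smul_right, (Fin.succ_ne_zero i).symm]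

end WedgeL

section Signs

variable {W : Type u} [NormedAddCommGroup W] [InnerProductSpace ℝ W]

theorem IsAlt.wedgeL {𝕜 : Type} [RCLike 𝕜] {m : ℕ} {F : Fin m → PreFock 𝕜 W}
    (h : ∀ i, IsAlt (F i)) : IsAlt (wedgeL F) := by
  induction m with
  | zero =>
    rw [wedgeL_zero]
    exact IsAlt.unit
  | succ m ih =>
    rw [wedgeL_succ]
    exact (h 0).wedge (ih fun i => h i.succ)

theorem IsAlt.wedgeR {𝕜 : Type} [RCLike 𝕜] {m : ℕ} {F : Fin m → PreFock 𝕜 W}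
    (h : ∀ i, IsAlt (F i)) : IsAlt (wedgeR F) := by
  induction m with
  | zero =>
    rw [wedgeR_zero]
    exact IsAlt.unit
  | succ m ih =>
    rw [wedgeR_succ]
    exact (ih fun i => h i.succ).wedge (h 0)

theorem IsHolo.wedgeL {c : ℂ} {J : W →ₗ[ℝ] W} {m : ℕ} {F : Fin m → PreFock ℂ W}
    (h : ∀ i, IsAlt (F i)) (h' : ∀ i, IsHolo c J (F i)) : IsHolo c J (wedgeL F) := by
  induction m with
  | zero =>
    rw [wedgeL_zero]
    exact IsHolo.unit
  | succ m ih =>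
    rw [wedgeL_succ]
    exact (h' 0).wedge (ih (fun i => h i.succ) fun i => h' i.succ) (h 0)
      (IsAlt.wedgeL fun i => h i.succ)

theorem IsPar.wedge {𝕜 : Type} [RCLike 𝕜] {a b : ZMod 2} {σ τ : PreFock 𝕜 W} (hσ : IsPar a σ)
    (hτ : IsPar b τ) : IsPar (a + b) (wedge σ τ) := by
  intro n hn x
  refine Finset.sum_eq_zero fun k _ => ?_
  rw [Finset.sum_eq_zero, mul_zero]
  intro π _
  by_cases hk : ((k : ℕ) : ZMod 2) = a
  · rw [hτ (n - k), mul_zero, mul_zero]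
    intro h
    apply hn
    rw [← hk, ← h, ← Nat.cast_add, Nat.add_sub_cancel' (Nat.le_of_lt_succ k.2)]
  · rw [hσ k hk, zero_mul, mul_zero]

theorem IsPar.unit {𝕜 : Type} [RCLike 𝕜] : IsPar 0 (unitPre : PreFock 𝕜 W) := fun n hn _ =>
  if_neg fun h => hn (by rw [h, Nat.cast_zero])

theorem IsPar.wedgeL {𝕜 : Type} [RCLike 𝕜] {m : ℕ} {F : Fin m → PreFock 𝕜 W} {a : Fin m → ZMod 2}
    (h : ∀ i, IsPar (a i) (F i)) : IsPar (∑ i, a i) (wedgeL F) := by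
  induction m with
  | zero =>
    rw [wedgeL_zero]
    exact IsPar.unit
  | succ m ih =>
    rw [wedgeL_succ, Fin.sum_univ_succ]
    exact (h 0).wedge (ih fun i => h i.succ)

theorem IsPar.wedgeR {𝕜 : Type} [RCLike 𝕜] {m : ℕ} {F : Fin m → PreFock 𝕜 W} {a : Fin m → ZMod 2}
    (h : ∀ i, IsPar (a i) (F i)) : IsPar (∑ i, a i) (wedgeR F) := by
  induction m with
  | zero =>
    rw [wedgeR_zero]
    exact IsPar.unit
  | succ m ih =>
    rw [wedgeR_succ, Fin.sum_univ_succ, add_comm]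
    exact (ih fun i => h i.succ).wedge (h 0)

theorem fsgn_sum (b : ZMod 2) {m : ℕ} (a : Fin m → ZMod 2) :
    fsgn b (∑ i, a i) = ∏ i, fsgn b (a i) := by
  have hadd : ∀ x y : ZMod 2, fsgn b (x + y) = fsgn b x * fsgn b y := by
    intro x y
    rw [fsgn, fsgn, fsgn, ← pow_add, neg_one_pow_eq_pow_mod_two, neg_one_pow_eq_pow_mod_two
      (n := b.val * x.val + b.val * y.val)]
    congr 1
    revert b x y
    decide
  induction m with
  | zero => simp [fsgn]
  | succ m ih => rw [Fin.sum_univ_succ, Fin.prod_univ_succ, hadd, ih]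

/-- Collecting the first and the second factors of a family of products: the second factors are
collected in the reversed order. -/
theorem wedgeL_wedge {m : ℕ} {A B : Fin m → PreFock ℂ W} {a b : Fin m → ZMod 2}
    (hA : ∀ i, IsAlt (A i)) (hB : ∀ i, IsAlt (B i)) (ha : ∀ i, IsPar (a i) (A i))
    (hb : ∀ i, IsPar (b i) (B i)) :
    wedgeL (fun i => wedge (A i) (B i)) =
      (∏ i, ∏ j ∈ Finset.Ioi i, fsgn (b i) (a j) * fsgn (b i) (b j)) •
        wedge (wedgeL A) (wedgeR B) := by
  induction m with
  | zero => simp [wedgeL_zero, wedgeR_zero, unit_wedge IsAlt.unit]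
  | succ m ih =>
    have hA' : IsAlt (wedgeL fun i => A i.succ) := IsAlt.wedgeL fun i => hA i.succ
    have hB' : IsAlt (wedgeR fun i => B i.succ) := IsAlt.wedgeR fun i => hB i.succ
    have e1 := wedge_comm (hB 0) hA' (hb 0) (IsPar.wedgeL fun i => ha i.succ)
    have e2 := wedge_comm (hB 0) hB' (hb 0) (IsPar.wedgeR fun i => hb i.succ)
    rw [← fsgn, fsgn_sum] at e1 e2
    rw [wedgeL_succ, ih (fun i => hA i.succ) (fun i => hB i.succ) (fun i => ha i.succ)
      (fun i => hb i.succ), wedge_smul_right, Fin.prod_univ_succ, Fin.prod_Ioi_zero,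
      wedgeL_succ A, wedgeR_succ B]
    simp only [Fin.prod_Ioi_succ]
    rw [wedge_assoc (hA 0) (hB 0) (hA'.wedge hB'), ← wedge_assoc (hB 0) hA' hB', e1,
      wedge_smul_left, wedge_assoc hA' (hB 0) hB', e2, wedge_smul_right, wedge_smul_right,
      wedge_smul_right, wedge_assoc (hA 0) hA' (hB'.wedge (hB 0)), smul_smul, smul_smul,
      Finset.prod_mul_distrib]
    congr 1
    ring

end Signs

section Glue

variable {n : ℕ} {V : Fin n → Type u} [∀ i, NormedAddCommGroup (V i)]
  [∀ i, InnerProductSpace ℝ (V i)] [∀ i, CompleteSpace (V i)]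
  {W : Type u} [NormedAddCommGroup W] [InnerProductSpace ℝ W] [CompleteSpace W]
  (g : PiLp 2 V ≃ₗᵢ[ℝ] W)

/-- The projection to a component of an orthogonal sum. -/
def gproj (i : Fin n) : W →L[ℝ] V i :=
  (PiLp.proj 2 V i).comp (g.symm.toContinuousLinearEquiv : W →L[ℝ] PiLp 2 V)

theorem gproj_apply (i : Fin n) (x : W) : gproj g i x = g.symm x i := rfl

/-- The union of orthonormal bases of the components. -/
def gvec (a : (i : Fin n) × StdIdx (V i)) : W :=
  g (PiLp.single 2 a.1 (stdBasis (V a.1) a.2))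

theorem gproj_gvec_same (i : Fin n) (j : StdIdx (V i)) :
    gproj g i (gvec g ⟨i, j⟩) = stdBasis (V i) j := by
  simp [gproj_apply, gvec]

theorem gproj_gvec_ne {i k : Fin n} (h : k ≠ i) (j : StdIdx (V i)) :
    gproj g k (gvec g ⟨i, j⟩) = 0 := by
  simp [gproj_apply, gvec, h]

theorem inner_gvec (a : (i : Fin n) × StdIdx (V i)) (x : W) :
    inner ℝ (gvec g a) x = inner ℝ (stdBasis (V a.1) a.2) (gproj g a.1 x) := by
  rw [gproj_apply, gvec, ← LinearIsometryEquiv.inner_map_map g.symm,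
    LinearIsometryEquiv.symm_apply_apply, PiLp.inner_apply, Finset.sum_eq_single a.1]
  · simp
  · intro k _ hk
    simp [hk]
  · simp

theorem orthonormal_gvec : Orthonormal ℝ (gvec g) := by
  classical
  rw [orthonormal_iff_ite]
  rintro ⟨i, j⟩ ⟨i', j'⟩
  rw [inner_gvec]
  by_cases h : i = i'
  · subst h
    rw [gproj_gvec_same, orthonormal_iff_ite.1 (stdBasis (V i)).orthonormal]
    simp
  · rw [gproj_gvec_ne g h, inner_zero_right, if_neg]
    rintro ⟨⟩
    exact h rfl

/-- The union of orthonormal bases of the components, as a basis of their orthogonal sum. -/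
def gbasis : HilbertBasis ((i : Fin n) × StdIdx (V i)) ℝ W :=
  HilbertBasis.mkOfOrthogonalEqBot (orthonormal_gvec g) (by
    rw [Submodule.eq_bot_iff]
    intro x hx
    rw [Submodule.mem_orthogonal] at hx
    have h1 : ∀ i, gproj g i x = 0 := by
      intro i
      refine (stdBasis (V i)).repr.injective ?_
      ext j
      rw [map_zero, HilbertBasis.repr_apply_apply, ← inner_gvec g ⟨i, j⟩]
      exact hx _ (Submodule.subset_span ⟨_, rfl⟩)
    have h2 : g.symm x = 0 := by
      ext i
      exact h1 i
    simpa using h2)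

theorem gbasis_apply (a : (i : Fin n) × StdIdx (V i)) : gbasis g a = gvec g a := by
  rw [gbasis, HilbertBasis.coe_mkOfOrthogonalEqBot]

theorem isFrame_gvec : IsFrame fun a => (gvec g a, (0 : W)) := by
  have := isFrame_basis (gbasis g)
  simpa only [gbasis_apply] using this

theorem ins_zero_arg {σ : PreFock ℂ W} (hσ : IsAlt σ) : ins (0 : W) σ = 0 := by
  have := ins_smul_arg hσ 0 0
  simpa using this

theorem insC_real (x : W) {σ : PreFock ℂ W} (hσ : IsAlt σ) : insC (x, 0) σ = ins x σ := by
  rw [insC_apply, ins_zero_arg hσ]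
  simp

theorem ins_pull {V' : Type u} (f : W → V') (x : W) (σ : PreFock ℂ V') :
    ins x (pullPre f σ) = pullPre f (ins (f x) σ) := by
  funext n y
  rw [ins_apply, pullPre, pullPre, ins_apply]
  congr 2
  funext j
  refine Fin.cases ?_ (fun j => ?_) j <;> simp

theorem ins_gvec_pull {i k : Fin n} (h : k ≠ i) (j : StdIdx (V i)) {σ : PreFock ℂ (V k)}
    (hσ : IsAlt σ) : ins (gvec g ⟨i, j⟩) (pullPre (gproj g k) σ) = 0 := by
  rw [ins_pull, gproj_gvec_ne g h, ins_zero_arg hσ]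
  rfl

/-- Pulling back along the projection to a component preserves norms, since the basis vectors of the
other components are annihilated. -/
theorem sqN_gproj (i : Fin n) (m : ℕ) : ∀ {σ : PreFock ℂ (V i)}, IsAlt σ →
    sqN m (pullPre (gproj g i) σ) = sqN m σ := by
  induction m with
  | zero =>
    intro σ _
    have : ∀ {U : Type u} [NormedAddCommGroup U] [InnerProductSpace ℝ U] [CompleteSpace U]
        (ρ : PreFock ℂ U) , sqN 0 ρ = ENNReal.ofReal (‖ρ 0 (fun j => j.elim0)‖ ^ 2) := by
      intro U _ _ _ ρ
      rw [sqN, tsum_eq_single (fun j => j.elim0) (fun i hi => (hi (funext fun j => j.elim0)).elim)]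
      rw [Nat.factorial_zero, Nat.cast_one, one_mul]
      congr 4
      funext j
      exact j.elim0
    rw [this, this, pullPre]
    congr 4
    funext j
    exact j.elim0
  | succ m ih =>
    intro σ hσ
    have h1 := succ_sqN (isFrame_gvec g) (hσ.pull (gproj g i)) m
    have h2 := succ_sqN (isFrame_basis (stdBasis (V i))) hσ m
    rw [ENNReal.tsum_sigma', tsum_eq_single i] at h1
    · have h3 : ∀ j, insC (gvec g ⟨i, j⟩, (0 : W)) (pullPre (gproj g i) σ) =
          pullPre (gproj g i) (insC (stdBasis (V i) j, (0 : V i)) σ) := by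
        intro j
        rw [insC_real _ (hσ.pull _), insC_real _ hσ, ins_pull, gproj_gvec_same]
      simp only [h3] at h1
      rw [tsum_congr fun j => ih (hσ.insC (stdBasis (V i) j, (0 : V i))), ← h2] at h1
      exact (ENNReal.mul_right_inj (by exact_mod_cast m.succ_ne_zero)
        (ENNReal.natCast_ne_top _)).1 h1
    · intro k hk
      refine ENNReal.tsum_eq_zero.2 fun j => ?_
      rw [insC_real _ (hσ.pull _), ins_gvec_pull g hk.symm j hσ, sqN_zero]

theorem sqT_gproj (i : Fin n) {σ : PreFock ℂ (V i)} (hσ : IsAlt σ) :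
    sqT (pullPre (gproj g i) σ) = sqT σ := tsum_congr fun m => sqN_gproj g i m hσ

theorem sqT_unit : sqT (unitPre : PreFock ℂ W) = 1 := by
  rw [sqT, tsum_eq_single 0, sqN,
    tsum_eq_single (fun j => j.elim0) (fun i hi => (hi (funext fun j => j.elim0)).elim)]
  · simp [unitPre]
  · intro m hm
    simp [sqN, unitPre, hm]

/-- The product of functions on the components of an orthogonal sum multiplies square norms. -/
theorem sqT_wedgeL {m : ℕ} (f : Fin m → Fin n) (hf : Function.Injective f)
    (F : Fin m → PreFock ℂ W) (hF : ∀ i, IsAlt (F i))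
    (hk : ∀ i a, a.1 ≠ f i → ins (gvec g a) (F i) = 0) :
    sqT (wedgeL F) = ∏ i, sqT (F i) ∧ ∀ a, a.1 ∉ Set.range f → ins (gvec g a) (wedgeL F) = 0 := by
  induction m with
  | zero =>
    rw [wedgeL_zero, sqT_unit]
    exact ⟨by simp, fun a _ => ins_unit _⟩
  | succ m ih =>
    obtain ⟨h1, h2⟩ := ih (fun i => f i.succ) (hf.comp (Fin.succ_injective m))
      (fun i => F i.succ) (fun i => hF i.succ) fun i => hk i.succ
    have hL : IsAlt (wedgeL fun i => F i.succ) := IsAlt.wedgeL fun i => hF i.succ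
    rw [wedgeL_succ, Fin.prod_univ_succ, ← h1]
    constructor
    · refine sqT_wedge (isFrame_gvec g) (hF 0) hL fun a => ?_
      rw [insC_real _ (hF 0), insC_real _ hL]
      by_cases ha : a.1 = f 0
      · right
        refine h2 a ?_
        rintro ⟨i, hi⟩
        exact Fin.succ_ne_zero i (hf (hi.trans ha))
      · exact Or.inl (hk 0 a ha)
    · intro a ha
      rw [ins_wedge (hF 0) hL, hk 0 a fun h => ha ⟨0, h.symm⟩,
        h2 a fun ⟨i, hi⟩ => ha ⟨i.succ, hi⟩]
      simp

theorem sqT_wedgeL_gproj (σ : ∀ i, Fock ℂ (V i)) :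
    sqT (wedgeL fun i => pullPre (gproj g i) (σ i).fn) = ∏ i, sqT (σ i).fn := by
  rw [(sqT_wedgeL g id Function.injective_id _ (fun i => (σ i).isAlt.pull (gproj g i)) ?_).1]
  · exact Finset.prod_congr rfl fun i _ => sqT_gproj g i (σ i).isAlt
  · rintro i ⟨k, j⟩ h
    exact ins_gvec_pull g (fun e => h e.symm) j (σ i).isAlt

end Glue

/-! ### The maps for decompositions -/

namespace FermionicTheory

variable {S : SpacetimeSystem.{u, v, w}} (T : FermionicTheory.{u, v, w, u₁, u₂} S)
  {n : ℕ} {parts : Fin n → S.Hyp} {s : S.Hyp}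

theorem tau_eq {𝕜 : Type} [RCLike 𝕜] (d : S.Dec parts s) (σ : ∀ i, Fock 𝕜 (T.L (parts i))) :
    T.tau d σ = wedgeL fun i => pullPre (gproj (T.glue d) i) (σ i).fn := rfl

theorem isFock_tau (d : S.Dec parts s) (σ : ∀ i, T.DC (parts i)) :
    IsFock ℂ (T.L s) (T.tau d σ) := by
  rw [tau_eq, isFock_iff, sqT_wedgeL_gproj]
  refine ⟨IsAlt.wedgeL fun i => (σ i).isAlt.pull (gproj (T.glue d) i), ?_⟩
  exact ENNReal.prod_ne_top fun i _ => ((isFock_iff _).1 (σ i).isFock).2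

/-- The map for a decomposition, as a multilinear map. -/
def tauM (d : S.Dec parts s) : MultilinearMap ℂ (fun i => T.DC (parts i)) (T.DC s) where
  toFun σ := Fock.mk (T.tau d σ) (T.isFock_tau d σ)
  map_update_add' {inst} σ i x y := by
    obtain rfl : inst = instDecidableEqFin n := Subsingleton.elim _ _
    apply Subtype.ext
    change T.tau d _ = T.tau d _ + T.tau d _
    have : ∀ z, T.tau d (Function.update σ i z) = wedgeL (Function.update
        (fun j => pullPre (gproj (T.glue d) j) (σ j).fn) i
          (pullPre (gproj (T.glue d) i) z.fn)) := fun z => by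
      rw [tau_eq]
      congr 1
      funext j
      by_cases hj : j = i
      · subst hj
        simp
      · simp [hj]
    rw [this, this, this, ← wedgeL_update_add]
    rfl
  map_update_smul' {inst} σ i c x := by
    obtain rfl : inst = instDecidableEqFin n := Subsingleton.elim _ _
    apply Subtype.ext
    change T.tau d _ = c • T.tau d _
    have : ∀ z, T.tau d (Function.update σ i z) = wedgeL (Function.update
        (fun j => pullPre (gproj (T.glue d) j) (σ j).fn) i
          (pullPre (gproj (T.glue d) i) z.fn)) := fun z => by
      rw [tau_eq]
      congr 1
      funext j
      by_cases hj : j = i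
      · subst hj
        simp
      · simp [hj]
    rw [this, this, ← wedgeL_update_smul]
    rfl

theorem tauM_fn (d : S.Dec parts s) (σ : ∀ i, T.DC (parts i)) :
    (T.tauM d σ).fn = T.tau d σ := rfl

theorem norm_tauM (d : S.Dec parts s) (σ : ∀ i, T.DC (parts i)) :
    ‖T.tauM d σ‖ = ∏ i, ‖σ i‖ := by
  have h := sqT_wedgeL_gproj (T.glue d) σ
  rw [← T.tau_eq d σ, ← T.tauM_fn d σ, ← ofReal_norm_sq] at h
  simp only [← ofReal_norm_sq] at h
  rw [← ENNReal.ofReal_prod_of_nonneg fun i _ => by positivity, Finset.prod_pow,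
    ENNReal.ofReal_eq_ofReal_iff (by positivity) (by positivity)] at h
  exact (sq_eq_sq₀ (by positivity) (by positivity)).1 h

/-- The map for a decomposition, as a continuous multilinear map. -/
def tauC (d : S.Dec parts s) : ContinuousMultilinearMap ℂ (fun i => T.DC (parts i)) (T.DC s) :=
  (T.tauM d).mkContinuous 1 fun σ => by rw [T.norm_tauM, one_mul]

theorem cplx_fn {V : Type u₁} [NormedAddCommGroup V] [InnerProductSpace ℝ V] [CompleteSpace V]
    (σ : Fock ℝ V) : (Fock.cplx σ).fn = fun n x => ((σ.fn n x : ℝ) : ℂ) := rfl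

theorem cplx_wedgeL {W : Type u₁} {m : ℕ} (F : Fin m → PreFock ℝ W) :
    (fun n x => ((wedgeL F n x : ℝ) : ℂ)) = wedgeL fun i n x => ((F i n x : ℝ) : ℂ) := by
  induction m with
  | zero =>
    rw [wedgeL_zero, wedgeL_zero]
    funext n x
    by_cases hn : n = 0 <;> simp [unitPre, hn]
  | succ m ih => rw [wedgeL_succ, wedgeL_succ, wedge_cplx, ih]

theorem tau_cplx (d : S.Dec parts s) (σ : ∀ i, T.DR (parts i)) :
    T.tau d (fun i => Fock.cplx (σ i)) = fun n x => ((T.tau d σ n x : ℝ) : ℂ) := by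
  rw [tau_eq, tau_eq, cplx_wedgeL]
  rfl

theorem isFock_tau_real (d : S.Dec parts s) (σ : ∀ i, T.DR (parts i)) :
    IsFock ℝ (T.L s) (T.tau d σ) := by
  rw [isFock_iff]
  refine ⟨IsAlt.wedgeL fun i => (σ i).isAlt.pull (gproj (T.glue d) i), ?_⟩
  have h := ((isFock_iff _).1 (T.isFock_tau d fun i => Fock.cplx (σ i))).2
  rw [tau_cplx] at h
  have e : sqT (fun n x => ((T.tau d σ n x : ℝ) : ℂ)) = sqT (T.tau d σ) := by
    simp only [sqT, sqN, Complex.norm_real]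
  rwa [e] at h

/-- The map for a decomposition on the real spaces. -/
def tauR (d : S.Dec parts s) (σ : ∀ i, T.DR (parts i)) : T.DR s :=
  Fock.mk (T.tau d σ) (T.isFock_tau_real d σ)

theorem cplx_tauR (d : S.Dec parts s) (σ : ∀ i, T.DR (parts i)) :
    Fock.cplx (T.tauR d σ) = T.tauC d fun i => Fock.cplx (σ i) :=
  Subtype.ext (T.tau_cplx d σ).symm

theorem fundF_tauR (d : S.Dec parts s) (σ : ∀ i, T.DR (parts i)) :
    Fock.fundF (T.tauR d σ) = T.tauR d fun i => Fock.fundF (σ i) := by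
  apply Subtype.ext
  have hp : ∀ {m : ℕ} (F : Fin m → PreFock ℝ (T.L s)),
      pullPre fund (wedgeL F) = wedgeL fun i => pullPre fund (F i) := by
    intro m
    induction m with
    | zero => intro F; rw [wedgeL_zero, wedgeL_zero]; rfl
    | succ m ih => intro F; rw [wedgeL_succ, wedgeL_succ, pullPre_wedge, ih]
  change pullPre fund (T.tau d σ) = T.tau d _
  rw [tau_eq, tau_eq, hp]
  congr 1
  funext i n x
  change (σ i).fn n (fun j => (T.glue d).symm (fund (x j)) i) =
    (σ i).fn n (fun j => fund ((T.glue d).symm (x j) i))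
  simp only [T.glue_fund]

end FermionicTheory

namespace Polarization

variable {S : SpacetimeSystem.{u, v, w}} {T : FermionicTheory.{u, v, w, u₁, u₂} S}
  (P : Polarization T) {n : ℕ} {parts : Fin n → S.Hyp} {s : S.Hyp}

theorem isHolo_tau (d : S.Dec parts s) (p : s ∈ P.Pol) (q : ∀ i, parts i ∈ P.Pol) {c : ℂ}
    {σ : ∀ i, T.DC (parts i)} (h : ∀ i, IsHolo c (P.J _ (q i)) (σ i).fn) :
    IsHolo c (P.J s p) (T.tau d σ) := by
  refine IsHolo.wedgeL (fun i => (σ i).isAlt.pull (gproj (T.glue d) i)) fun i x => ?_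
  have h1 := h i ((T.glue d).symm x i)
  rw [← P.J_glue d p q] at h1
  refine (ins_pull (gproj (T.glue d) i) _ _).trans ?_
  refine Eq.trans ?_ (congrArg (c • ·) (ins_pull (gproj (T.glue d) i) x _).symm)
  exact congrArg (pullPre (gproj (T.glue d) i)) h1

/-- The map for a decomposition on the holomorphic elements. -/
def tauH (d : S.Dec parts s) (p : s ∈ P.Pol) (q : ∀ i, parts i ∈ P.Pol) (ψ : ∀ i, P.H (q i)) :
    P.H p :=
  ⟨T.tauC d fun i => (ψ i).1, mem_holo (P.isHolo_tau d p q fun i => P.isHolo_H (q i) (ψ i))⟩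

/-- In terms of functions on the original hypersurface, the product for the opposite orientation has
its factors in the reversed order. -/
theorem flipD_tau (d : S.Dec parts s) (η : ∀ i, T.DC (S.rev (parts i))) :
    (T.flipD ℂ rfl (T.tauC (S.revDec d) η)).fn =
      wedgeR fun i => pullPre (gproj (T.glue d) i) (T.flipD ℂ rfl (η i)).fn := by
  have hp : ∀ {m : ℕ} (F : Fin m → PreFock ℂ (T.L (S.rev s))),
      pullPre (T.flip (S := S) (s := s) rfl) (wedgeL F) =
        wedgeL fun i => pullPre (T.flip rfl) (F i) := by
    intro m
    induction m with
    | zero => intro F; rw [wedgeL_zero, wedgeL_zero]; rfl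
    | succ m ih => intro F; rw [wedgeL_succ, wedgeL_succ, pullPre_wedge, ih]
  change revPre (pullPre (T.flip rfl) (T.tau (S.revDec d) η)) = _
  rw [T.tau_eq, hp, wedgeR]
  congr 2
  funext i m x
  change (η i).fn m (fun j => (T.glue (S.revDec d)).symm (T.flip rfl (x j)) i) =
    (η i).fn m (fun j => T.flip rfl ((T.glue d).symm (x (Fin.rev (Fin.rev j))) i))
  simp only [T.glue_flip, Fin.rev_rev]

/-- The sign results from collecting the holomorphic and the anti-holomorphic factors, and from the
reversed order of the latter. -/
theorem tau_wedgeB (d : S.Dec parts s) (p : s ∈ P.Pol) (q : ∀ i, parts i ∈ P.Pol)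
    (a b : Fin n → ZMod 2) (ψ : ∀ i, P.H (q i)) (η : ∀ i, P.H (P.rev_mem _ (q i)))
    (hψ : ∀ i, (ψ i).1 ∈ Fock.fpar (a i)) (hη : ∀ i, (η i).1 ∈ Fock.fpar (b i)) :
    T.tauC d (fun i => P.wedgeB rfl (q i) (P.rev_mem _ (q i)) (ψ i) (η i)) =
      (∏ i, ∏ j ∈ Finset.Ioi i, fsgn (b i) (a j) * fsgn (b i) (b j)) •
        P.wedgeB rfl p (P.rev_mem _ p) (P.tauH d p q ψ)
          (P.tauH (S.revDec d) (P.rev_mem _ p) (fun i => P.rev_mem _ (q i)) η) := by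
  apply Subtype.ext
  change T.tau d _ = (_ : ℂ) • wedge (T.tau d fun i => (ψ i).1)
    (T.flipD ℂ rfl (T.tauC (S.revDec d) fun i => (η i).1)).fn
  have h := wedgeL_wedge (A := fun i => pullPre (gproj (T.glue d) i) (ψ i).1.fn)
    (B := fun i => pullPre (gproj (T.glue d) i) (T.flipD ℂ rfl (η i).1).fn) (a := a) (b := b)
    (fun i => (ψ i).1.isAlt.pull (gproj (T.glue d) i))
    (fun i => (T.flipD ℂ rfl (η i).1).isAlt.pull (gproj (T.glue d) i))
    (fun i m hm _ => hψ i m hm _) (fun i m hm _ => hη i m hm _)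
  rw [flipD_tau]
  exact h

end Polarization

/-! ### The probability maps -/

section AmpFlip

variable {V : Type u} [NormedAddCommGroup V] [InnerProductSpace ℝ V] [KreinSpace V]
  {W : Type u} [NormedAddCommGroup W] [InnerProductSpace ℝ W] [KreinSpace W]

/-- The image of a Hilbert basis under an isometric isomorphism. -/
def mapBasis {ι : Type*} (e : V ≃ₗᵢ[ℝ] W) (b : HilbertBasis ι ℝ V) : HilbertBasis ι ℝ W :=
  HilbertBasis.ofRepr (e.symm.trans b.repr)

theorem mapBasis_apply {ι : Type*} (e : V ≃ₗᵢ[ℝ] W) (b : HilbertBasis ι ℝ V) (i : ι) :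
    mapBasis e b i = e (b i) := by
  classical
  rw [← HilbertBasis.repr_symm_single, ← HilbertBasis.repr_symm_single]
  simp [mapBasis]

theorem kip_map_neg {c : V → W} (hc : ∀ x y, inner ℝ (c x) (c y) = inner ℝ x y)
    (hf : ∀ x, c (fund x) = -fund (c x)) (x y : V) : kip (c x) (c y) = -kip x y := by
  rw [kip, kip, ← hc, hf, inner_neg_left, neg_neg]

/-- Under orientation reversal the order of the arguments is reversed, which amounts to replacing
an ON-basis by its image under `u`. -/
theorem HasAmp.flip {N : Submodule ℝ V} (hN : IsHypermaximalNeutral N) {N' : Submodule ℝ W}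
    (c : V ≃ₗᵢ[ℝ] W) (hc : ∀ x, c (fund x) = -fund (c x))
    (hcu : ∀ x, uMap N' (c x) = c (uMap N x)) {σ : Fock ℂ W} {a : ℂ} (h : HasAmp (uMap N') σ a) :
    HasAmp (uMap N) (Fock.flip c σ) a := by
  intro ι ζ hζ
  obtain ⟨h1, h2, h3, -⟩ := (uMap_unique hN (uMap N)).2 rfl
  -- By definition, `uMap N` is the reflection at the closure of `N`.
  let e : V ≃ₗᵢ[ℝ] W := N.topologicalClosure.reflection.trans c
  have he : ∀ x, e x = c (uMap N x) := fun _ => rfl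
  have hon : IsONBasis (mapBasis e ζ) := by
    intro i
    rw [mapBasis_apply, he]
    have : fund (c (uMap N (ζ i))) = c (uMap N (fund (ζ i))) := by
      rw [h2, map_neg, hc, neg_neg]
    rw [this]
    rcases hζ i with h | h
    · left; rw [h]
    · right; rw [h, map_neg, map_neg]
  refine hasSum_of_eq (h ι (mapBasis e ζ) hon) fun p => ?_
  obtain ⟨n, i⟩ := p
  have hk : ∀ j, kip (mapBasis e ζ j) (mapBasis e ζ j) = kip (ζ j) (ζ j) := fun j => by
    rw [mapBasis_apply, he, kip_map_neg c.inner_map_map hc, h3, neg_neg]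
  simp only [ampTerm, hk]
  congr 2
  rw [Fock.flip_fn]
  congr 1
  funext k
  refine Fin.addCases (fun j => ?_) (fun j => ?_) k
  · have : Fin.rev (Fin.castAdd n j) = Fin.natAdd n (Fin.rev j) := by
      ext
      simp
      omega
    rw [this, Fin.append_right, Fin.append_left, Fin.rev_rev, mapBasis_apply, he]
  · have : Fin.rev (Fin.natAdd n j) = Fin.castAdd n (Fin.rev j) := by
      ext
      simp
      omega
    rw [this, Fin.append_right, Fin.append_left, mapBasis_apply, he, hcu, h1]

theorem ampDom_sum {u : V →ₗ[ℝ] V} {ι : Type*} (s : Finset ι) (σ : ι → Fock ℂ V)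
    (h : ∀ i ∈ s, σ i ∈ ampDom ℂ u) : ∑ i ∈ s, σ i ∈ ampDom ℂ u :=
  Finset.sum_induction _ (· ∈ ampDom ℂ u) (fun _ _ => ampDom_add) ampDom_zero h

theorem continuous_uMap (N : Submodule ℝ V) : Continuous (uMap N) :=
  N.topologicalClosure.reflection.continuous

end AmpFlip

namespace FermionicTheory

variable {S : SpacetimeSystem.{u, v, w}} (T : FermionicTheory.{u, v, w, u₁, u₂} S)

/-- The involution for the opposite orientation is transported from the original one, by
uniqueness. -/
theorem uReg_flip (M : S.Reg) (x : T.L (S.bdry M)) :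
    T.uReg (S.revReg M) (T.flip (S.rev_bdry M) x) = T.flip (S.rev_bdry M) (T.uReg M x) := by
  have h := S.rev_bdry M
  have h' : S.rev (S.bdry (S.revReg M)) = S.bdry M := by rw [← h, S.rev_rev]
  obtain ⟨h1, h2, h3, h4⟩ := (uMap_unique (T.r_hypermaximal M) (T.uReg M)).2 rfl
  have hk : ∀ {s s' : S.Hyp} (h : S.rev s = s') (x y : T.L s),
      kip (T.flip h x) (T.flip h y) = -kip x y := fun h x y =>
    kip_map_neg (T.flip h).inner_map_map (T.flip_fund h) x y
  have e := (uMap_unique (T.r_hypermaximal (S.revReg M))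
    ((T.flip h).toLinearEquiv.toLinearMap ∘ₗ T.uReg M ∘ₗ
      (T.flip h').toLinearEquiv.toLinearMap)).1 ?_
  · have := LinearMap.congr_fun e (T.flip h x)
    refine this.symm.trans ?_
    change T.flip h (T.uReg M (T.flip h' (T.flip h x))) = _
    rw [T.flip_flip]
  · refine ⟨fun y => ?_, fun y => ?_, fun y z => ?_, fun y hy => ?_⟩
    · change T.flip h (T.uReg M (T.flip h' (T.flip h (T.uReg M (T.flip h' y))))) = y
      rw [T.flip_flip, h1, T.flip_flip]
    · change T.flip h (T.uReg M (T.flip h' (fund y))) = -fund (T.flip h (T.uReg M (T.flip h' y)))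
      rw [T.flip_fund, map_neg, h2, neg_neg, T.flip_fund]
    · change kip (T.flip h (T.uReg M (T.flip h' y))) (T.flip h (T.uReg M (T.flip h' z))) = _
      rw [hk, h3, hk, neg_neg]
    · obtain ⟨f, hf⟩ := T.r_flip M
      obtain ⟨φ, rfl⟩ := hy
      obtain ⟨φ, rfl⟩ := f.surjective φ
      change T.flip h (T.uReg M (T.flip h' (T.r _ (f φ)))) = _
      rw [hf, T.flip_flip, h4 _ ⟨φ, rfl⟩]

theorem hasAmp_flipD (M : S.Reg) {σ : T.DC (S.bdry (S.revReg M))} {a : ℂ}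
    (h : HasAmp (T.uReg (S.revReg M)) σ a) :
    HasAmp (T.uReg M) (T.flipD ℂ (S.rev_bdry M) σ) a :=
  HasAmp.flip (T.r_hypermaximal M) _ (T.flip_fund _) (T.uReg_flip M) h

theorem hasAmp_flipD_symm (M : S.Reg) (h' : S.rev (S.bdry (S.revReg M)) = S.bdry M)
    {σ : T.DC (S.bdry M)} {a : ℂ} (h : HasAmp (T.uReg M) σ a) :
    HasAmp (T.uReg (S.revReg M)) (T.flipD ℂ h' σ) a :=
  HasAmp.flip (T.r_hypermaximal _) _ (T.flip_fund _) (fun x => by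
    have := T.uReg_flip M (T.flip h' x)
    rw [T.flip_flip] at this
    change T.uReg M _ = T.flip h' (T.uReg (S.revReg M) x)
    rw [this, T.flip_flip]) h

end FermionicTheory

namespace Polarization

variable {S : SpacetimeSystem.{u, v, w}} {T : FermionicTheory.{u, v, w, u₁, u₂} S}
  (P : Polarization T)

/-- Partial sums over adapted bases are multiplicative on the products of holomorphic and
anti-holomorphic elements. -/
theorem ampS_wedgeB (M : S.Reg) (p : S.bdry M ∈ P.Pol) {s' : S.Hyp} (h : S.rev (S.bdry M) = s')
    (p' : s' ∈ P.Pol) {κ : Type*} {b : κ × Bool → T.L (S.bdry M)}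
    (hb : ∀ a, b (a, true) = P.J _ p (b (a, false))) (F : Finset κ) (ψ : P.H p) (η : P.H p') :
    ampS (T.uReg M) b (F ×ˢ Finset.univ) (P.wedgeB h p p' ψ η).fn =
      ampS (T.uReg M) b (F ×ˢ Finset.univ) ψ.1.fn *
        ampS (T.uReg M) b (F ×ˢ Finset.univ) (T.flipD ℂ h η.1).fn :=
  ampS_wedge hb (P.J_kip _ p) (fun x => by rw [P.J_uReg, neg_neg]) F ψ.1.isAlt (Fock.isAlt _)
    (P.isHolo_H p ψ) (P.isHolo_flipD h p p' η)

/-- Both sides are limits of the same partial sums over an adapted basis. -/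
theorem amp_identU (M : S.Reg) (p : S.bdry M ∈ P.Pol) (p' : S.bdry (S.revReg M) ∈ P.Pol) (m : ℕ)
    (ψ : Fin m → P.H p) (η : Fin m → P.H p') (hψ : ∀ k, (ψ k).1 ∈ ampDom ℂ (T.uReg M))
    (hη : ∀ k, (η k).1 ∈ ampDom ℂ (T.uReg (S.revReg M)))
    (hU : P.identU (S.rev_bdry M) p p' (∑ k, ctmul (ψ k) (η k)) ∈ ampDom ℂ (T.uReg M)) :
    amp (T.uReg M) (P.identU (S.rev_bdry M) p p' (∑ k, ctmul (ψ k) (η k))) =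
      ∑ k, amp (T.uReg M) (ψ k).1 * amp (T.uReg (S.revReg M)) (η k).1 := by
  obtain ⟨κ, b, hb, hon⟩ := exists_adapted (P.J _ p) (P.J_J _ p) (P.J_fund _ p) (P.J_kip _ p)
  have h1 := tendsto_ampL (hasAmp_amp hU) b hon
  have h2 : Filter.Tendsto (fun q : ℕ × Finset κ =>
      ∑ k, ampL (T.uReg M) b (q.2 ×ˢ Finset.univ) (ψ k).1 *
        ampL (T.uReg M) b (q.2 ×ˢ Finset.univ) (T.flipD ℂ (S.rev_bdry M) (η k).1)) Filter.atTop
      (nhds (∑ k, amp (T.uReg M) (ψ k).1 * amp (T.uReg (S.revReg M)) (η k).1)) :=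
    tendsto_finsetSum _ fun k _ => (tendsto_ampL (hasAmp_amp (hψ k)) b hon).mul
      (tendsto_ampL (T.hasAmp_flipD M (hasAmp_amp (hη k))) b hon)
  classical
  refine tendsto_nhds_unique (h1.congr fun q => ?_) h2
  rw [map_sum, map_sum]
  refine Finset.sum_congr rfl fun k _ => ?_
  rw [P.identU_ctmul, ampL_apply, P.ampS_wedgeB M p (S.rev_bdry M) p' hb]
  rfl

/-- The products of monomials lie in both domains. -/
theorem dense_common_domain (M : S.Reg) (p : S.bdry M ∈ P.Pol)
    (p' : S.bdry (S.revReg M) ∈ P.Pol) :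
    Dense {σ : T.DC (S.bdry M) | σ ∈ ampDom ℂ (T.uReg M) ∧
      ∃ (m : ℕ) (ψ : Fin m → P.H p) (η : Fin m → P.H p'),
        (∀ k, (ψ k).1 ∈ ampDom ℂ (T.uReg M)) ∧
        (∀ k, (η k).1 ∈ ampDom ℂ (T.uReg (S.revReg M))) ∧
        σ = P.identU (S.rev_bdry M) p p' (∑ k, ctmul (ψ k) (η k))} := by
  have h' : S.rev (S.bdry (S.revReg M)) = S.bdry M := by rw [← S.rev_bdry M, S.rev_rev]
  have hc : Continuous (T.uReg M) := continuous_uMap _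
  refine (P.dense_of_splitMon p (Submodule.span ℂ {σ | σ ∈ ampDom ℂ (T.uReg M) ∧
    ∃ (ψ : P.H p) (η : P.H p'), ψ.1 ∈ ampDom ℂ (T.uReg M) ∧
      η.1 ∈ ampDom ℂ (T.uReg (S.revReg M)) ∧ σ = P.wedgeB (S.rev_bdry M) p p' ψ η}) ?_).mono ?_
  · intro σ hσ
    refine Submodule.subset_span ⟨?_, ?_⟩
    · obtain ⟨k, m, a, b, -, -, e⟩ := id hσ
      obtain ⟨n, l, e'⟩ := exists_wedge_mon b k a
      rw [show σ = monF n l from Subtype.ext (e.trans e')]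
      exact monF_mem_ampDom hc n l
    · obtain ⟨ψ, η, k, m, a, b, hψ, hη, e⟩ := P.exists_of_splitMon (S.rev_bdry M) h' p p' hσ
      refine ⟨ψ, η, ?_, ?_, Subtype.ext e.symm⟩
      · rw [hψ]
        exact monF_mem_ampDom hc k a
      · rw [hη]
        exact ⟨_, T.hasAmp_flipD_symm M h' (hasAmp_amp (monF_mem_ampDom hc m b))⟩
  · intro σ hσ
    obtain ⟨m, f, g, rfl⟩ := (Submodule.mem_span_set').1 hσ
    choose hg ψ η hψ hη e using fun k => (g k).2
    refine ⟨ampDom_sum _ _ fun k _ => ampDom_smul _ (hg k), m, fun k => f k • ψ k, η,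
      fun k => ampDom_smul _ (hψ k), hη, ?_⟩
    rw [map_sum]
    refine Finset.sum_congr rfl fun k _ => ?_
    rw [P.identU_ctmul, e k, map_smul, LinearMap.smul_apply]

end Polarization

/-! ### The bigrading -/

section FockParts

variable {V : Type u} [NormedAddCommGroup V] [InnerProductSpace ℝ V] [CompleteSpace V]

/-- The f-grading operator on the Fock space. -/
def parF (σ : Fock ℂ V) : Fock ℂ V := Fock.mk (par σ.fn) ((isFock_iff _).2 ⟨σ.isAlt.par, by
  have : sqT (par σ.fn) = sqT σ.fn := tsum_congr fun n => sqN_par n σ.fn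
  rw [this]
  exact ((isFock_iff _).1 σ.isFock).2⟩)

theorem parF_fn (σ : Fock ℂ V) : (parF σ).fn = par σ.fn := rfl

/-- A subspace invariant under the f-grading operator contains the even and the odd parts of its
elements. -/
theorem exists_fpar (N : Submodule ℂ (Fock ℂ V)) (hN : ∀ σ ∈ N, parF σ ∈ N) {σ : Fock ℂ V}
    (hσ : σ ∈ N) : ∃ σ₀ ∈ N, ∃ σ₁ ∈ N, σ₀ ∈ Fock.fpar 0 ∧ σ₁ ∈ Fock.fpar 1 ∧ σ = σ₀ + σ₁ := by
  refine ⟨(1 / 2 : ℂ) • (σ + parF σ), N.smul_mem _ (N.add_mem hσ (hN σ hσ)),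
    (1 / 2 : ℂ) • (σ + (-1 : ℂ) • parF σ),
    N.smul_mem _ (N.add_mem hσ (N.smul_mem _ (hN σ hσ))), ?_, ?_, ?_⟩
  · intro n hn x
    have h1 : Odd n := by
      rw [← Nat.not_even_iff_odd]
      exact fun h => hn ((ZMod.natCast_eq_zero_iff_even).2 h)
    simp [parF_fn, par_apply, h1.neg_one_pow]
  · intro n hn x
    have h1 : Even n := by
      rw [← Nat.not_odd_iff_even]
      exact fun h => hn ((ZMod.natCast_eq_one_iff_odd).2 h)
    change (1 / 2 : ℂ) * (σ.fn n x + (-1) * ((-1) ^ n * σ.fn n x)) = 0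
    rw [h1.neg_one_pow]
    ring
  · rw [← smul_add]
    have : σ + parF σ + (σ + (-1 : ℂ) • parF σ) = (2 : ℂ) • σ := by
      rw [neg_one_smul, two_smul]
      abel
    rw [this, smul_smul]
    norm_num

theorem fpar_inter {σ : Fock ℂ V} (h0 : σ ∈ Fock.fpar (𝕜 := ℂ) 0) (h1 : σ ∈ Fock.fpar (𝕜 := ℂ) 1) :
    σ = 0 := by
  ext n x
  by_cases hn : (n : ZMod 2) = 0
  · exact h1 n (by rw [hn]; decide) x
  · exact h0 n hn x

theorem isClosed_fpar (a : ZMod 2) :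
    IsClosed ((Fock.fpar a : Submodule ℂ (Fock ℂ V)) : Set (Fock ℂ V)) := by
  have : ((Fock.fpar a : Submodule ℂ (Fock ℂ V)) : Set (Fock ℂ V)) =
      ⋂ (n : ℕ) (_ : (n : ZMod 2) ≠ a) (x : Fin n → V), {σ | evalL (𝕜 := ℂ) n x σ = 0} := by
    ext σ
    simp only [Set.mem_iInter]
    rfl
  rw [this]
  exact isClosed_iInter fun n => isClosed_iInter fun _ => isClosed_iInter fun x =>
    isClosed_eq (evalL n x).continuous continuous_const

/-- Complex conjugation as a conjugate linear map. -/
def conjL : Fock ℂ V →ₗ⋆[ℂ] Fock ℂ V where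
  toFun := Fock.conj
  map_add' σ τ := by
    ext n x
    exact map_add (starRingEnd ℂ) _ _
  map_smul' c σ := by
    ext n x
    exact map_mul (starRingEnd ℂ) _ _

theorem norm_conj (σ : Fock ℂ V) : ‖Fock.conj σ‖ = ‖σ‖ := by
  rw [← sq_eq_sq₀ (norm_nonneg _) (norm_nonneg _), norm_sq_eq_re_inner (𝕜 := ℂ),
    norm_sq_eq_re_inner (𝕜 := ℂ) σ, Fock.inner_conj]

theorem continuous_conj : Continuous (Fock.conj : Fock ℂ V → Fock ℂ V) :=
  AddMonoidHomClass.continuous_of_bound (conjL (V := V)) 1 fun σ => by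
    rw [one_mul]
    exact (norm_conj σ).le

/-- The inclusion of the real in the complex Fock space as a linear map. -/
def cplxL : Fock ℝ V →ₗ[ℝ] Fock ℂ V where
  toFun := Fock.cplx
  map_add' σ τ := by
    ext n x
    exact Complex.ofReal_add _ _
  map_smul' c σ := by
    ext n x
    exact Complex.ofReal_mul _ _

theorem cplx_inj {σ τ : Fock ℝ V} (h : Fock.cplx σ = Fock.cplx τ) : σ = τ := by
  ext n x
  have := congrArg (fun ρ : Fock ℂ V => ρ.fn n x) h
  exact Complex.ofReal_injective this

theorem inner_cplx (σ τ : Fock ℝ V) :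
    inner ℂ (Fock.cplx σ) (Fock.cplx τ) = ((inner ℝ σ τ : ℝ) : ℂ) := by
  refine (Fock.hasSum_inner (stdBasis V) (Fock.cplx σ) (Fock.cplx τ)).unique
    (hasSum_of_eq (Complex.hasSum_ofReal.2 (Fock.hasSum_inner (stdBasis V) σ τ)) fun p => ?_)
  simp [FermionicTheory.cplx_fn]

theorem continuous_cplx : Continuous (Fock.cplx : Fock ℝ V → Fock ℂ V) := by
  refine AddMonoidHomClass.continuous_of_bound (cplxL (V := V)) 1 fun σ => ?_
  rw [one_mul]
  refine le_of_eq ((sq_eq_sq₀ (norm_nonneg _) (norm_nonneg _)).1 ?_)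
  change ‖Fock.cplx σ‖ ^ 2 = _
  rw [norm_sq_eq_re_inner (𝕜 := ℂ), inner_cplx, ← real_inner_self_eq_norm_sq]
  rfl

theorem conj_cplx (σ : Fock ℝ V) : Fock.conj (Fock.cplx σ) = Fock.cplx σ := by
  ext n x
  exact Complex.conj_ofReal _

/-- An element invariant under complex conjugation is real. -/
theorem exists_cplx {σ : Fock ℂ V} (h : Fock.conj σ = σ) : ∃ τ : Fock ℝ V, Fock.cplx τ = σ := by
  have hre : ∀ n x, ((σ.fn n x).re : ℂ) = σ.fn n x := fun n x =>
    Complex.conj_eq_iff_re.1 (congrArg (fun ρ : Fock ℂ V => ρ.fn n x) h)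
  refine ⟨Fock.mk (fun n x => (σ.fn n x).re) ⟨fun n => ?_, ?_⟩, ?_⟩
  · obtain ⟨f, hf⟩ := σ.isFock.alt n
    exact ⟨Complex.reCLM.compContinuousAlternatingMap f, fun x => by simp [hf]⟩
  · refine σ.isFock.summable.congr fun p => ?_
    rw [← hre, Complex.norm_real]
    simp
  · ext n x
    exact hre n x

end FockParts

namespace Polarization

variable {S : SpacetimeSystem.{u, v, w}} {T : FermionicTheory.{u, v, w, u₁, u₂} S}
  (P : Polarization T) {s s' : S.Hyp} (h : S.rev s = s') (p : s ∈ P.Pol) (p' : s' ∈ P.Pol)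

/-- The products of a holomorphic and an anti-holomorphic element of given f-degrees. -/
def bigen (a b : ZMod 2) : Set (T.DC s) :=
  {σ | ∃ (ψ : P.H p) (η : P.H p'), ψ.1 ∈ Fock.fpar a ∧ η.1 ∈ Fock.fpar b ∧
    σ = P.wedgeB h p p' ψ η}

/-- The components of the bigrading. -/
abbrev bi (a b : ZMod 2) : Submodule ℂ (T.DC s) := P.bigrD (P.identU h p p') a b

/-- The components of the bigrading are the closed spans of the products. -/
theorem bi_eq (a b : ZMod 2) :
    P.bi h p p' a b = (Submodule.span ℂ (P.bigen h p p' a b)).topologicalClosure := by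
  apply SetLike.coe_injective
  rw [Submodule.topologicalClosure_coe]
  change P.identU h p p' '' (P.bigr p p' a b : Set (P.ModSq p p')) = _
  rw [bigr, Submodule.topologicalClosure_coe]
  refine ((P.identU h p p').toHomeomorph.image_closure _).trans ?_
  congr 1
  refine (congrArg (fun N : Submodule ℂ (T.DC s) => (N : Set (T.DC s))) (Submodule.map_span
    ((P.identU h p p').toLinearEquiv : P.ModSq p p' →ₗ[ℂ] T.DC s) _)).trans ?_
  refine congrArg (fun X : Set (T.DC s) =>
    ((Submodule.span ℂ X : Submodule ℂ (T.DC s)) : Set (T.DC s))) (Set.ext fun σ => ?_)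
  constructor
  · rintro ⟨_, ⟨ψ, η, hψ, hη, rfl⟩, rfl⟩
    exact ⟨ψ, η, hψ, hη, P.identU_ctmul h p p' ψ η⟩
  · rintro ⟨ψ, η, hψ, hη, rfl⟩
    exact ⟨_, ⟨ψ, η, hψ, hη, rfl⟩, P.identU_ctmul h p p' ψ η⟩

theorem isClosed_bi (a b : ZMod 2) : IsClosed (P.bi h p p' a b : Set (T.DC s)) := by
  rw [bi_eq]
  exact Submodule.isClosed_topologicalClosure _

theorem wedgeB_mem_bi {a b : ZMod 2} {ψ : P.H p} {η : P.H p'} (hψ : ψ.1 ∈ Fock.fpar a)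
    (hη : η.1 ∈ Fock.fpar b) : P.wedgeB h p p' ψ η ∈ P.bi h p p' a b := by
  rw [bi_eq]
  exact Submodule.le_topologicalClosure _ (Submodule.subset_span ⟨ψ, η, hψ, hη, rfl⟩)

/-- A closed subspace contains a component of the bigrading if it contains the generating
products. -/
theorem bi_le {a b : ZMod 2} {N : Submodule ℂ (T.DC s)} (hN : IsClosed (N : Set (T.DC s)))
    (hg : ∀ (ψ : P.H p) (η : P.H p'), ψ.1 ∈ Fock.fpar a → η.1 ∈ Fock.fpar b →
      P.wedgeB h p p' ψ η ∈ N) : P.bi h p p' a b ≤ N := by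
  rw [bi_eq]
  refine Submodule.topologicalClosure_minimal _ (Submodule.span_le.2 ?_) hN
  rintro _ ⟨ψ, η, hψ, hη, rfl⟩
  exact hg ψ η hψ hη

theorem exists_par (ψ : P.H p) : ∃ ψ₀ ψ₁ : P.H p, ψ₀.1 ∈ Fock.fpar 0 ∧ ψ₁.1 ∈ Fock.fpar 1 ∧
    ψ = ψ₀ + ψ₁ := by
  obtain ⟨σ₀, h0, σ₁, h1, h2, h3, e⟩ := exists_fpar (P.H p) (fun σ hσ =>
    mem_holo (isHolo_of_mem hσ).par) ψ.2
  exact ⟨⟨σ₀, h0⟩, ⟨σ₁, h1⟩, h2, h3, Subtype.ext e⟩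

theorem inner_bi {a b a' b' : ZMod 2} (hab : (a, b) ≠ (a', b')) {σ τ : T.DC s}
    (hσ : σ ∈ P.bi h p p' a b) (hτ : τ ∈ P.bi h p p' a' b') : inner ℂ σ τ = 0 := by
  have h1 : P.bi h p p' a b ≤ (P.bi h p p' a' b')ᗮ := by
    refine P.bi_le h p p' (Submodule.isClosed_orthogonal _) fun ψ η hψ hη => ?_
    rw [Submodule.mem_orthogonal']
    intro ρ hρ
    have h2 : P.bi h p p' a' b' ≤ (Submodule.span ℂ {P.wedgeB h p p' ψ η})ᗮ := by
      refine P.bi_le h p p' (Submodule.isClosed_orthogonal _) fun ψ' η' hψ' hη' => ?_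
      rw [Submodule.mem_orthogonal_singleton_iff_inner_right,
        inner_map_of_norm_map _ (P.norm_wedgeB h p p')]
      by_cases ha : a = a'
      · have hb : b ≠ b' := fun hb => hab (by rw [ha, hb])
        have : inner ℂ η η' = 0 := Fock.inner_eq_zero hb hη hη'
        rw [this, mul_zero]
      · have : inner ℂ ψ ψ' = 0 := Fock.inner_eq_zero ha hψ hψ'
        rw [this, zero_mul]
    exact Submodule.mem_orthogonal_singleton_iff_inner_right.1 (h2 hρ)
  exact (Submodule.mem_orthogonal' _ _).1 (h1 hσ) τ hτ

theorem dense_wedgeB : Dense (Submodule.span ℂ {σ : T.DC s | ∃ (ψ : P.H p) (η : P.H p'),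
    σ = P.wedgeB h p p' ψ η} : Set (T.DC s)) := by
  have h' : S.rev s' = s := by rw [← h, S.rev_rev]
  refine P.dense_of_splitMon p _ fun σ hσ => ?_
  obtain ⟨ψ, η, k, m, a, b, -, -, e⟩ := P.exists_of_splitMon h h' p p' hσ
  exact Submodule.subset_span ⟨ψ, η, Subtype.ext e.symm⟩

instance hasProj_bi (a b : ZMod 2) : (P.bi h p p' a b).HasOrthogonalProjection := by
  have : CompleteSpace (P.bi h p p' a b) :=
    (P.isClosed_bi h p p' a b).completeSpace_coe
  infer_instance

theorem starProj_bi {a b : ZMod 2} (q : ZMod 2 × ZMod 2) {σ : T.DC s}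
    (hσ : σ ∈ P.bi h p p' a b) :
    (P.bi h p p' q.1 q.2).starProjection σ = if q = (a, b) then σ else 0 := by
  split_ifs with hq
  · subst hq
    exact Submodule.starProjection_eq_self_iff.2 hσ
  · rw [Submodule.starProjection_apply_eq_zero_iff, Submodule.mem_orthogonal]
    exact fun τ hτ => P.inner_bi h p p' hq hτ hσ

/-- Every element is the sum of its projections to the components of the bigrading. -/
theorem sum_starProj (σ : T.DC s) :
    ∑ q : ZMod 2 × ZMod 2, (P.bi h p p' q.1 q.2).starProjection σ = σ := by
  have h1 : ∀ {a b : ZMod 2} {τ : T.DC s}, τ ∈ P.bi h p p' a b →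
      ∑ q : ZMod 2 × ZMod 2, (P.bi h p p' q.1 q.2).starProjection τ = τ := by
    intro a b τ hτ
    simp only [P.starProj_bi h p p' _ hτ]
    simp
  let N : Submodule ℂ (T.DC s) := LinearMap.ker
    ((∑ q : ZMod 2 × ZMod 2, (P.bi h p p' q.1 q.2).starProjection) -
      ContinuousLinearMap.id ℂ (T.DC s) : T.DC s →L[ℂ] T.DC s).toLinearMap
  have hN : ∀ τ, τ ∈ N ↔ ∑ q : ZMod 2 × ZMod 2, (P.bi h p p' q.1 q.2).starProjection τ = τ := by
    intro τ
    simp [N, sub_eq_zero]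
  have hc : IsClosed (N : Set (T.DC s)) := ContinuousLinearMap.isClosed_ker _
  have h2 : (N : Set (T.DC s)) = Set.univ := by
    refine Set.eq_univ_of_univ_subset ?_
    rw [← (P.dense_wedgeB h p p').closure_eq]
    refine closure_minimal ?_ hc
    change (Submodule.span ℂ _ : Submodule ℂ (T.DC s)) ≤ N
    rw [Submodule.span_le]
    rintro _ ⟨ψ, η, rfl⟩
    obtain ⟨ψ₀, ψ₁, hψ₀, hψ₁, rfl⟩ := P.exists_par p ψ
    obtain ⟨η₀, η₁, hη₀, hη₁, rfl⟩ := P.exists_par p' η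
    simp only [map_add, LinearMap.add_apply]
    refine N.add_mem (N.add_mem ?_ ?_) (N.add_mem ?_ ?_) <;> rw [hN]
    · exact h1 (P.wedgeB_mem_bi h p p' hψ₀ hη₀)
    · exact h1 (P.wedgeB_mem_bi h p p' hψ₁ hη₀)
    · exact h1 (P.wedgeB_mem_bi h p p' hψ₀ hη₁)
    · exact h1 (P.wedgeB_mem_bi h p p' hψ₁ hη₁)
  exact (hN σ).1 (h2 ▸ Set.mem_univ σ : σ ∈ (N : Set (T.DC s)))

theorem internal_bi : DirectSum.IsInternal fun q : ZMod 2 × ZMod 2 => P.bi h p p' q.1 q.2 := by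
  rw [DirectSum.isInternal_submodule_iff_iSupIndep_and_iSup_eq_top]
  constructor
  · have : OrthogonalFamily ℂ (fun q : ZMod 2 × ZMod 2 => P.bi h p p' q.1 q.2)
        fun q => (P.bi h p p' q.1 q.2).subtypeₗᵢ :=
      fun q q' hq σ τ => P.inner_bi h p p' hq σ.2 τ.2
    exact this.independent
  · rw [eq_top_iff]
    intro σ _
    rw [← P.sum_starProj h p p' σ]
    exact Submodule.sum_mem _ fun q _ => Submodule.mem_iSup_of_mem q
      (Submodule.starProjection_apply_mem _ σ)

theorem bi_le_fpar (a b : ZMod 2) : P.bi h p p' a b ≤ Fock.fpar (a + b) :=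
  P.bi_le h p p' (isClosed_fpar _) fun ψ η hψ hη =>
    IsPar.wedge (σ := ψ.1.fn) (τ := (T.flipD ℂ h η.1).fn) hψ (flipD_mem_fpar h hη)

theorem sum_four (f : ZMod 2 × ZMod 2 → T.DC s) :
    ∑ q, f q = (f (0, 0) + f (1, 1)) + (f (0, 1) + f (1, 0)) := by
  rw [Fintype.sum_prod_type]
  have : ∀ g : ZMod 2 → T.DC s, ∑ a, g a = g 0 + g 1 := Fin.sum_univ_two
  simp only [this]
  abel

theorem bi_even : P.bi h p p' 0 0 ⊔ P.bi h p p' 1 1 = Fock.fpar 0 := by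
  refine le_antisymm (sup_le (P.bi_le_fpar h p p' 0 0) (P.bi_le_fpar h p p' 1 1)) fun σ hσ => ?_
  have h1 := P.sum_starProj h p p' σ
  rw [sum_four] at h1
  set f := fun q : ZMod 2 × ZMod 2 => (P.bi h p p' q.1 q.2).starProjection σ with hf
  have hm : ∀ q, f q ∈ P.bi h p p' q.1 q.2 := fun q => Submodule.starProjection_apply_mem _ σ
  have hm' : ∀ q, f q ∈ Fock.fpar (𝕜 := ℂ) (q.1 + q.2) := fun q => P.bi_le_fpar h p p' _ _ (hm q)
  change f (0, 0) + f (1, 1) + (f (0, 1) + f (1, 0)) = σ at h1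
  have h0 : f (0, 1) + f (1, 0) = 0 := by
    refine fpar_inter ?_ (Submodule.add_mem _ (hm' (0, 1)) (hm' (1, 0)))
    rw [eq_sub_iff_add_eq'.2 h1]
    exact Submodule.sub_mem _ hσ (Submodule.add_mem _ (hm' (0, 0)) (hm' (1, 1)))
  rw [h0, add_zero] at h1
  rw [← h1]
  exact Submodule.add_mem_sup (hm (0, 0)) (hm (1, 1))

theorem bi_odd : P.bi h p p' 0 1 ⊔ P.bi h p p' 1 0 = Fock.fpar 1 := by
  refine le_antisymm (sup_le (P.bi_le_fpar h p p' 0 1) (P.bi_le_fpar h p p' 1 0)) fun σ hσ => ?_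
  have h1 := P.sum_starProj h p p' σ
  rw [sum_four] at h1
  set f := fun q : ZMod 2 × ZMod 2 => (P.bi h p p' q.1 q.2).starProjection σ with hf
  have hm : ∀ q, f q ∈ P.bi h p p' q.1 q.2 := fun q => Submodule.starProjection_apply_mem _ σ
  have hm' : ∀ q, f q ∈ Fock.fpar (𝕜 := ℂ) (q.1 + q.2) := fun q => P.bi_le_fpar h p p' _ _ (hm q)
  change f (0, 0) + f (1, 1) + (f (0, 1) + f (1, 0)) = σ at h1
  have h0 : f (0, 0) + f (1, 1) = 0 := by
    refine fpar_inter (Submodule.add_mem _ (hm' (0, 0)) (hm' (1, 1))) ?_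
    rw [eq_sub_iff_add_eq.2 h1]
    exact Submodule.sub_mem _ hσ (Submodule.add_mem _ (hm' (0, 1)) (hm' (1, 0)))
  rw [h0, zero_add] at h1
  rw [← h1]
  exact Submodule.add_mem_sup (hm (0, 1)) (hm (1, 0))

theorem fundF_mem_bi (a b : ZMod 2) {σ : T.DC s} (hσ : σ ∈ P.bi h p p' a b) :
    Fock.fundF σ ∈ P.bi h p p' a b := by
  have : P.bi h p p' a b ≤ (P.bi h p p' a b).comap
      (Fock.fundF (𝕜 := ℂ) (V := T.L s)).toLinearMap := by
    refine P.bi_le h p p' ((P.isClosed_bi h p p' a b).preimage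
      (Fock.fundF (𝕜 := ℂ) (V := T.L s)).continuous) fun ψ η hψ hη => ?_
    change Fock.fundF (P.wedgeB h p p' ψ η) ∈ P.bi h p p' a b
    rw [P.fundF_wedgeB h p p' ψ hη]
    exact Submodule.smul_mem _ _ (P.wedgeB_mem_bi h p p' (fundF_mem_fpar hψ) (fundF_mem_fpar hη))
  exact this hσ

theorem conj_mem_fpar {V : Type u₁} [NormedAddCommGroup V] [InnerProductSpace ℝ V]
    [CompleteSpace V] {a : ZMod 2} {σ : Fock ℂ V} (hσ : σ ∈ Fock.fpar (𝕜 := ℂ) a) :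
    Fock.conj σ ∈ Fock.fpar (𝕜 := ℂ) a :=
  fun n hn x => (congrArg (starRingEnd ℂ) (hσ n hn x)).trans (map_zero _)

theorem iota_mem_fpar {a : ZMod 2} {ψ : P.H p} (hψ : ψ.1 ∈ Fock.fpar a) :
    (P.iota h p p' ψ).1 ∈ Fock.fpar a := by
  have h' : S.rev s' = s := by rw [← h, S.rev_rev]
  rw [P.iota_coe h h']
  exact conj_mem_fpar (flipD_mem_fpar h' hψ)

theorem conj_mem_bi (a b : ZMod 2) {σ : T.DC s} (hσ : σ ∈ P.bi h p p' a b) :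
    Fock.conj σ ∈ P.bi h p p' b a := by
  have h' : S.rev s' = s := by rw [← h, S.rev_rev]
  have : P.bi h p p' a b ≤ (P.bi h p p' b a).comap (conjL (V := T.L s)) := by
    refine P.bi_le h p p' ((P.isClosed_bi h p p' b a).preimage continuous_conj)
      fun ψ η hψ hη => ?_
    change Fock.conj (P.wedgeB h p p' ψ η) ∈ P.bi h p p' b a
    rw [P.conj_wedgeB h h' p p' a b ψ η hψ hη]
    exact Submodule.smul_mem _ _ (P.wedgeB_mem_bi h p p' (P.iota_mem_fpar h' p' p hη)
      (P.iota_mem_fpar h p p' hψ))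
  exact this hσ

/-- Complex conjugation preserves the components of bidegrees `(0, 0)` and `(1, 1)`, so the
components of a real element are real. -/
theorem real_even_bi {σ : T.DR s} (hσ : σ ∈ Fock.fpar (𝕜 := ℝ) 0) : ∃ σ₀ σ₁ : T.DR s,
    Fock.cplx σ₀ ∈ P.bi h p p' 0 0 ∧ Fock.cplx σ₁ ∈ P.bi h p p' 1 1 ∧ σ = σ₀ + σ₁ := by
  have h1 : Fock.cplx σ ∈ P.bi h p p' 0 0 ⊔ P.bi h p p' 1 1 := by
    rw [P.bi_even]
    exact fun n hn x => by
      rw [FermionicTheory.cplx_fn]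
      change ((σ.fn n x : ℝ) : ℂ) = 0
      rw [hσ n hn x, Complex.ofReal_zero]
  obtain ⟨τ₀, h0, τ₁, h1, e⟩ := Submodule.mem_sup.1 h1
  have e' : Fock.conj τ₀ - τ₀ = τ₁ - Fock.conj τ₁ := by
    have : Fock.conj τ₀ + Fock.conj τ₁ = τ₀ + τ₁ := by
      rw [e]
      refine (map_add conjL τ₀ τ₁).symm.trans ?_
      rw [e]
      exact conj_cplx σ
    rw [sub_eq_sub_iff_add_eq_add, this, add_comm]
  -- This difference lies in two orthogonal components.
  have hz : Fock.conj τ₀ - τ₀ = 0 := by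
    rw [← inner_self_eq_zero (𝕜 := ℂ)]
    conv_lhs => rw [e']
    rw [← e']
    conv_lhs => arg 2; rw [e']
    exact P.inner_bi h p p' (a := 1) (b := 1) (a' := 0) (b' := 0) (by decide)
      (Submodule.sub_mem _ h1 (P.conj_mem_bi h p p' 1 1 h1))
      (Submodule.sub_mem _ (P.conj_mem_bi h p p' 0 0 h0) h0)
  obtain ⟨σ₀, r0⟩ := exists_cplx (sub_eq_zero.1 hz)
  obtain ⟨σ₁, r1⟩ := exists_cplx (sub_eq_zero.1 (e'.symm.trans hz)).symm
  refine ⟨σ₀, σ₁, by rwa [r0], by rwa [r1], cplx_inj ?_⟩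
  rw [← e, ← r0, ← r1]
  exact (map_add cplxL σ₀ σ₁).symm

end Polarization

/-! ### The cone of positive elements -/

namespace Polarization

variable {S : SpacetimeSystem.{u, v, w}} {T : FermionicTheory.{u, v, w, u₁, u₂} S}
  (P : Polarization T) {s s' : S.Hyp} (h : S.rev s = s') (p : s ∈ P.Pol) (p' : s' ∈ P.Pol)

/-- The product of a holomorphic element and its complex conjugate. -/
def rankOne (ξ : P.H p) : T.DC s := P.wedgeB h p p' ξ (P.iota h p p' ξ)

/-- The matrix elements of an element of the Fock space, regarded as an operator on the
holomorphic elements. -/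
def form (σ : T.DC s) (ζ ξ : P.H p) : ℂ := inner ℂ (P.wedgeB h p p' ζ (P.iota h p p' ξ)) σ

/-- The elements of bidegree `(0, 0)` which are positive as operators on the holomorphic
elements. -/
def posC : Set (T.DC s) :=
  {σ | σ ∈ P.bi h p p' 0 0 ∧ ∀ ξ : P.H p, 0 ≤ (P.form h p p' σ ξ ξ).re ∧
    (P.form h p p' σ ξ ξ).im = 0}

theorem mem_posD (σ : T.DR s) :
    σ ∈ P.posD h (P.identU h p p') ↔ Fock.cplx σ ∈ P.posC h p p' := by
  have h1 : ∀ ζ ξ, P.opForm h ((P.identU h p p').symm (Fock.cplx σ)) ζ ξ =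
      P.form h p p' (Fock.cplx σ) ζ ξ := by
    intro ζ ξ
    rw [opForm, form, ← P.identU_ctmul, ← LinearIsometryEquiv.inner_map_map (P.identU h p p'),
      LinearIsometryEquiv.apply_symm_apply]
  have h2 : (P.identU h p p').symm (Fock.cplx σ) ∈ P.bigr p p' 0 0 ↔
      Fock.cplx σ ∈ P.bi h p p' 0 0 := by
    constructor
    · intro hm
      exact ⟨_, hm, LinearIsometryEquiv.apply_symm_apply _ _⟩
    · rintro ⟨x, hx, e⟩
      rw [← e]
      change (P.identU h p p').symm (P.identU h p p' x) ∈ _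
      rwa [LinearIsometryEquiv.symm_apply_apply]
  change (_ ∧ _) ↔ (_ ∧ _)
  rw [h2]
  simp only [h1]

theorem form_add (σ τ : T.DC s) (ζ ξ : P.H p) :
    P.form h p p' (σ + τ) ζ ξ = P.form h p p' σ ζ ξ + P.form h p p' τ ζ ξ := inner_add_right _ _ _

theorem form_smul (c : ℂ) (σ : T.DC s) (ζ ξ : P.H p) :
    P.form h p p' (c • σ) ζ ξ = c * P.form h p p' σ ζ ξ := inner_smul_right _ _ _

theorem form_add_left (σ : T.DC s) (ζ ζ' ξ : P.H p) :
    P.form h p p' σ (ζ + ζ') ξ = P.form h p p' σ ζ ξ + P.form h p p' σ ζ' ξ := by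
  rw [form, map_add, LinearMap.add_apply, inner_add_left]
  rfl

theorem form_add_right (σ : T.DC s) (ζ ξ ξ' : P.H p) :
    P.form h p p' σ ζ (ξ + ξ') = P.form h p p' σ ζ ξ + P.form h p p' σ ζ ξ' := by
  rw [form, map_add, map_add, inner_add_left]
  rfl

theorem form_smul_left (c : ℂ) (σ : T.DC s) (ζ ξ : P.H p) :
    P.form h p p' σ (c • ζ) ξ = (starRingEnd ℂ) c * P.form h p p' σ ζ ξ := by
  rw [form, map_smul, LinearMap.smul_apply, inner_smul_left]
  rfl

theorem form_smul_right (c : ℂ) (σ : T.DC s) (ζ ξ : P.H p) :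
    P.form h p p' σ ζ (c • ξ) = c * P.form h p p' σ ζ ξ := by
  rw [form, LinearMap.map_smulₛₗ, map_smul, inner_smul_left, Complex.conj_conj]
  rfl

theorem posC_zero : (0 : T.DC s) ∈ P.posC h p p' :=
  ⟨Submodule.zero_mem _, fun ξ => by simp [form]⟩

theorem posC_add {σ τ : T.DC s} (hσ : σ ∈ P.posC h p p') (hτ : τ ∈ P.posC h p p') :
    σ + τ ∈ P.posC h p p' := by
  refine ⟨Submodule.add_mem _ hσ.1 hτ.1, fun ξ => ?_⟩
  rw [form_add, Complex.add_re, Complex.add_im, (hσ.2 ξ).2, (hτ.2 ξ).2, add_zero]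
  exact ⟨add_nonneg (hσ.2 ξ).1 (hτ.2 ξ).1, rfl⟩

theorem posC_smul {c : ℝ} (hc : 0 ≤ c) {σ : T.DC s} (hσ : σ ∈ P.posC h p p') :
    (c : ℂ) • σ ∈ P.posC h p p' := by
  refine ⟨Submodule.smul_mem _ _ hσ.1, fun ξ => ?_⟩
  rw [form_smul, Complex.re_ofReal_mul, Complex.im_ofReal_mul, (hσ.2 ξ).2, mul_zero]
  exact ⟨mul_nonneg hc (hσ.2 ξ).1, rfl⟩

theorem isClosed_posC : IsClosed (P.posC h p p') := by
  have hf : ∀ ξ : P.H p, Continuous fun σ : T.DC s => P.form h p p' σ ξ ξ := fun ξ =>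
    continuous_const.inner continuous_id
  have : P.posC h p p' = (P.bi h p p' 0 0 : Set (T.DC s)) ∩ ⋂ ξ : P.H p,
      {σ | 0 ≤ (P.form h p p' σ ξ ξ).re} ∩ {σ | (P.form h p p' σ ξ ξ).im = 0} := by
    ext σ
    simp [posC]
  rw [this]
  exact (P.isClosed_bi h p p' 0 0).inter (isClosed_iInter fun ξ =>
    (isClosed_le continuous_const (Complex.continuous_re.comp (hf ξ))).inter
      (isClosed_eq (Complex.continuous_im.comp (hf ξ)) continuous_const))

theorem form_rankOne (ξ ζ : P.H p) : P.form h p p' (P.rankOne h p p' ξ) ζ ζ =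
    ((‖inner ℂ ζ ξ‖ ^ 2 : ℝ) : ℂ) := by
  rw [form, rankOne, inner_map_of_norm_map _ (P.norm_wedgeB h p p'), P.inner_iota,
    ← inner_conj_symm ξ ζ, Complex.mul_conj, Complex.normSq_eq_norm_sq]

theorem rankOne_mem_posC {ξ : P.H p} (hξ : ξ.1 ∈ Fock.fpar 0) :
    P.rankOne h p p' ξ ∈ P.posC h p p' := by
  refine ⟨P.wedgeB_mem_bi h p p' hξ (P.iota_mem_fpar h p p' hξ), fun ζ => ?_⟩
  rw [form_rankOne, Complex.ofReal_re, Complex.ofReal_im]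
  exact ⟨by positivity, rfl⟩

theorem conj_wedgeB_iota {ζ ξ : P.H p} (hζ : ζ.1 ∈ Fock.fpar 0) (hξ : ξ.1 ∈ Fock.fpar 0) :
    Fock.conj (P.wedgeB h p p' ζ (P.iota h p p' ξ)) = P.wedgeB h p p' ξ (P.iota h p p' ζ) := by
  have h' : S.rev s' = s := by rw [← h, S.rev_rev]
  rw [P.conj_wedgeB h h' p p' 0 0 _ _ hζ (P.iota_mem_fpar h p p' hξ), P.iota_iota]
  simp [fsgn]

theorem form_conj {σ : T.DC s} (hσ : Fock.conj σ = σ) {ζ ξ : P.H p} (hζ : ζ.1 ∈ Fock.fpar 0)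
    (hξ : ξ.1 ∈ Fock.fpar 0) :
    (starRingEnd ℂ) (P.form h p p' σ ζ ξ) = P.form h p p' σ ξ ζ := by
  rw [form, form, inner_conj_symm, ← Fock.inner_conj, hσ, P.conj_wedgeB_iota h p p' hζ hξ]

/-- The matrix elements of an element of bidegree `(0, 0)` depend on the even parts of the vectors
only. -/
theorem form_even {σ : T.DC s} (hσ : σ ∈ P.bi h p p' 0 0) (ξ : P.H p) :
    ∃ ξ₀ : P.H p, ξ₀.1 ∈ Fock.fpar 0 ∧ P.form h p p' σ ξ ξ = P.form h p p' σ ξ₀ ξ₀ := by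
  obtain ⟨ξ₀, ξ₁, h0, h1, rfl⟩ := P.exists_par p ξ
  refine ⟨ξ₀, h0, ?_⟩
  have e : ∀ {a b : ZMod 2} {ζ ξ : P.H p}, ζ.1 ∈ Fock.fpar a → ξ.1 ∈ Fock.fpar b →
      (a, b) ≠ (0, 0) → P.form h p p' σ ζ ξ = 0 := fun ha hb hab =>
    P.inner_bi h p p' hab (P.wedgeB_mem_bi h p p' ha (P.iota_mem_fpar h p p' hb)) hσ
  rw [form_add_left, form_add_right, form_add_right, e h0 h1 (by decide), e h1 h0 (by decide),
    e h1 h1 (by decide), add_zero, add_zero, add_zero]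

theorem form_real {σ : T.DC s} (hσ : σ ∈ P.bi h p p' 0 0) (hc : Fock.conj σ = σ) (ξ : P.H p) :
    (P.form h p p' σ ξ ξ).im = 0 := by
  obtain ⟨ξ₀, h0, e⟩ := P.form_even h p p' hσ ξ
  rw [e, ← Complex.conj_eq_iff_im]
  exact P.form_conj h p p' hc h0 h0

/-- The finite sums of products of even holomorphic elements and their complex conjugates. -/
def rankSums : Set (T.DC s) :=
  {σ | ∃ (m : ℕ) (ξ : Fin m → P.H p), (∀ k, (ξ k).1 ∈ Fock.fpar 0) ∧
    σ = ∑ k, P.rankOne h p p' (ξ k)}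

open scoped ComplexOrder in
/-- Real positive elements are limits of finite sums of rank one elements. Such sums are
obtained by compression to finite-dimensional subspaces, where a positive matrix is a sum of
matrices of rank one. -/
theorem mem_closure_rankSums {σ : T.DC s} (hσ : σ ∈ P.posC h p p') (hc : Fock.conj σ = σ) :
    σ ∈ closure (P.rankSums h p p') := by
  have h' : S.rev s' = s := by rw [← h, S.rev_rev]
  rw [Metric.mem_closure_iff]
  intro ε hε
  have h1 := hσ.1
  rw [bi_eq, ← SetLike.mem_coe, Submodule.topologicalClosure_coe, Metric.mem_closure_iff] at h1
  obtain ⟨z, hz, hd⟩ := h1 ε hε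
  obtain ⟨m, f, g, rfl⟩ := (Submodule.mem_span_set').1 hz
  choose ψ η hψ hη e using fun k => (g k).2
  -- The finite-dimensional space of even elements to which `σ` is compressed.
  let E : Submodule ℂ (P.H p) :=
    Submodule.span ℂ (Set.range ψ ∪ Set.range fun k => P.iota h' p' p (η k))
  have hE : E ≤ (Fock.fpar (𝕜 := ℂ) 0).comap (P.H p).subtype := by
    rw [Submodule.span_le]
    rintro _ (⟨k, rfl⟩ | ⟨k, rfl⟩)
    · exact hψ k
    · exact P.iota_mem_fpar h' p' p (hη k)
  have : FiniteDimensional ℂ E :=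
    FiniteDimensional.span_of_finite ℂ ((Set.finite_range _).union (Set.finite_range _))
  let b := stdOrthonormalBasis ℂ E
  let x : Fin (Module.finrank ℂ E) → P.H p := fun i => (b i : P.H p)
  have hx : ∀ i, (x i).1 ∈ Fock.fpar (𝕜 := ℂ) 0 := fun i => hE (b i).2
  have hxx : ∀ i j, inner ℂ (x i) (x j) = if i = j then (1 : ℂ) else 0 :=
    fun i j => (orthonormal_iff_ite.1 b.orthonormal) i j
  have hrep : ∀ ζ ∈ E, ∃ c : Fin (Module.finrank ℂ E) → ℂ, ζ = ∑ i, c i • x i := by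
    intro ζ hζ
    refine ⟨fun i => inner ℂ (b i) ⟨ζ, hζ⟩, ?_⟩
    have := congrArg Subtype.val (b.sum_repr' ⟨ζ, hζ⟩)
    rw [Submodule.coe_sum] at this
    exact this.symm
  let W : Fin (Module.finrank ℂ E) → Fin (Module.finrank ℂ E) → T.DC s := fun i j =>
    P.wedgeB h p p' (x i) (P.iota h p p' (x j))
  have hW : ∀ i j k l, inner ℂ (W i j) (W k l) = if k = i ∧ l = j then (1 : ℂ) else 0 := by
    intro i j k l
    rw [inner_map_of_norm_map _ (P.norm_wedgeB h p p'), P.inner_iota, hxx, hxx]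
    by_cases hi : i = k <;> by_cases hj : l = j <;> simp [hi, hj, eq_comm]
  let Y : Matrix (Fin (Module.finrank ℂ E)) (Fin (Module.finrank ℂ E)) ℂ :=
    Matrix.of fun i j => P.form h p p' σ (x i) (x j)
  have hY : Y.PosSemidef := by
    refine Matrix.PosSemidef.of_dotProduct_mulVec_nonneg ?_ fun c => ?_
    · ext i j
      exact P.form_conj h p p' hc (hx j) (hx i)
    · have h2 := hσ.2 (∑ i, c i • x i)
      have h3 : P.form h p p' σ (∑ i, c i • x i) (∑ i, c i • x i) =
          star c ⬝ᵥ Y.mulVec c := by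
        rw [form, map_sum, map_sum, LinearMap.sum_apply, sum_inner]
        simp only [dotProduct, Matrix.mulVec, Pi.star_apply]
        refine Finset.sum_congr rfl fun i _ => ?_
        rw [map_sum, sum_inner, Finset.mul_sum]
        refine Finset.sum_congr rfl fun j _ => ?_
        change P.form h p p' σ (c i • x i) (c j • x j) = _
        rw [form_smul_left, form_smul_right]
        change _ = star (c i) * (P.form h p p' σ (x i) (x j) * c j)
        rw [mul_comm (c j)]
        rfl
      rw [← h3, Complex.nonneg_iff]
      exact ⟨h2.1, h2.2.symm⟩
  let y : T.DC s := ∑ i, ∑ j, Y i j • W i j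
  -- The compression is the best approximation of `σ` in the span of the elements `W i j`.
  let G : Submodule ℂ (T.DC s) := Submodule.span ℂ (Set.range fun q : _ × _ => W q.1 q.2)
  have hWG : ∀ i j, W i j ∈ G := fun i j => Submodule.subset_span ⟨(i, j), rfl⟩
  have hyG : y ∈ G := Submodule.sum_mem _ fun i _ => Submodule.sum_mem _ fun j _ =>
    G.smul_mem _ (hWG i j)
  have hzG : ∑ k, f k • (g k : T.DC s) ∈ G := by
    refine Submodule.sum_mem _ fun k _ => G.smul_mem _ ?_
    obtain ⟨c, hc1⟩ := hrep (ψ k) (Submodule.subset_span (Or.inl ⟨k, rfl⟩))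
    obtain ⟨c', hc2⟩ := hrep (P.iota h' p' p (η k)) (Submodule.subset_span (Or.inr ⟨k, rfl⟩))
    have hη' : η k = ∑ j, (starRingEnd ℂ) (c' j) • P.iota h p p' (x j) := by
      rw [← P.iota_iota h' h p' p (η k), hc2, map_sum]
      exact Finset.sum_congr rfl fun j _ => LinearMap.map_smulₛₗ _ _ _
    rw [e k, hη', map_sum]
    refine Submodule.sum_mem _ fun j _ => ?_
    rw [map_smul, hc1, map_sum, LinearMap.sum_apply]
    refine G.smul_mem _ (Submodule.sum_mem _ fun i _ => ?_)
    rw [map_smul, LinearMap.smul_apply]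
    exact G.smul_mem _ (hWG i j)
  have horth : ∀ τ ∈ G, inner ℂ τ (σ - y) = 0 := by
    intro τ hτ
    have : G ≤ (Submodule.span ℂ {σ - y})ᗮ := by
      rw [Submodule.span_le]
      rintro _ ⟨⟨i, j⟩, rfl⟩
      rw [SetLike.mem_coe, Submodule.mem_orthogonal_singleton_iff_inner_left, inner_sub_right,
        inner_sum, Finset.sum_eq_single i, inner_sum, Finset.sum_eq_single j, inner_smul_right,
        hW, if_pos ⟨rfl, rfl⟩, mul_one]
      · exact sub_self _
      · intro l _ hl
        rw [inner_smul_right, hW, if_neg (fun hh => hl hh.2), mul_zero]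
      · simp
      · intro k _ hk
        rw [inner_sum]
        refine Finset.sum_eq_zero fun l _ => ?_
        rw [inner_smul_right, hW, if_neg (fun hh => hk hh.1), mul_zero]
      · simp
    exact Submodule.mem_orthogonal_singleton_iff_inner_left.1 (this hτ)
  refine ⟨y, ?_, lt_of_le_of_lt ?_ hd⟩
  · obtain ⟨r, V, hV⟩ := Matrix.posSemidef_iff_eq_sum_vecMulVec.1 hY
    refine ⟨r, fun k => ∑ i, V k i • x i, fun k => ?_, ?_⟩
    · exact hE (E.sum_mem fun i _ => E.smul_mem _ (b i).2)
    · have hk : ∀ k, P.rankOne h p p' (∑ i, V k i • x i) =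
          ∑ i, ∑ j, (V k i * star (V k j)) • W i j := by
        intro k
        rw [rankOne, map_sum, map_sum, LinearMap.sum_apply]
        refine Finset.sum_congr rfl fun i _ => ?_
        rw [map_sum]
        refine Finset.sum_congr rfl fun j _ => ?_
        have e1 : P.iota h p p' (V k j • x j) = star (V k j) • P.iota h p p' (x j) :=
          LinearMap.map_smulₛₗ _ _ _
        rw [e1, map_smul, map_smul, LinearMap.smul_apply, smul_smul, mul_comm]
      simp only [hk]
      rw [Finset.sum_comm]
      refine Finset.sum_congr rfl fun i _ => ?_
      rw [Finset.sum_comm]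
      refine Finset.sum_congr rfl fun j _ => ?_
      rw [← Finset.sum_smul, hV, Matrix.sum_apply]
      rfl
  · rw [dist_eq_norm, dist_eq_norm]
    set z := ∑ k, f k • (g k : T.DC s)
    have h3 := norm_add_sq_eq_norm_sq_add_norm_sq_of_inner_eq_zero (𝕜 := ℂ) (y - z) (σ - y)
      (horth _ (G.sub_mem hyG hzG))
    rw [show y - z + (σ - y) = σ - z by abel] at h3
    nlinarith [norm_nonneg (σ - y), norm_nonneg (σ - z), mul_self_nonneg ‖y - z‖]

/-- An inequality for a continuous functional holds on real positive elements if it holds on the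
elements of rank one. -/
theorem posC_induction {f : T.DC s → ℝ} (hf : Continuous f) (h0 : f 0 = 0)
    (hadd : ∀ σ τ, f (σ + τ) = f σ + f τ)
    (h1 : ∀ ξ : P.H p, ξ.1 ∈ Fock.fpar 0 → 0 ≤ f (P.rankOne h p p' ξ)) {σ : T.DC s}
    (hσ : σ ∈ P.posC h p p') (hc : Fock.conj σ = σ) : 0 ≤ f σ := by
  have hcl : IsClosed {τ | 0 ≤ f τ} := isClosed_le continuous_const hf
  refine closure_minimal ?_ hcl (P.mem_closure_rankSums h p p' hσ hc)
  rintro _ ⟨m, ξ, hξ, rfl⟩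
  exact Finset.sum_induction _ (fun τ => 0 ≤ f τ)
    (fun σ τ hσ hτ => (hadd σ τ).symm ▸ add_nonneg hσ hτ) h0.ge fun k _ => h1 _ (hξ k)

end Polarization

section Cplx

variable {V : Type u} [NormedAddCommGroup V] [InnerProductSpace ℝ V] [CompleteSpace V]

theorem cplx_zero : Fock.cplx (0 : Fock ℝ V) = 0 := map_zero (cplxL (V := V))

theorem cplx_add (σ τ : Fock ℝ V) : Fock.cplx (σ + τ) = Fock.cplx σ + Fock.cplx τ :=
  map_add (cplxL (V := V)) σ τ

theorem cplx_neg (σ : Fock ℝ V) : Fock.cplx (-σ) = -Fock.cplx σ := map_neg (cplxL (V := V)) σ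

theorem cplx_sub (σ τ : Fock ℝ V) : Fock.cplx (σ - τ) = Fock.cplx σ - Fock.cplx τ :=
  map_sub (cplxL (V := V)) σ τ

theorem cplx_smul (c : ℝ) (σ : Fock ℝ V) : Fock.cplx (c • σ) = (c : ℂ) • Fock.cplx σ :=
  (map_smul (cplxL (V := V)) c σ).trans (Complex.coe_smul _ _).symm

end Cplx

namespace Polarization

variable {S : SpacetimeSystem.{u, v, w}} {T : FermionicTheory.{u, v, w, u₁, u₂} S}
  (P : Polarization T) {s s' : S.Hyp} (h : S.rev s = s') (p : s ∈ P.Pol) (p' : s' ∈ P.Pol)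

theorem isClosed_posD : IsClosed (P.posD h (P.identU h p p')) := by
  have : P.posD h (P.identU h p p') = Fock.cplx ⁻¹' P.posC h p p' :=
    Set.ext fun σ => P.mem_posD h p p' σ
  rw [this]
  exact (P.isClosed_posC h p p').preimage continuous_cplx

theorem add_mem_posD {σ τ : T.DR s} (hσ : σ ∈ P.posD h (P.identU h p p'))
    (hτ : τ ∈ P.posD h (P.identU h p p')) : σ + τ ∈ P.posD h (P.identU h p p') := by
  rw [mem_posD] at *
  rw [cplx_add]
  exact P.posC_add h p p' hσ hτ

theorem smul_mem_posD {c : ℝ} (hc : 0 ≤ c) {σ : T.DR s}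
    (hσ : σ ∈ P.posD h (P.identU h p p')) : c • σ ∈ P.posD h (P.identU h p p') := by
  rw [mem_posD] at *
  rw [cplx_smul]
  exact P.posC_smul h p p' hc hσ

/-- A real element is positive if it is positive on even elements; that its matrix elements are
real is automatic. -/
theorem mem_posD_of_even {σ : T.DR s} (hσ : Fock.cplx σ ∈ P.bi h p p' 0 0)
    (hp : ∀ ξ : P.H p, ξ.1 ∈ Fock.fpar 0 → 0 ≤ (P.form h p p' (Fock.cplx σ) ξ ξ).re) :
    σ ∈ P.posD h (P.identU h p p') := by
  rw [mem_posD]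
  refine ⟨hσ, fun ξ => ⟨?_, P.form_real h p p' hσ (conj_cplx σ) ξ⟩⟩
  obtain ⟨ξ₀, h0, e⟩ := P.form_even h p p' hσ ξ
  rw [e]
  exact hp ξ₀ h0

/-- Positive elements have non-negative inner products, by reduction to elements of rank one. -/
theorem inner_nonneg_posD {σ τ : T.DR s} (hσ : σ ∈ P.posD h (P.identU h p p'))
    (hτ : τ ∈ P.posD h (P.identU h p p')) : 0 ≤ inner ℝ σ τ := by
  rw [mem_posD] at *
  have h1 := P.posC_induction h p p' (f := fun ρ => (inner ℂ ρ (Fock.cplx τ)).re)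
    (Complex.continuous_re.comp (continuous_id.inner continuous_const)) (by simp)
    (fun ρ ρ' => by rw [inner_add_left, Complex.add_re]) (fun ξ _ => (hτ.2 ξ).1) hσ (conj_cplx σ)
  rwa [inner_cplx, Complex.ofReal_re] at h1

/-- The cone of positive elements is self-dual, so the projection of an element to the cone
differs from it by a positive element. -/
theorem generating_posD {σ : T.DR s} (hσ : Fock.cplx σ ∈ P.bi h p p' 0 0) :
    ∃ σ₁ ∈ P.posD h (P.identU h p p'), ∃ σ₂ ∈ P.posD h (P.identU h p p'), σ = σ₁ - σ₂ := by
  have hconv : Convex ℝ (P.posD h (P.identU h p p')) := fun x hx y hy a b ha hb _ =>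
    P.add_mem_posD h p p' (P.smul_mem_posD h p p' ha hx) (P.smul_mem_posD h p p' hb hy)
  have h0 : (0 : T.DR s) ∈ P.posD h (P.identU h p p') := by
    rw [mem_posD, cplx_zero]
    exact P.posC_zero h p p'
  -- The minimizer `ρ` satisfies `⟨σ - ρ, κ⟩ ≤ 0` for all positive `κ`, since `ρ + κ` is positive.
  obtain ⟨ρ, hρ, hmin⟩ := exists_norm_eq_iInf_of_complete_convex ⟨_, h0⟩
    (P.isClosed_posD h p p').isComplete hconv σ
  rw [norm_eq_iInf_iff_real_inner_le_zero hconv hρ] at hmin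
  refine ⟨ρ, hρ, ρ - σ, P.mem_posD_of_even h p p' ?_ fun ξ hξ => ?_, by abel⟩
  · rw [cplx_sub]
    exact Submodule.sub_mem _ ((P.mem_posD h p p' ρ).1 hρ).1 hσ
  · obtain ⟨κ, hκ⟩ := exists_cplx (P.conj_wedgeB_iota h p p' hξ hξ)
    have hκm : κ ∈ P.posD h (P.identU h p p') := by
      rw [mem_posD, hκ]
      exact P.rankOne_mem_posC h p p' hξ
    have h1 := hmin (ρ + κ) (P.add_mem_posD h p p' hρ hκm)
    rw [add_sub_cancel_left] at h1
    rw [form, ← hκ, inner_cplx, Complex.ofReal_re, real_inner_comm, ← neg_sub, inner_neg_left]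
    linarith

theorem isPositiveStructure :
    IsPositiveStructure (P.bi h p p') (P.posD h (P.identU h p p')) where
  internal := P.internal_bi h p p'
  closed := P.isClosed_bi h p p'
  fund_mem a b _ hσ := P.fundF_mem_bi h p p' a b hσ
  orthogonal a b a' b' hab σ hσ τ hτ := P.inner_bi h p p' hab (P.fundF_mem_bi h p p' a b hσ) hτ
  even := P.bi_even h p p'
  odd := P.bi_odd h p p'
  conj_mem a b _ hσ := P.conj_mem_bi h p p' a b hσ
  real_even _ hσ := P.real_even_bi h p p' hσ
  subset σ hσ := ((P.mem_posD h p p' σ).1 hσ).1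
  zero_mem := by
    rw [mem_posD, cplx_zero]
    exact P.posC_zero h p p'
  add_mem _ hσ _ hτ := P.add_mem_posD h p p' hσ hτ
  smul_mem _ hc _ hσ := P.smul_mem_posD h p p' hc hσ
  proper σ h1 h2 := by
    have h3 := P.inner_nonneg_posD h p p' h1 h2
    rw [inner_neg_right, real_inner_self_eq_norm_sq] at h3
    have : ‖σ‖ = 0 := by nlinarith [norm_nonneg σ]
    exact norm_eq_zero.1 this
  generating _ hσ := P.generating_posD h p p' hσ
  archimedean σ τ hσ hτ hn := by
    refine P.mem_posD_of_even h p p' ?_ fun ξ _ => ?_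
    · rw [cplx_neg]
      exact Submodule.neg_mem _ hσ
    · have e : ∀ n : ℕ, 0 ≤ (P.form h p p' (Fock.cplx τ) ξ ξ).re -
          n * (P.form h p p' (Fock.cplx σ) ξ ξ).re := by
        intro n
        have h1 := (((P.mem_posD h p p' _).1 (hn n)).2 ξ).1
        rw [sub_eq_add_neg, ← neg_smul, cplx_add, cplx_smul, form_add, form_smul, Complex.add_re,
          Complex.re_ofReal_mul] at h1
        linarith
      have h4 : P.form h p p' (Fock.cplx (-σ)) ξ ξ = -P.form h p p' (Fock.cplx σ) ξ ξ := by
        rw [cplx_neg, form, inner_neg_right]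
        rfl
      rw [h4, Complex.neg_re]
      by_contra! hlt
      obtain ⟨n, hn'⟩ := exists_nat_gt ((P.form h p p' (Fock.cplx τ) ξ ξ).re /
        (P.form h p p' (Fock.cplx σ) ξ ξ).re)
      rw [div_lt_iff₀ (by linarith)] at hn'
      linarith [e n]
  inner_nonneg σ hσ τ hτ := by
    rw [Fock.krein, fundF_fundF]
    exact P.inner_nonneg_posD h p p' hσ hτ

end Polarization

/-! ### Positivity of the maps for decompositions and of the probability maps -/

/-- On a family of even elements the order of the factors does not matter. -/
theorem wedgeR_eq_wedgeL {V : Type u} [NormedAddCommGroup V] [InnerProductSpace ℝ V]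
    [CompleteSpace V] {m : ℕ}
    {F : Fin m → PreFock ℂ V} (hF : ∀ i, IsAlt (F i)) (hp : ∀ i, IsPar 0 (F i)) :
    wedgeR F = wedgeL F := by
  induction m with
  | zero => rw [wedgeR_zero, wedgeL_zero]
  | succ m ih =>
    rw [wedgeR_succ, wedgeL_succ, ih (fun i => hF i.succ) (fun i => hp i.succ)]
    have h1 := IsPar.wedgeL (a := fun _ => 0) fun i : Fin m => hp i.succ
    rw [Finset.sum_const_zero] at h1
    have h2 := wedge_comm (IsAlt.wedgeL fun i : Fin m => hF i.succ) (hF 0) h1 (hp 0)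
    rw [h2]
    simp

theorem conj_wedgeL {W : Type u} {m : ℕ} (F : Fin m → PreFock ℂ W) :
    (fun n x => (starRingEnd ℂ) (wedgeL F n x)) =
      wedgeL fun i n x => (starRingEnd ℂ) (F i n x) := by
  induction m with
  | zero =>
    rw [wedgeL_zero, wedgeL_zero]
    funext n x
    by_cases hn : n = 0 <;> simp [unitPre, hn]
  | succ m ih => rw [wedgeL_succ, wedgeL_succ, wedge_conj, ih]

namespace Polarization

variable {S : SpacetimeSystem.{u, v, w}} {T : FermionicTheory.{u, v, w, u₁, u₂} S}
  (P : Polarization T)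

section Tau

variable {n : ℕ} {parts : Fin n → S.Hyp} {s : S.Hyp} (d : S.Dec parts s) (p : s ∈ P.Pol)
  (q : ∀ i, parts i ∈ P.Pol)

theorem tauH_mem_fpar {ξ : ∀ i, P.H (q i)} (hξ : ∀ i, (ξ i).1 ∈ Fock.fpar 0) :
    (P.tauH d p q ξ).1 ∈ Fock.fpar (𝕜 := ℂ) 0 := by
  have h1 := IsPar.wedgeL (a := fun _ => 0) (F := fun i => pullPre (gproj (T.glue d) i) (ξ i).1.fn)
    fun i m hm _ => hξ i m hm _
  rw [Finset.sum_const_zero] at h1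
  exact h1

/-- The maps for decompositions preserve the elements of rank one. -/
theorem tau_rankOne {ξ : ∀ i, P.H (q i)} (hξ : ∀ i, (ξ i).1 ∈ Fock.fpar 0) :
    T.tauC d (fun i => P.rankOne rfl (q i) (P.rev_mem _ (q i)) (ξ i)) =
      P.rankOne rfl p (P.rev_mem _ p) (P.tauH d p q ξ) := by
  have h1 := P.tau_wedgeB d p q 0 0 ξ (fun i => P.iota rfl (q i) (P.rev_mem _ (q i)) (ξ i)) hξ
    fun i => P.iota_mem_fpar rfl (q i) (P.rev_mem _ (q i)) (hξ i)
  refine h1.trans ?_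
  rw [Finset.prod_eq_one fun i _ => Finset.prod_eq_one fun j _ => by simp [fsgn], one_smul]
  apply Subtype.ext
  refine congrArg (wedge (P.tauH d p q ξ).1.fn) ?_
  refine (flipD_tau d _).trans ?_
  have e : ∀ i, T.flipD ℂ rfl (P.iota rfl (q i) (P.rev_mem _ (q i)) (ξ i)).1 =
      Fock.conj (ξ i).1 := fun i => P.flipD_iota rfl (S.rev_rev _) _ _ _
  simp only [e]
  rw [P.flipD_iota rfl (S.rev_rev s), wedgeR_eq_wedgeL
    (fun i => (Fock.conj (ξ i).1).isAlt.pull (gproj (T.glue d) i))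
    (fun i m hm _ => conj_mem_fpar (hξ i) m hm _)]
  exact (conj_wedgeL _).symm

/-- The maps for decompositions preserve positivity: by continuity and multilinearity it is enough
to consider elements of rank one. -/
theorem tauR_mem_posD {σ : ∀ i, T.DR (parts i)}
    (hσ : ∀ i, σ i ∈ P.posD rfl (P.identU rfl (q i) (P.rev_mem _ (q i)))) :
    T.tauR d σ ∈ P.posD rfl (P.identU rfl p (P.rev_mem _ p)) := by
  rw [mem_posD, T.cplx_tauR]
  have h1 : (fun i => Fock.cplx (σ i)) ∈
      closure (Set.univ.pi fun i => P.rankSums rfl (q i) (P.rev_mem _ (q i))) := by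
    rw [closure_pi_set]
    intro i _
    exact P.mem_closure_rankSums rfl (q i) _ ((P.mem_posD _ _ _ _).1 (hσ i)) (conj_cplx _)
  have h2 : closure (Set.univ.pi fun i => P.rankSums rfl (q i) (P.rev_mem _ (q i))) ⊆
      T.tauC d ⁻¹' P.posC rfl p (P.rev_mem _ p) := by
    refine closure_minimal ?_ ((P.isClosed_posC rfl p _).preimage (T.tauC d).cont)
    intro τ hτ
    choose m ξ hξ e using fun i => hτ i trivial
    obtain rfl : τ = fun i => ∑ k, P.rankOne rfl (q i) (P.rev_mem _ (q i)) (ξ i k) := funext e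
    change T.tauC d _ ∈ P.posC rfl p (P.rev_mem _ p)
    rw [ContinuousMultilinearMap.map_sum]
    refine Finset.sum_induction _ (fun ρ => ρ ∈ P.posC rfl p (P.rev_mem _ p))
      (fun _ _ => P.posC_add _ _ _) (P.posC_zero _ _ _) fun k _ => ?_
    rw [P.tau_rankOne d p q fun i => hξ i (k i)]
    exact P.rankOne_mem_posC _ _ _ (P.tauH_mem_fpar d p q fun i => hξ i (k i))
  exact h2 h1

end Tau

section Amp

variable (M : S.Reg) (p : S.bdry M ∈ P.Pol) (p' : S.bdry (S.revReg M) ∈ P.Pol)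

/-- On an element of rank one the partial sums of the probability map are absolute squares. -/
theorem amp_nonneg {σ : T.DR (S.bdry M)}
    (hσ : σ ∈ P.posD (S.rev_bdry M) (P.identU (S.rev_bdry M) p p'))
    (hd : σ ∈ ampDom ℝ (T.uReg M)) : 0 ≤ amp (T.uReg M) σ := by
  obtain ⟨κ, b, hb, hon⟩ := exists_adapted (P.J _ p) (P.J_J _ p) (P.J_fund _ p) (P.J_kip _ p)
  have h' : S.rev (S.bdry (S.revReg M)) = S.bdry M := by rw [← S.rev_bdry, S.rev_rev]
  have h1 := (Complex.continuous_re.tendsto _).comp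
    (tendsto_ampL (HasAmp.cplx (hasAmp_amp hd)) b hon)
  rw [Complex.ofReal_re] at h1
  classical
  refine ge_of_tendsto' h1 fun F => ?_
  refine P.posC_induction (S.rev_bdry M) p p'
    (f := fun τ => (ampL (T.uReg M) b (F.2 ×ˢ Finset.univ) τ).re)
    (Complex.continuous_re.comp (ampL (T.uReg M) b (F.2 ×ˢ Finset.univ)).continuous)
    (by rw [map_zero, Complex.zero_re]) (fun τ τ' => by rw [map_add, Complex.add_re])
    (fun ξ _ => ?_) ((P.mem_posD _ _ _ _).1 hσ) (conj_cplx σ)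
  rw [ampL_apply, rankOne, P.ampS_wedgeB M p (S.rev_bdry M) p' hb,
    P.flipD_iota (S.rev_bdry M) h', ampS_conj, Complex.mul_conj, Complex.ofReal_re]
  exact Complex.normSq_nonneg _

/-- The probability map vanishes in bidegree `(1, 1)`, since amplitudes of odd elements vanish. -/
theorem amp_eq_zero {σ : T.DR (S.bdry M)} (hσ : Fock.cplx σ ∈ P.bi (S.rev_bdry M) p p' 1 1)
    (hd : σ ∈ ampDom ℝ (T.uReg M)) : amp (T.uReg M) σ = 0 := by
  obtain ⟨κ, b, hb, hon⟩ := exists_adapted (P.J _ p) (P.J_J _ p) (P.J_fund _ p) (P.J_kip _ p)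
  have h1 := tendsto_ampL (HasAmp.cplx (hasAmp_amp hd)) b hon
  have h2 : ∀ I : Finset (κ × Bool), ∀ F : Finset κ, I = F ×ˢ Finset.univ →
      P.bi (S.rev_bdry M) p p' 1 1 ≤ (ampL (T.uReg M) b I).toLinearMap.ker := by
    rintro _ F rfl
    refine P.bi_le _ p p' (ampL (T.uReg M) b _).isClosed_ker fun ψ η hψ _ => ?_
    change ampL (T.uReg M) b (F ×ˢ Finset.univ) (P.wedgeB (S.rev_bdry M) p p' ψ η) = 0
    rw [ampL_apply, P.ampS_wedgeB M p (S.rev_bdry M) p' hb, ampS_odd _ _ _ (σ := ψ.1.fn) hψ,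
      zero_mul]
  classical
  have h3 := tendsto_nhds_unique h1
    (tendsto_const_nhds.congr fun F => (h2 _ F.2 rfl hσ).symm)
  exact Complex.ofReal_eq_zero.1 h3

end Amp

end Polarization

end FermionGBF

end

theorem mainTheorem3 {S : SpacetimeSystem} (T : FermionicTheory S) (P : Polarization T) :
    ∃ U : ∀ (s s' : S.Hyp) (_ : S.rev s = s') (p : s ∈ P.Pol) (p' : s' ∈ P.Pol),
        P.ModSq p p' ≃ₗᵢ[ℂ] T.DC s,
      -- the identification is the decomposition into holomorphic and anti-holomorphic parts
      (∀ s s' h p p' (ψ : P.H p) (η : P.H p'),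
        (U s s' h p p' (ctmul ψ η)).fn = wedge ψ.1.fn (T.flipD ℂ h η.1).fn) ∧
      -- the Krein space inner products agree, with the twist
      (∀ s s' h p p' (a b : ZMod 2) (ψ ψ' : P.H p) (η η' : P.H p'),
        η.1 ∈ Fock.fpar a → η'.1 ∈ Fock.fpar b →
        Fock.krein (U s s' h p p' (ctmul ψ' η')) (U s s' h p p' (ctmul ψ η)) =
          Fock.krein ψ'.1 ψ.1 * (fsgn b a * Fock.krein η'.1 η.1)) ∧
      -- the identifications of opposite orientations agree
      (∀ s s' h h' p p' (ψ : P.H p) (η : P.H p'),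
        T.flipD ℂ h' (U s s' h p p' (ctmul ψ η)) = U s' s h' p' p (ctmul η ψ)) ∧
      -- the real structures agree
      (∀ s s' h h' p p' (a b : ZMod 2) (ψ : P.H p) (η : P.H p'),
        ψ.1 ∈ Fock.fpar a → η.1 ∈ Fock.fpar b →
        Fock.conj (U s s' h p p' (ctmul ψ η)) =
          fsgn a b • U s s' h p p' (ctmul (P.iota h' p' p η) (P.iota h p p' ψ))) ∧
      -- the maps for decompositions of hypersurfaces agree
      (∀ (n : ℕ) (parts : Fin n → S.Hyp) (s : S.Hyp) (d : S.Dec parts s) (p : s ∈ P.Pol)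
        (q : ∀ i, parts i ∈ P.Pol) (a b : Fin n → ZMod 2) (ψ : ∀ i, P.H (q i))
        (η : ∀ i, P.H (P.rev_mem _ (q i))),
        (∀ i, (ψ i).1 ∈ Fock.fpar (a i)) → (∀ i, (η i).1 ∈ Fock.fpar (b i)) →
        ∃ (Ψ : P.H p) (Ε : P.H (P.rev_mem _ p)),
          Ψ.1.fn = T.tau d (fun i => (ψ i).1) ∧ Ε.1.fn = T.tau (S.revDec d) (fun i => (η i).1) ∧
          T.tau d (fun i => U _ _ rfl (q i) (P.rev_mem _ (q i)) (ctmul (ψ i) (η i))) =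
            (∏ i, ∏ j ∈ Finset.Ioi i, fsgn (b i) (a j) * fsgn (b i) (b j)) •
              (U _ _ rfl p (P.rev_mem _ p) (ctmul Ψ Ε)).fn) ∧
      -- the probability maps agree, and the common domain is dense
      (∀ (M : S.Reg) (p : S.bdry M ∈ P.Pol) (p' : S.bdry (S.revReg M) ∈ P.Pol),
        (∀ (m : ℕ) (ψ : Fin m → P.H p) (η : Fin m → P.H p'),
          (∀ k, (ψ k).1 ∈ ampDom ℂ (T.uReg M)) →
          (∀ k, (η k).1 ∈ ampDom ℂ (T.uReg (S.revReg M))) →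
          U _ _ (S.rev_bdry M) p p' (∑ k, ctmul (ψ k) (η k)) ∈ ampDom ℂ (T.uReg M) →
          amp (T.uReg M) (U _ _ (S.rev_bdry M) p p' (∑ k, ctmul (ψ k) (η k))) =
            ∑ k, amp (T.uReg M) (ψ k).1 * amp (T.uReg (S.revReg M)) (η k).1) ∧
        Dense {σ : T.DC (S.bdry M) | σ ∈ ampDom ℂ (T.uReg M) ∧
          ∃ (m : ℕ) (ψ : Fin m → P.H p) (η : Fin m → P.H p'),
            (∀ k, (ψ k).1 ∈ ampDom ℂ (T.uReg M)) ∧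
            (∀ k, (η k).1 ∈ ampDom ℂ (T.uReg (S.revReg M))) ∧
            σ = U _ _ (S.rev_bdry M) p p' (∑ k, ctmul (ψ k) (η k))}) ∧
      -- (R1+)
      (∀ s s' h p p',
        IsPositiveStructure (P.bigrD (U s s' h p p')) (P.posD h (U s s' h p p'))) ∧
      -- (R2+)
      (∀ (n : ℕ) (parts : Fin n → S.Hyp) (s : S.Hyp) (d : S.Dec parts s) (p : s ∈ P.Pol)
        (q : ∀ i, parts i ∈ P.Pol) (σ : ∀ i, T.DR (parts i)),
        (∀ i, σ i ∈ P.posD rfl (U _ _ rfl (q i) (P.rev_mem _ (q i)))) →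
        ∃ ρ ∈ P.posD rfl (U _ _ rfl p (P.rev_mem _ p)), ρ.fn = T.tau d σ ∧
          ((∀ i, Fock.fundF (σ i) = σ i) → Fock.fundF ρ = ρ)) ∧
      -- (R4+)
      (∀ (M : S.Reg) (p : S.bdry M ∈ P.Pol) (p' : S.bdry (S.revReg M) ∈ P.Pol),
        (∀ σ ∈ P.posD (S.rev_bdry M) (U _ _ (S.rev_bdry M) p p'),
          σ ∈ ampDom ℝ (T.uReg M) → 0 ≤ amp (T.uReg M) σ) ∧
        (∀ σ : T.DR (S.bdry M),
          Fock.cplx σ ∈ P.bigrD (U _ _ (S.rev_bdry M) p p') 1 1 →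
          σ ∈ ampDom ℝ (T.uReg M) → amp (T.uReg M) σ = 0)) := by
  refine ⟨fun _ _ h p p' => P.identU h p p', ?_, ?_, ?_, ?_, ?_, ?_, ?_, ?_, ?_⟩
  · intro s s' h p p' ψ η
    rw [P.identU_ctmul]
    rfl
  · intro s s' h p p' a b ψ ψ' η η' hη hη'
    rw [P.identU_ctmul, P.identU_ctmul]
    exact P.krein_wedgeB h p p' a b ψ ψ' η η' hη hη'
  · intro s s' h h' p p' ψ η
    rw [P.identU_ctmul, P.identU_ctmul]
    exact P.flipD_wedgeB h h' p p' ψ η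
  · intro s s' h h' p p' a b ψ η hψ hη
    rw [P.identU_ctmul, P.identU_ctmul]
    exact P.conj_wedgeB h h' p p' a b ψ η hψ hη
  · intro n parts s d p q a b ψ η hψ hη
    refine ⟨P.tauH d p q ψ, P.tauH (S.revDec d) (P.rev_mem _ p) (fun i => P.rev_mem _ (q i)) η,
      rfl, rfl, ?_⟩
    simp only [P.identU_ctmul]
    exact congrArg Fock.fn (P.tau_wedgeB d p q a b ψ η hψ hη)
  · exact fun M p p' => ⟨fun m ψ η => P.amp_identU M p p' m ψ η, P.dense_common_domain M p p'⟩
  · exact fun s s' h p p' => P.isPositiveStructure h p p'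
  · intro n parts s d p q σ hσ
    refine ⟨T.tauR d σ, P.tauR_mem_posD d p q hσ, rfl, fun hf => ?_⟩
    rw [T.fundF_tauR]
    simp only [hf]
  · exact fun M p p' => ⟨fun σ hσ hd => P.amp_nonneg M p p' hσ hd,
      fun σ hσ hd => P.amp_eq_zero M p p' hσ hd⟩
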